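/- **Graphs.** A (finite, unit) time-like graph (TLG) $\mathcal G=(\mathcal V,\mathcal E)$ is a finite multigraph whose vertices carry times in $[0,1]$, with exactly one vertex (called $0$) at time $0$ and exactly one vertex (called $1$) at time $1$, whose edges all go strictly forward in time, and in which every other vertex is the end of some edge and the beginning of some edge. A time-path is a sequence of consecutive edges traversed forward in time; a full time-path goes from $0$ to $1$. The family TLG$^*$ consists of the graphs obtained from the minimal graph (vertices $0,1$, one edge) by finitely many steps of the form (1) add a vertex in the interior of an edge, splitting this edge in two; (2) add a new edge between two vertices $t_j<t_k$ already connected by a time-path. Such a sequence of graphs is a TLG$^*$-tower. For vertices $u,v$, the interval $\mathcal G[u,v]$ consists of the vertices $w$ with (possibly trivial) time-paths from $u$ to $w$ and from $w$ to $v$, and of all edges between such vertices. A cell from $t_*$ to $t^*$ is a pair $(\sigma_1,\sigma_2)$ of distinct time-paths from $t_*$ to $t^*$ without common interior vertices; it is simple if no time-path (in either direction) joins an interior vertex of $\sigma_1$ and an interior vertex of $\sigma_2$; it is truly simple if no path at all (time-path or not) in $\mathcal G[t_*,t^*]\setminus\{t_*,t^*\}$ joins an interior vertex of $\sigma_1$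 and one of $\sigma_2$. **Processes.** A process on $\mathcal G$ is a family $(X(t))$ of real random variables indexed by the points $t$ of $\mathcal G$ (vertices, and interior points of edges); $X_\sigma$ is its restriction to a time-path $\sigma$. Let $\mathcal G$ be a TLG$^*$ and $\mathcal M=\{\mu_\sigma\}$ a family, indexed by the full time-paths $\sigma$ of $\mathcal G$, of laws of real RCLL processes on $[0,1]$, such that * (consistency) for full time-paths $\sigma_1,\sigma_2$, the laws $\mu_{\sigma_1},\mu_{\sigma_2}$ have the same restriction to the set of times at which $\sigma_1$ and $\sigma_2$ pass through the same point of $\mathcal G$; * (T3) whenever $(\sigma_1,\sigma_2)$ is a simple cell from $t_*$ to $t^*$ and $\sigma$ is a full time-path containing $\sigma_1$ or $\sigma_2$, a $\mu_\sigma$-distributed process $Y$ has the property that $(Y(t):t\in[0,t_*]\cup[t^*,1])$ and $(Y(t):t\in[t_*,t^*])$ are conditionally independent given $(Y(t_*),Y(t^*))$. The natural process $X$ on $\mathcal G$ is constructed along a TLG$^*$-tower $\mathcal G_0,\dots,\mathcal G_n=\mathcal G$ that starts with the minimal graph: on $\mathcal G_0$ it has the law $\mu_\sigma$ of the corresponding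 full time-path; adding a vertex changes nothing; when an edge $E^*$ from $t_j$ to $t_k$ is added to $\mathcal G_l$, one chooses a full time-path $\sigma$ through $E^*$, and the conditional law of $X_{E^*}$ given $X$ on all of $\mathcal G_l$ is $\mu_*(\cdot\mid X(t_j),X(t_k))$, where $\mu_*(\cdot\mid x,y)$ is the conditional law of $(Y(t):t\in[t_j,t_k])$ given $Y(t_j)=x$, $Y(t_k)=y$ for $Y$ with law $\mu_\sigma$. **Theorem.** For every such $\mathcal G$, $\mathcal M$ and tower, every process $X$ so constructed is strong cell-Markovian, that is, for every truly simple cell $(\sigma_1,\sigma_2)$ in $\mathcal G$ from $t_*$ to $t^*$: 1. $X_{\sigma_1}$ and $X_{\sigma_2}$ are conditionally independent given $(X(t_*),X(t^*))$; 2. $(X(t):t\in\mathcal G[t_*,t^*])$ and $(X(t):t\in\mathcal G[0,t_*]\cup\mathcal G[t^*,1])$ are conditionally independent given $(X(t_*),X(t^*))$. -/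

import Mathlib

open MeasureTheory ProbabilityTheory Set Filter Topology

noncomputable section

/-! ### Time-like graphs -/

/-- A (finite, unit) time-like graph: a finite multigraph whose vertices carry times in `[0,1]`,
with a unique vertex at time `0` and a unique vertex at time `1`, all of whose edges go strictly
forward in time, and in which every other vertex has an incoming and an outgoing edge. -/
structure TLG where
  V : Type
  E : Type
  [finV : Finite V]
  [finE : Finite E]
  time : V → unitInterval
  src : E → V
  tgt : E → V
  start : V
  finish : V
  time_start : time start = 0
  time_finish : time finish = 1
  time_pos : ∀ v, v ≠ start → 0 < time v
  time_lt_one : ∀ v, v ≠ finish → time v < 1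
  src_lt_tgt : ∀ e, time (src e) < time (tgt e)
  exists_incoming : ∀ v, v ≠ start → v ≠ finish → ∃ e, tgt e = v
  exists_outgoing : ∀ v, v ≠ start → v ≠ finish → ∃ e, src e = v

namespace TLG

variable (G : TLG)

/-- A point of the graph: a vertex, or a pair of an edge and a time strictly between the times of
its endpoints. (Endpoints of edges are identified with the vertices.) -/
inductive Point : Type
  | vertex (v : G.V) : Point
  | inner (e : G.E) (t : unitInterval) (h : G.time (G.src e) < t ∧ t < G.time (G.tgt e)) : Point

open Classical in
/-- The point `(e, t)` of the closed edge `e` at time `t` (with `t` clamped to the time interval of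
`e`). -/
def pt (e : G.E) (t : unitInterval) : G.Point :=
  if h : G.time (G.src e) < t ∧ t < G.time (G.tgt e) then .inner e t h
  else if t ≤ G.time (G.src e) then .vertex (G.src e) else .vertex (G.tgt e)

variable {G}

/-- `IsPath u l v`: the list of edges `l` is a time-path from `u` to `v` (the empty list is the
trivial time-path from a vertex to itself). -/
def IsPath : G.V → List G.E → G.V → Prop
  | u, [], v => u = v
  | u, e :: l, v => G.src e = u ∧ IsPath (G.tgt e) l v

/-- `u` and `v` are connected by a (possibly trivial) time-path from `u` to `v`. -/
def Reach (u v : G.V) : Prop := ∃ l : List G.E, IsPath u l v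

variable (G) in
/-- Full time-paths: time-paths from the vertex at time `0` to the vertex at time `1`. -/
def FullPath : Type := {l : List G.E // IsPath G.start l G.finish}

/-- The point at time `t` of a time-path `l` which starts at `u` (clamped outside the time interval
of the path). -/
def pathPoint : G.V → List G.E → unitInterval → G.Point
  | u, [], _ => .vertex u
  | _, e :: l, t => if t ≤ G.time (G.tgt e) then G.pt e t else pathPoint (G.tgt e) l t

/-- The point of a full time-path at time `t`. -/
def FullPath.point (σ : G.FullPath) (t : unitInterval) : G.Point := pathPoint G.start σ.1 t

/-- All points on the (closed) edges of a list of edges. -/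
def pathPoints (l : List G.E) : Set G.Point := {p | ∃ e ∈ l, ∃ t, p = G.pt e t}

/-! ### Intervals and cells -/

/-- Vertices of the interval graph `G[u,v]`. -/
def intervalV (u v : G.V) : Set G.V := {w | Reach u w ∧ Reach w v}

/-- Edges of the interval graph `G[u,v]`: those which connect two of its vertices. -/
def intervalE (u v : G.V) : Set G.E := {e | G.src e ∈ intervalV u v ∧ G.tgt e ∈ intervalV u v}

/-- Points of the interval graph `G[u,v]`. -/
def intervalPoints (u v : G.V) : Set G.Point :=
  {p | (∃ w ∈ intervalV u v, p = .vertex w) ∨ ∃ e ∈ intervalE u v, ∃ t, p = G.pt e t}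

/-- Interior vertices of a time-path (all its vertices except the first and the last one). -/
def interiorV (l : List G.E) : Set G.V := {w | w ∈ (l.map G.tgt).dropLast}

/-- `(l₁, l₂)` is a cell from `u` to `v`: two distinct co-terminal time-paths without common
interior vertices. (Distinctness forces both paths to be non-empty.) -/
structure IsCell (u v : G.V) (l₁ l₂ : List G.E) : Prop where
  left : IsPath u l₁ v
  right : IsPath u l₂ v
  ne : l₁ ≠ l₂
  disjoint : Disjoint (interiorV l₁) (interiorV l₂)

/-- A simple cell: no time-path joins the interiors of the two sides, in either direction. -/
structure IsSimpleCell (u v : G.V) (l₁ l₂ : List G.E) : Prop extends IsCell u v l₁ l₂ where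
  simple : ∀ a ∈ interiorV l₁, ∀ b ∈ interiorV l₂, ¬ Reach a b ∧ ¬ Reach b a

/-- `a` and `b` are neighbours in `G[u,v]` with the vertices `u` and `v` removed, the direction of
edges being ignored. -/
def InnerAdj (u v a b : G.V) : Prop :=
  a ≠ u ∧ a ≠ v ∧ b ≠ u ∧ b ≠ v ∧
    ∃ e ∈ intervalE u v, (G.src e = a ∧ G.tgt e = b) ∨ (G.src e = b ∧ G.tgt e = a)

/-- A truly simple cell: the interiors of the two sides are not joined by any path (time-path or
not) in `G[u,v]` with `u` and `v` removed. -/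
structure IsTrulySimpleCell (u v : G.V) (l₁ l₂ : List G.E) : Prop extends IsCell u v l₁ l₂ where
  trulySimple : ∀ a ∈ interiorV l₁, ∀ b ∈ interiorV l₂,
    ¬ Relation.ReflTransGen (InnerAdj u v) a b

/-! ### The TLG* family -/

/-- The minimal graph: two vertices, at times `0` and `1`, and one edge between them. -/
structure IsMinimal (G : TLG) : Prop where
  vertices : ∀ v : G.V, v = G.start ∨ v = G.finish
  edge : ∃! e : G.E, G.src e = G.start ∧ G.tgt e = G.finish
  edges : ∀ e : G.E, G.src e = G.start ∧ G.tgt e = G.finish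

/-- `G'` arises from `G` by adding a vertex at time `τ` on the edge `e₀`: the edge `e₀` is replaced
by a lower edge `onE (inr false)` and an upper edge `onE (inr true)`. -/
structure VertexStep (G G' : TLG) where
  e₀ : G.E
  τ : unitInterval
  lt_τ : G.time (G.src e₀) < τ
  τ_lt : τ < G.time (G.tgt e₀)
  onV : Option G.V ≃ G'.V
  onE : {e : G.E // e ≠ e₀} ⊕ Bool ≃ G'.E
  time_old : ∀ v, G'.time (onV (some v)) = G.time v
  time_new : G'.time (onV none) = τ
  start_eq : G'.start = onV (some G.start)
  finish_eq : G'.finish = onV (some G.finish)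
  src_old : ∀ e, G'.src (onE (.inl e)) = onV (some (G.src e.1))
  tgt_old : ∀ e, G'.tgt (onE (.inl e)) = onV (some (G.tgt e.1))
  src_lower : G'.src (onE (.inr false)) = onV (some (G.src e₀))
  tgt_lower : G'.tgt (onE (.inr false)) = onV none
  src_upper : G'.src (onE (.inr true)) = onV none
  tgt_upper : G'.tgt (onE (.inr true)) = onV (some (G.tgt e₀))

/-- `G'` arises from `G` by adding a new edge `onE none` from `j` to `k`, two vertices of `G` with
`time j < time k` which are connected by a time-path in `G`. -/
structure EdgeStep (G G' : TLG) where
  j : G.V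
  k : G.V
  time_lt : G.time j < G.time k
  connected : Reach j k
  onV : G.V ≃ G'.V
  onE : Option G.E ≃ G'.E
  time_eq : ∀ v, G'.time (onV v) = G.time v
  start_eq : G'.start = onV G.start
  finish_eq : G'.finish = onV G.finish
  src_old : ∀ e, G'.src (onE (some e)) = onV (G.src e)
  tgt_old : ∀ e, G'.tgt (onE (some e)) = onV (G.tgt e)
  src_new : G'.src (onE none) = onV j
  tgt_new : G'.tgt (onE none) = onV k

/-- A TLG*-tower which starts with the minimal graph and ends with `G`. -/
inductive Tower : TLG → Type 1
  | minimal {G : TLG} (h : IsMinimal G) : Tower G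
  | addVertex {G G' : TLG} (T : Tower G) (s : VertexStep G G') : Tower G'
  | addEdge {G G' : TLG} (T : Tower G) (s : EdgeStep G G') : Tower G'

variable (G) in
/-- `G` belongs to the TLG* family. -/
def IsStar : Prop := Nonempty (Tower G)

/-! ### How points and time-paths of `G` sit in the next graph of a tower -/

theorem IsPath.append {u v w : G.V} {l m : List G.E} (h : IsPath u l v) (h' : IsPath v m w) :
    IsPath u (l ++ m) w := by
  induction l generalizing u with
  | nil => cases h; exact h'
  | cons e l ih => exact ⟨h.1, ih h.2⟩

namespace VertexStep

variable {G G' : TLG} (s : VertexStep G G')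

/-- The lower half of the subdivided edge. -/
def lower : G'.E := s.onE (.inr false)

/-- The upper half of the subdivided edge. -/
def upper : G'.E := s.onE (.inr true)

open Classical in
/-- The identification of the points of `G` with those of `G'` (same representation). -/
def onPoint : G.Point → G'.Point
  | .vertex v => .vertex (s.onV (some v))
  | .inner e t _ =>
    if h : e = s.e₀ then (if t ≤ s.τ then G'.pt s.lower t else G'.pt s.upper t)
    else G'.pt (s.onE (.inl ⟨e, h⟩)) t

open Classical in
/-- The time-path of `G'` with the same representation as an edge of `G`. -/
def onEdge (e : G.E) : List G'.E :=
  if h : e = s.e₀ then [s.lower, s.upper] else [s.onE (.inl ⟨e, h⟩)]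

theorem isPath_flatMap {u v : G.V} {l : List G.E} (h : IsPath u l v) :
    IsPath (s.onV (some u)) (l.flatMap s.onEdge) (s.onV (some v)) := by
  induction l generalizing u with
  | nil => cases h; rfl
  | cons e l ih =>
    obtain ⟨rfl, h⟩ := h
    rw [List.flatMap_cons]
    refine IsPath.append ?_ (ih h)
    by_cases he : e = s.e₀
    · subst he
      simp [onEdge, IsPath, lower, upper, s.src_lower, s.tgt_lower, s.src_upper, s.tgt_upper]
    · simp [onEdge, he, IsPath, s.src_old, s.tgt_old]

/-- The full time-path of `G'` with the same representation as a full time-path of `G`. -/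
def onFullPath (σ : G.FullPath) : G'.FullPath :=
  ⟨σ.1.flatMap s.onEdge, by
    rw [s.start_eq, s.finish_eq]; exact s.isPath_flatMap σ.2⟩

end VertexStep

namespace EdgeStep

variable {G G' : TLG} (s : EdgeStep G G')

/-- The new edge. -/
def newEdge : G'.E := s.onE none

/-- The inclusion of the points of `G` into those of `G'`. -/
def onPoint : G.Point → G'.Point
  | .vertex v => .vertex (s.onV v)
  | .inner e t _ => G'.pt (s.onE (some e)) t

theorem isPath_map {u v : G.V} {l : List G.E} (h : IsPath u l v) :
    IsPath (s.onV u) (l.map fun e => s.onE (some e)) (s.onV v) := by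
  induction l generalizing u with
  | nil => cases h; rfl
  | cons e l ih =>
    obtain ⟨rfl, h⟩ := h
    exact ⟨s.src_old e, by rw [s.tgt_old]; exact ih h⟩

/-- The inclusion of the full time-paths of `G` into those of `G'`. -/
def onFullPath (σ : G.FullPath) : G'.FullPath :=
  ⟨σ.1.map fun e => s.onE (some e), by
    rw [s.start_eq, s.finish_eq]; exact s.isPath_map σ.2⟩

end EdgeStep

end TLG

/-! ### Conditional independence, path space and families of path distributions -/

/-- The `σ`-algebra generated by the random variables `X p`, `p ∈ A`. -/
@[reducible] def sigmaOf {Ω ι : Type*} (X : ι → Ω → ℝ) (A : Set ι) : MeasurableSpace Ω :=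
  ⨆ p ∈ A, MeasurableSpace.comap (X p) inferInstance

/-- The `σ`-algebras `m₁` and `m₂` are conditionally independent given `m`. -/
def CondIndepGiven {Ω : Type*} {m0 : MeasurableSpace Ω} (P : Measure Ω)
    (m m₁ m₂ : MeasurableSpace Ω) : Prop :=
  ∀ A B : Set Ω, MeasurableSet[m₁] A → MeasurableSet[m₂] B →
    P⟦A ∩ B | m⟧ =ᵐ[P] fun ω => (P⟦A | m⟧) ω * (P⟦B | m⟧) ω

/-- Right-continuous functions with left limits on `[0,1]`. -/
def IsRCLL (f : unitInterval → ℝ) : Prop :=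
  ∀ t, ContinuousWithinAt f (Ici t) t ∧ ∃ y, Tendsto f (𝓝[<] t) (𝓝 y)

/-- The space of RCLL paths on `[0,1]`, with the `σ`-algebra generated by the evaluations. -/
abbrev RCLLPath : Type := {f : unitInterval → ℝ // IsRCLL f}

/-- The coordinate process on the space of RCLL paths. -/
def coord (t : unitInterval) (f : RCLLPath) : ℝ := f.1 t

namespace TLG

variable {G : TLG}

/-- The family `μ` is consistent: the laws on two full time-paths agree on the set of times at which
the two time-paths pass through the same point of the graph. -/
def IsConsistent (μ : G.FullPath → Measure RCLLPath) : Prop :=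
  ∀ σ₁ σ₂ : G.FullPath,
    (μ σ₁).map (fun f (t : {t : unitInterval // σ₁.point t = σ₂.point t}) => coord t f) =
    (μ σ₂).map (fun f (t : {t : unitInterval // σ₁.point t = σ₂.point t}) => coord t f)

/-- The (3T) conditions: `G` is a TLG*; the family `μ` is a consistent family of laws of RCLL
processes; and for every full time-path containing a side of a simple cell from `u` to `v`, the
process on it between the times of `u` and `v` and the process on it outside these times are
conditionally independent given its values at the times of `u` and `v`. -/
structure ThreeT (G : TLG) (μ : G.FullPath → Measure RCLLPath) : Prop where
  star : IsStar G
  prob : ∀ σ, IsProbabilityMeasure (μ σ)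
  consistent : IsConsistent μ
  markov : ∀ (u v : G.V) (l₁ l₂ : List G.E), IsSimpleCell u v l₁ l₂ →
    ∀ σ : G.FullPath, (l₁ <:+: σ.1 ∨ l₂ <:+: σ.1) →
      CondIndepGiven (μ σ) (sigmaOf coord {G.time u, G.time v})
        (sigmaOf coord (Icc 0 (G.time u) ∪ Icc (G.time v) 1))
        (sigmaOf coord (Icc (G.time u) (G.time v)))

/-! ### The construction -/

/-- `κ` is a version of the conditional law of `(Y(t) : t ∈ [a,b])` given `(Y(a), Y(b))`, when `Y`
has law `ν`. -/
def IsBridgeKernel (ν : Measure RCLLPath) (a b : unitInterval)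
    (κ : Kernel (ℝ × ℝ) (Icc a b → ℝ)) : Prop :=
  IsMarkovKernel κ ∧
    ν.map (fun f => ((coord a f, coord b f), fun t : Icc a b => coord t f)) =
      (ν.map fun f => (coord a f, coord b f)) ⊗ₘ κ

/-- The pair of values of a function on the points of `G` at two vertices. -/
def evalPair (j k : G.V) (x : G.Point → ℝ) : ℝ × ℝ := (x (.vertex j), x (.vertex k))

theorem measurable_evalPair (j k : G.V) : Measurable (evalPair j k) :=
  (measurable_pi_apply _).prodMk (measurable_pi_apply _)

/-- `X` is constructed along the given tower from the family `μ`.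

* On the minimal graph `X` has the prescribed law.
* When a vertex is added, nothing changes.
* When an edge from `j` to `k` is added, for some full time-path `σ` through the new edge the
  conditional law of `X` on the new edge, given `X` on all of the previous graph, is
  `μ_*(· | X(j), X(k))`, with `μ_*(· | x, y)` the conditional law of a `μ σ`-distributed process on
  `[time j, time k]` given that it has the values `x` and `y` at the end points. -/
def IsConstructed {Ω : Type*} [MeasurableSpace Ω] (P : Measure Ω) :
    {G : TLG} → Tower G → (G.FullPath → Measure RCLLPath) → (G.Point → Ω → ℝ) → Prop
  | G, .minimal _, μ, X =>
      ∀ σ : G.FullPath, P.map (fun ω t => X (σ.point t) ω) = (μ σ).map (fun f t => coord t f)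
  | _, .addVertex T s, μ, X =>
      IsConstructed P T (fun σ => μ (s.onFullPath σ)) (fun p => X (s.onPoint p))
  | G', .addEdge (G := G) T s, μ, X =>
      IsConstructed P T (fun σ => μ (s.onFullPath σ)) (fun p => X (s.onPoint p)) ∧
      ∃ σ : G'.FullPath, s.newEdge ∈ σ.1 ∧
        ∃ κ : Kernel (ℝ × ℝ) (Icc (G.time s.j) (G.time s.k) → ℝ),
          IsBridgeKernel (μ σ) (G.time s.j) (G.time s.k) κ ∧
          P.map (fun ω => ((fun p : G.Point => X (s.onPoint p) ω),
              fun t : Icc (G.time s.j) (G.time s.k) => X (G'.pt s.newEdge t) ω)) =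
            (P.map fun ω (p : G.Point) => X (s.onPoint p) ω) ⊗ₘ
              (κ.comap (evalPair s.j s.k) (measurable_evalPair s.j s.k))

/-! ### Cell-Markov properties -/

/-- The two sides of every truly simple cell are conditionally independent given the values at its
end vertices. -/
def IsCellMarkov {Ω : Type*} [MeasurableSpace Ω] (P : Measure Ω) (X : G.Point → Ω → ℝ) : Prop :=
  ∀ (u v : G.V) (l₁ l₂ : List G.E), IsTrulySimpleCell u v l₁ l₂ →
    CondIndepGiven P (sigmaOf X {.vertex u, .vertex v})
      (sigmaOf X (pathPoints l₁)) (sigmaOf X (pathPoints l₂))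

/-- Cell-Markovian, and moreover for every truly simple cell from `u` to `v` the process on `G[u,v]`
and the process on `G[0,u] ∪ G[v,1]` are conditionally independent given the values at `u` and
`v`. -/
def IsStrongCellMarkov {Ω : Type*} [MeasurableSpace Ω] (P : Measure Ω) (X : G.Point → Ω → ℝ) :
    Prop :=
  IsCellMarkov P X ∧
  ∀ (u v : G.V) (l₁ l₂ : List G.E), IsTrulySimpleCell u v l₁ l₂ →
    CondIndepGiven P (sigmaOf X {.vertex u, .vertex v})
      (sigmaOf X (intervalPoints u v))
      (sigmaOf X (intervalPoints G.start u ∪ intervalPoints v G.finish))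

end TLG

end

/-! ### Calculus of conditional independence -/

section CondIndep

variable {Ω : Type*} {m0 : MeasurableSpace Ω} {P : Measure Ω}

/-! Only the points of the graph and its full time-paths matter, so a graph is replaced by the
family `F` of its full time-paths, seen as functions from `[0,1]` to points. Adding a vertex does
not change `F`. Adding an edge from `j` to `k` adds the paths in which the new edge replaces the
segment of an old path between `j` and `k` (`addConnection`). The rest is induction along this
construction, with conditional independence handled by symmetry, weakening and contraction.

First, `X` has the law μ_σ along every full time-path σ (`Constructed.map_eq`). The new edge and the
old segment it bypasses form a simple cell (`isSimplePair_splice`), so by (T3) the law on the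
spliced path is determined by its bridge between `j` and `k` and its law at the other times. Both
agree with those of `X`, by construction, consistency and induction. Hence (T3) passes to `X`: a
bypassed segment is independent of the rest of its path given the values on `J = {j, k}`. This, and
the fact that the new edge `N` depends on the old process only through `J`, is all that the two
inductions below use (`MarkovBuilt`).

The second assertion does not lend itself to induction as it stands, because the ends of a cell need
not be the ends of a cell at an earlier stage. The invariant is `SpineMarkov`: for every path σ and
all `s ≤ t`, the interval `I` between σ(s) and σ(t) and its exterior `O` are conditionally
independent given `X` on σ[s,t], and also given `X` on the rest of σ, its ends included. For a
single path both are trivial. For old end points, `N` can meet only one of `I` and `O`, and then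
both its ends lie there, so `N` can be attached to that part. If the path itself runs along `N`, the
bypassed segment must first be dropped from the conditioning; `Ind.drop` does so with the Markov
property of that segment and the other half of the invariant. Finally, at a truly simple cell, (T3)
makes the inside and the outside of σ conditionally independent given the end values, and the two
halves of the invariant extend this to `I` and `O` (`SpineMarkov.ind_between_beyond`).

The first assertion is a separate induction (`MarkovBuilt.ind_cell`). At most one side of a truly
simple cell uses the new edge, and then all of it. If that side is the new edge, independence is
built in. Otherwise the bypassed segment is put back: it is linked to a retained interior point of
the side, so the old pair is still truly simple, and `N` is attached to the independence known for
it. -/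

theorem integrable_indicator_one [IsProbabilityMeasure P] {B : Set Ω} (hB : MeasurableSet B) :
    Integrable (B.indicator fun _ => (1 : ℝ)) P :=
  (integrable_const 1).indicator hB

/-- Two integrable functions with equal integrals over the intersections `C ∩ A`, with `C ∈ m` and
`A ∈ m₁`, have equal integrals over all sets of `m ⊔ m₁`. -/
theorem setIntegral_eq_of_sup {m m₁ : MeasurableSpace Ω} (hm : m ≤ m0) (hm₁ : m₁ ≤ m0)
    {f g : Ω → ℝ} (hf : Integrable f P) (hg : Integrable g P)
    (h : ∀ C A, MeasurableSet[m] C → MeasurableSet[m₁] A →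
      ∫ ω in C ∩ A, f ω ∂P = ∫ ω in C ∩ A, g ω ∂P)
    (D : Set Ω) (hD : MeasurableSet[m ⊔ m₁] D) : ∫ ω in D, f ω ∂P = ∫ ω in D, g ω ∂P := by
  let S : Set (Set Ω) := {s | ∃ C A, MeasurableSet[m] C ∧ MeasurableSet[m₁] A ∧ s = C ∩ A}
  have hS : m ⊔ m₁ = MeasurableSpace.generateFrom S := by
    apply le_antisymm
    · refine sup_le (fun C hC => ?_) (fun A hA => ?_)
      · exact MeasurableSpace.measurableSet_generateFrom
          ⟨C, univ, hC, @MeasurableSet.univ _ m₁, (inter_univ C).symm⟩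
      · exact MeasurableSpace.measurableSet_generateFrom
          ⟨univ, A, @MeasurableSet.univ _ m, hA, (univ_inter A).symm⟩
    · refine MeasurableSpace.generateFrom_le ?_
      rintro _ ⟨C, A, hC, hA, rfl⟩
      exact MeasurableSet.inter ((le_sup_left : m ≤ m ⊔ m₁) C hC)
        ((le_sup_right : m₁ ≤ m ⊔ m₁) A hA)
  have hpi : IsPiSystem S := by
    rintro _ ⟨C, A, hC, hA, rfl⟩ _ ⟨C', A', hC', hA', rfl⟩ _
    exact ⟨C ∩ C', A ∩ A', hC.inter hC', hA.inter hA', by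
      ext; simp only [mem_inter_iff]; tauto⟩
  have hle : m ⊔ m₁ ≤ m0 := sup_le hm hm₁
  induction D, hD using MeasurableSpace.induction_on_inter hS hpi with
  | empty => simp
  | basic s hs =>
    obtain ⟨C, A, hC, hA, rfl⟩ := hs
    exact h C A hC hA
  | compl s hs ih =>
    have h1 := integral_add_compl (hle s hs) hf
    have h2 := integral_add_compl (hle s hs) hg
    have h3 := h univ univ (@MeasurableSet.univ _ m) (@MeasurableSet.univ _ m₁)
    simp only [inter_univ, Measure.restrict_univ] at h3
    linarith
  | iUnion s hd hs ih =>
    rw [integral_iUnion (fun i => hle _ (hs i)) hd hf.integrableOn,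
      integral_iUnion (fun i => hle _ (hs i)) hd hg.integrableOn]
    exact tsum_congr ih

theorem condExp_indicator_mul [IsProbabilityMeasure P] {m : MeasurableSpace Ω} {A : Set Ω}
    (hA : MeasurableSet[m0] A) (f : Ω → ℝ) (hf : StronglyMeasurable[m] f) (hfi : Integrable f P) :
    P[A.indicator f | m] =ᵐ[P] fun ω => (P⟦A | m⟧) ω * f ω := by
  have e : A.indicator f = f * A.indicator fun _ => (1 : ℝ) := by
    ext ω; by_cases h : ω ∈ A <;> simp [h]
  rw [e]
  refine (condExp_mul_of_stronglyMeasurable_left hf ?_ (integrable_indicator_one hA)).trans ?_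
  · rw [← e]; exact hfi.indicator hA
  · exact .of_forall fun ω => mul_comm _ _

/-- The asymmetric form, in which contraction is a chain of equalities. Forward, pulling out the
indicator of `A` gives the right integrals over the sets `C ∩ A`, which determine those over `m ⊔
m₁`. Backward, it is the tower property through `m ⊔ m₁`. -/
theorem condIndepGiven_iff [IsProbabilityMeasure P] {m m₁ m₂ : MeasurableSpace Ω} (hm : m ≤ m0) (hm₁ : m₁ ≤ m0)
    (hm₂ : m₂ ≤ m0) :
    CondIndepGiven P m m₁ m₂ ↔ ∀ B, MeasurableSet[m₂] B → P⟦B | m ⊔ m₁⟧ =ᵐ[P] P⟦B | m⟧ := by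
  have hle : m ⊔ m₁ ≤ m0 := sup_le hm hm₁
  constructor
  · intro H B hB
    have iB := integrable_indicator_one (P := P) (hm₂ B hB)
    refine (ae_eq_condExp_of_forall_setIntegral_eq hle iB
      (fun _ _ _ => integrable_condExp.integrableOn) ?_
      (stronglyMeasurable_condExp.mono (le_sup_left : m ≤ m ⊔ m₁)).aestronglyMeasurable).symm
    intro D hD _
    refine setIntegral_eq_of_sup hm hm₁ integrable_condExp iB (fun C A hC hA => ?_) D hD
    have hA' := hm₁ A hA
    rw [← setIntegral_indicator hA', ← setIntegral_indicator hA',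
      ← setIntegral_condExp hm (integrable_condExp.indicator hA') hC,
      ← setIntegral_condExp hm (iB.indicator hA') hC]
    refine setIntegral_congr_ae (hm C hC) ?_
    have e : A.indicator (B.indicator fun _ => (1 : ℝ)) = (A ∩ B).indicator fun _ => 1 := by
      rw [indicator_indicator]
    rw [e]
    filter_upwards [H A B hA hB, condExp_indicator_mul (P := P) hA' (P⟦B | m⟧)
      stronglyMeasurable_condExp integrable_condExp] with ω h1 h2 _
    rw [h1, h2]
  · intro H A B hA hB
    have hA' := hm₁ A hA
    have iB := integrable_indicator_one (P := P) (hm₂ B hB)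
    have e : (A ∩ B).indicator (fun _ => (1 : ℝ)) =
        (A.indicator fun _ => (1 : ℝ)) * B.indicator fun _ => 1 := by
      ext ω; by_cases h : ω ∈ A <;> by_cases h' : ω ∈ B <;> simp [h, h']
    have h1 : P⟦A ∩ B | m ⊔ m₁⟧ =ᵐ[P] A.indicator (P⟦B | m⟧) := by
      rw [e]
      refine (condExp_mul_of_stronglyMeasurable_left ?_ ?_ iB).trans ?_
      · exact stronglyMeasurable_const.indicator ((le_sup_right : m₁ ≤ m ⊔ m₁) A hA)
      · rw [← e]; exact integrable_indicator_one (hA'.inter (hm₂ B hB))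
      · filter_upwards [H B hB] with ω hω
        rw [Pi.mul_apply, hω]
        by_cases h : ω ∈ A <;> simp [h]
    calc P⟦A ∩ B | m⟧ =ᵐ[P] P[P⟦A ∩ B | m ⊔ m₁⟧ | m] :=
          (condExp_condExp_of_le le_sup_left hle).symm
      _ =ᵐ[P] P[A.indicator (P⟦B | m⟧) | m] := condExp_congr_ae h1
      _ =ᵐ[P] _ := condExp_indicator_mul hA' _ stronglyMeasurable_condExp integrable_condExp

theorem CondIndepGiven.symm {m m₁ m₂ : MeasurableSpace Ω} (h : CondIndepGiven P m m₁ m₂) :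
    CondIndepGiven P m m₂ m₁ := by
  intro A B hA hB
  rw [inter_comm]
  filter_upwards [h B A hB hA] with ω hω
  rw [hω, mul_comm]

/-- A conditional expectation which is measurable with respect to a smaller `σ`-algebra is the
conditional expectation given any intermediate one. -/
theorem condExp_eq_of_le_of_le [IsProbabilityMeasure P] {m m' m'' : MeasurableSpace Ω} (h : m ≤ m') (h' : m' ≤ m'')
    (h'' : m'' ≤ m0) {f g : Ω → ℝ} (hg : StronglyMeasurable[m] g) (hgi : Integrable g P)
    (H : P[f | m''] =ᵐ[P] g) : P[f | m'] =ᵐ[P] g :=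
  calc P[f | m'] =ᵐ[P] P[P[f | m''] | m'] := (condExp_condExp_of_le h' h'').symm
    _ =ᵐ[P] P[g | m'] := condExp_congr_ae H
    _ =ᵐ[P] g := by
      rw [condExp_of_stronglyMeasurable (h'.trans h'') (hg.mono h) hgi]

/-- The criterion for the new edge: its construction gives an `m`-measurable version of the
conditional probability, namely the kernel at the end values, which need not be identified
beforehand with the one given `m`. -/
theorem CondIndepGiven.of_condExp_eq [IsProbabilityMeasure P] {m m₁ m₂ : MeasurableSpace Ω} (hm : m ≤ m0) (hm₁ : m₁ ≤ m0)
    (hm₂ : m₂ ≤ m0) (H : ∀ B, MeasurableSet[m₂] B → ∃ g : Ω → ℝ, StronglyMeasurable[m] g ∧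
      Integrable g P ∧ P⟦B | m ⊔ m₁⟧ =ᵐ[P] g) : CondIndepGiven P m m₁ m₂ := by
  refine (condIndepGiven_iff hm hm₁ hm₂).2 fun B hB => ?_
  obtain ⟨g, hg, hgi, h⟩ := H B hB
  exact h.trans (condExp_eq_of_le_of_le le_rfl le_sup_left (sup_le hm hm₁) hg hgi h).symm

end CondIndep

/-! ### `σ`-algebras generated by families of random variables -/

section SigmaOf

variable {Ω ι : Type*} {m0 : MeasurableSpace Ω} {X : ι → Ω → ℝ}

theorem sigmaOf_mono {A B : Set ι} (h : A ⊆ B) : sigmaOf X A ≤ sigmaOf X B :=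
  biSup_mono h

theorem sigmaOf_union (A B : Set ι) : sigmaOf X (A ∪ B) = sigmaOf X A ⊔ sigmaOf X B :=
  iSup_union

theorem sigmaOf_le (hX : ∀ p, Measurable (X p)) (A : Set ι) : sigmaOf X A ≤ m0 :=
  iSup₂_le fun p _ => (hX p).comap_le

theorem sigmaOf_image {κ : Type*} (f : κ → ι) (A : Set κ) :
    sigmaOf X (f '' A) = sigmaOf (fun p => X (f p)) A :=
  iSup_image

theorem comap_sigmaOf {Ω' : Type*} (f : Ω' → Ω) (A : Set ι) :
    (sigmaOf X A).comap f = sigmaOf (fun p ω => X p (f ω)) A := by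
  simp only [sigmaOf, MeasurableSpace.comap_iSup, MeasurableSpace.comap_comp]
  rfl

theorem comap_tuple {κ : Type*} (f : κ → ι) :
    MeasurableSpace.comap (fun ω (k : κ) => X (f k) ω) inferInstance = sigmaOf X (range f) := by
  simp only [sigmaOf, iSup_range]
  simp only [MeasurableSpace.pi, MeasurableSpace.comap_iSup, MeasurableSpace.comap_comp]
  rfl

end SigmaOf

/-! ### Conditional independence of parts of a process -/

/-- The parts `A` and `B` of a process are conditionally independent given the part `C`. -/
def Ind {Ω ι : Type*} {m0 : MeasurableSpace Ω} (P : Measure Ω) (X : ι → Ω → ℝ) (C A B : Set ι) :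
    Prop :=
  CondIndepGiven P (sigmaOf X C) (sigmaOf X A) (sigmaOf X B)

namespace Ind

variable {Ω ι : Type*} {m0 : MeasurableSpace Ω} {P : Measure Ω} {X : ι → Ω → ℝ}
  {A B C D A' B' C' : Set ι}

theorem image {κ : Type*} {f : κ → ι} {A B C : Set κ} :
    Ind P X (f '' C) (f '' A) (f '' B) ↔ Ind P (fun p => X (f p)) C A B := by
  simp only [Ind, sigmaOf_image]

theorem symm (h : Ind P X C A B) : Ind P X C B A :=
  CondIndepGiven.symm h

variable [IsProbabilityMeasure P] (hX : ∀ p, Measurable (X p))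
include hX

theorem iff_condExp : Ind P X C A B ↔
    ∀ E, MeasurableSet[sigmaOf X B] E → P⟦E | sigmaOf X (C ∪ A)⟧ =ᵐ[P] P⟦E | sigmaOf X C⟧ := by
  rw [Ind, condIndepGiven_iff (sigmaOf_le hX _) (sigmaOf_le hX _) (sigmaOf_le hX _),
    sigmaOf_union]

/-- By the tower property, events of `B` have the same conditional probability given any part
between `C` and `C ∪ A`. -/
theorem mono_left (h : Ind P X C A B) (hC : C ⊆ C') (hC' : C' ⊆ C ∪ A) (hA : A' ⊆ C ∪ A) :
    Ind P X C' A' B := by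
  rw [iff_condExp hX] at h ⊢
  intro E hE
  have key : ∀ D, C ⊆ D → D ⊆ C ∪ A → P⟦E | sigmaOf X D⟧ =ᵐ[P] P⟦E | sigmaOf X C⟧ :=
    fun D h1 h2 => condExp_eq_of_le_of_le (sigmaOf_mono h1) (sigmaOf_mono h2) (sigmaOf_le hX _)
      stronglyMeasurable_condExp integrable_condExp (h E hE)
  exact (key _ (hC.trans subset_union_left) (union_subset hC' hA)).trans (key _ hC hC').symm

/-- Decomposition and weak union. -/
theorem weaken (h : Ind P X C A B) (hC : C ⊆ C') (hC' : C' ⊆ C ∪ A ∪ B) (hA : A' ⊆ A ∪ C')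
    (hB : B' ⊆ B ∪ C') : Ind P X C' A' B' := by
  -- The new conditioning points are absorbed in two rounds: those in `A` here, the remaining ones,
  -- in `B`, after exchanging the roles of the two parts.
  have h1 : Ind P X (C ∪ (C' ∩ A)) (C ∪ A) B :=
    h.mono_left hX subset_union_left
      (union_subset_union_right _ inter_subset_right) subset_rfl
  have hC1 : C' ⊆ C ∪ (C' ∩ A) ∪ B := fun x hx => by
    rcases hC' hx with (h | h) | h
    · exact .inl (.inl h)
    · exact .inl (.inr ⟨hx, h⟩)
    · exact .inr h
  have h2 : Ind P X C' B' (C ∪ A) :=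
    h1.symm.mono_left hX (union_subset hC inter_subset_left) hC1 fun x hx => by
      rcases hB hx with h | h
      · exact .inr h
      · exact hC1 h
  exact h2.symm.mono_left hX subset_rfl subset_union_left fun x hx => by
    rcases hA hx with h | h
    · exact .inr (.inr h)
    · exact .inl h

/-- The graph arguments need only this rule, symmetry, weakening and the trivial cases below. The
intersection rule, which fails for general laws, is not available. -/
theorem contraction (h : Ind P X C A B) (h' : Ind P X (C ∪ A) D B) : Ind P X C (A ∪ D) B := by
  rw [iff_condExp hX] at h h' ⊢
  intro E hE
  rw [← union_assoc]
  exact (h' E hE).trans (h E hE)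

theorem of_subset_left (h : A ⊆ C) : Ind P X C A B := by
  rw [iff_condExp hX]
  intro E _
  rw [union_eq_self_of_subset_right h]

theorem of_subset_right (h : B ⊆ C) : Ind P X C A B :=
  (of_subset_left hX h).symm

end Ind

/-! ### Conditional independence and image measures -/

theorem condExp_map_comp {Ω Ω' : Type*} {m0 : MeasurableSpace Ω} {m m0' : MeasurableSpace Ω'}
    {P : Measure Ω} [IsProbabilityMeasure P] {f : Ω → Ω'} (hf : Measurable f)
    (hm : m ≤ m0') {g : Ω' → ℝ} (hg : Integrable g (P.map f)) :
    P[g ∘ f | m.comap f] =ᵐ[P] ((P.map f)[g | m]) ∘ f := by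
  have := Measure.isProbabilityMeasure_map (μ := P) hf.aemeasurable
  have hle : m.comap f ≤ m0 := (MeasurableSpace.comap_mono hm).trans hf.comap_le
  have hc : Integrable ((P.map f)[g | m]) (P.map f) := integrable_condExp
  refine (ae_eq_condExp_of_forall_setIntegral_eq hle (hg.comp_measurable hf)
    (fun _ _ _ => (hc.comp_measurable hf).integrableOn) ?_ ?_).symm
  · rintro _ ⟨D, hD, rfl⟩ _
    have e1 := setIntegral_map (hm D hD) hc.aestronglyMeasurable hf.aemeasurable
    have e2 := setIntegral_map (hm D hD) hg.aestronglyMeasurable hf.aemeasurable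
    simp only [Function.comp_apply]
    rw [← e1, ← e2, setIntegral_condExp hm hg hD]
  · have h1 : StronglyMeasurable[m] ((P.map f)[g | m]) := stronglyMeasurable_condExp
    exact (h1.comp_measurable (comap_measurable f)).aestronglyMeasurable

/-- Conditional independence depends on the joint law alone. This carries (T3), a property of μ_σ,
over to `X` along σ once the two laws are known to agree. -/
theorem Ind.map_iff {Ω Ω' ι : Type*} {m0 : MeasurableSpace Ω} {m0' : MeasurableSpace Ω'}
    {P : Measure Ω} [IsProbabilityMeasure P] {f : Ω → Ω'} (hf : Measurable f)
    {Y : ι → Ω' → ℝ} (hY : ∀ p, Measurable (Y p)) {C A B : Set ι} :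
    Ind (P.map f) Y C A B ↔ Ind P (fun p ω => Y p (f ω)) C A B := by
  have := Measure.isProbabilityMeasure_map (μ := P) hf.aemeasurable
  rw [Ind.iff_condExp hY, Ind.iff_condExp (X := fun p ω => Y p (f ω)) fun p => (hY p).comp hf]
  have hs : ∀ D : Set ι, sigmaOf (fun p ω => Y p (f ω)) D = (sigmaOf Y D).comap f :=
    fun D => (comap_sigmaOf f D).symm
  simp only [hs]
  have key : ∀ D : Set ι, ∀ E, MeasurableSet[sigmaOf Y B] E →
      P⟦f ⁻¹' E | (sigmaOf Y D).comap f⟧ =ᵐ[P] ((P.map f)⟦E | sigmaOf Y D⟧) ∘ f :=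
    fun D E hE => condExp_map_comp hf (sigmaOf_le hY D)
      (integrable_indicator_one (sigmaOf_le hY B E hE))
  have hms : ∀ D : Set ι, ∀ E, Measurable ((P.map f)⟦E | sigmaOf Y D⟧) := fun D E =>
    (stronglyMeasurable_condExp.mono (sigmaOf_le hY D)).measurable
  have ae : ∀ E, ((P.map f)⟦E | sigmaOf Y (C ∪ A)⟧ =ᵐ[P.map f] (P.map f)⟦E | sigmaOf Y C⟧) ↔
      ((P.map f)⟦E | sigmaOf Y (C ∪ A)⟧) ∘ f =ᵐ[P] ((P.map f)⟦E | sigmaOf Y C⟧) ∘ f := fun E =>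
    ae_map_iff hf.aemeasurable (measurableSet_eq_fun (hms _ _) (hms _ _))
  constructor
  · intro h E' hE'
    rw [hs] at hE'
    obtain ⟨E, hE, rfl⟩ := hE'
    exact (key _ E hE).trans (((ae E).1 (h E hE)).trans (key _ E hE).symm)
  · intro h E hE
    refine (ae E).2 ((key _ E hE).symm.trans ((h (f ⁻¹' E) ?_).trans (key _ E hE)))
    rw [hs]
    exact ⟨E, hE, rfl⟩

/-! ### Disintegration of joint laws and conditional probabilities -/

section Kernel

variable {Ω S T : Type*} {m0 : MeasurableSpace Ω} [mS : MeasurableSpace S] [MeasurableSpace T]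
  {P : Measure Ω} [IsProbabilityMeasure P] {U : Ω → S} {V : Ω → T} {κ : Kernel S T}

theorem measurable_kernel_real {B : Set T} (hB : MeasurableSet B) :
    Measurable fun s => (κ s).real B :=
  (κ.measurable_coe hB).ennreal_toReal

variable [IsMarkovKernel κ]

theorem integrable_kernel_real {B : Set T} (hB : MeasurableSet B) (Q : Measure S)
    [IsFiniteMeasure Q] : Integrable (fun s => (κ s).real B) Q :=
  .of_bound (measurable_kernel_real hB).aestronglyMeasurable 1
    (.of_forall fun s => by
      rw [Real.norm_of_nonneg measureReal_nonneg]; exact measureReal_le_one)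

/-- Since the kernel is given, no regularity of the spaces is required. In the applications they are
products of uncountably many lines. -/
theorem condExp_of_map_eq_compProd (hU : Measurable U) (hV : Measurable V)
    (h : P.map (fun ω => (U ω, V ω)) = P.map U ⊗ₘ κ) {B : Set T} (hB : MeasurableSet B) :
    P⟦V ⁻¹' B | mS.comap U⟧ =ᵐ[P] fun ω => (κ (U ω)).real B := by
  have hQ := Measure.isProbabilityMeasure_map (μ := P) hU.aemeasurable
  have hκ := integrable_kernel_real (κ := κ) hB (P.map U)
  refine (ae_eq_condExp_of_forall_setIntegral_eq hU.comap_le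
    (integrable_indicator_one (hV hB))
    (fun _ _ _ => (hκ.comp_measurable hU).integrableOn) ?_ ?_).symm
  · rintro _ ⟨A, hA, rfl⟩ _
    have e1 := setIntegral_map hA hκ.aestronglyMeasurable hU.aemeasurable
    have e2 : (P.map U ⊗ₘ κ) (A ×ˢ B) = P (U ⁻¹' A ∩ V ⁻¹' B) := by
      rw [← h, Measure.map_apply (hU.prodMk hV) (hA.prod hB)]
      rfl
    rw [Measure.compProd_apply_prod hA hB] at e2
    simp only [Function.comp_apply]
    rw [← e1, setIntegral_indicator (hV hB), setIntegral_const, smul_eq_mul, mul_one,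
      measureReal_def, ← e2]
    exact integral_toReal (κ.measurable_coe hB).aemeasurable
      (.of_forall fun s => measure_lt_top _ _)
  · exact (Measurable.comp (measurable_kernel_real hB)
      (comap_measurable U)).stronglyMeasurable.aestronglyMeasurable

theorem map_eq_compProd_of_condExp (hU : Measurable U) (hV : Measurable V)
    (h : ∀ B : Set T, MeasurableSet B →
      P⟦V ⁻¹' B | mS.comap U⟧ =ᵐ[P] fun ω => (κ (U ω)).real B) :
    P.map (fun ω => (U ω, V ω)) = P.map U ⊗ₘ κ := by
  have hQ := Measure.isProbabilityMeasure_map (μ := P) hU.aemeasurable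
  have hQ' := Measure.isProbabilityMeasure_map (μ := P) (hU.prodMk hV).aemeasurable
  refine Measure.ext_prod fun {A B} hA hB => ?_
  have hκ := integrable_kernel_real (κ := κ) hB (P.map U)
  rw [Measure.map_apply (hU.prodMk hV) (hA.prod hB), Measure.compProd_apply_prod hA hB]
  have e1 := setIntegral_map hA hκ.aestronglyMeasurable hU.aemeasurable
  have e2 : ∫ s in A, (κ s).real B ∂(P.map U) = (∫⁻ s in A, κ s B ∂(P.map U)).toReal :=
    integral_toReal (κ.measurable_coe hB).aemeasurable
      (.of_forall fun s => measure_lt_top _ _)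
  have e3 : ∫ ω in U ⁻¹' A, (P⟦V ⁻¹' B | mS.comap U⟧) ω ∂P = P.real (U ⁻¹' A ∩ V ⁻¹' B) := by
    rw [setIntegral_condExp hU.comap_le (integrable_indicator_one (hV hB)) ⟨A, hA, rfl⟩,
      setIntegral_indicator (hV hB), setIntegral_const, smul_eq_mul, mul_one]
  have e4 : (P (U ⁻¹' A ∩ V ⁻¹' B)).toReal = (∫⁻ s in A, κ s B ∂(P.map U)).toReal := by
    rw [← e2, e1, ← measureReal_def, ← e3]
    exact setIntegral_congr_ae (hU hA) ((h B hB).mono fun ω hω _ => hω)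
  refine (ENNReal.toReal_eq_toReal_iff' (measure_ne_top _ _) ?_).1 e4
  refine ne_top_of_le_ne_top (measure_ne_top (P.map U) A) ?_
  calc ∫⁻ s in A, κ s B ∂(P.map U) ≤ ∫⁻ _ in A, 1 ∂(P.map U) :=
        lintegral_mono fun s => prob_le_one
    _ = P.map U A := by simp

end Kernel

/-! ### Laws of processes which are glued from their parts on and off an interval -/

theorem comap_prodMk_sigmaOf {Ω ι : Type*} (X : ι → Ω → ℝ) (j k : ι) :
    MeasurableSpace.comap (fun ω => (X j ω, X k ω)) inferInstance = sigmaOf X {j, k} := by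
  rw [sigmaOf, iSup_pair]
  exact MeasurableSpace.comap_prodMk _ _

/-- `κ` is a version of the conditional law of the canonical process between the times `a` and `b`,
given its values at these times, when its law is `ν`. -/
def IsBridge (ν : Measure (unitInterval → ℝ)) (a b : unitInterval)
    (κ : Kernel (ℝ × ℝ) (Icc a b → ℝ)) : Prop :=
  ν.map (fun x => ((x a, x b), fun t : Icc a b => x t)) = (ν.map fun x => (x a, x b)) ⊗ₘ κ

/-- The times which are not strictly between `a` and `b`. -/
def outer (a b : unitInterval) : Set unitInterval := Iic a ∪ Ici b

theorem mem_outer {a b t : unitInterval} : t ∈ outer a b ↔ t ≤ a ∨ b ≤ t := Iff.rfl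

theorem mem_outer_iff_not {a b t : unitInterval} : t ∈ outer a b ↔ ¬ (a < t ∧ t < b) := by
  rw [mem_outer, not_and_or, not_lt, not_lt]

theorem left_mem_outer (a b : unitInterval) : a ∈ outer a b := .inl self_mem_Iic

theorem right_mem_outer (a b : unitInterval) : b ∈ outer a b := .inr self_mem_Ici

theorem pair_subset_outer (a b : unitInterval) : {a, b} ⊆ outer a b :=
  insert_subset (left_mem_outer a b) (singleton_subset_iff.2 (right_mem_outer a b))

section Glue

variable {Ω : Type*} {m0 : MeasurableSpace Ω} {P : Measure Ω} [IsProbabilityMeasure P]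
  {a b : unitInterval} {κ : Kernel (ℝ × ℝ) (Icc a b → ℝ)} [IsMarkovKernel κ]

/-- A process on the times in `outer a b` and a process on the times in `Icc a b`, joined. -/
noncomputable def glue (a b : unitInterval) (x : (outer a b → ℝ) × (Icc a b → ℝ)) :
    unitInterval → ℝ := fun t => by
  classical
  -- At the common times `a` and `b` the outer part takes precedence. The value `0` is never
  -- reached: a time not in `outer a b` lies strictly between `a` and `b`.
  exact if h : t ∈ outer a b then x.1 ⟨t, h⟩ else if h' : t ∈ Icc a b then x.2 ⟨t, h'⟩ else 0

theorem measurable_glue : Measurable (glue a b) := by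
  refine measurable_pi_iff.2 fun t => ?_
  unfold glue
  by_cases h : t ∈ outer a b
  · simp only [h, dite_true]
    exact (measurable_pi_apply (⟨t, h⟩ : outer a b)).comp measurable_fst
  · by_cases h' : t ∈ Icc a b
    · simp only [h, h', dite_true, dite_false]
      exact (measurable_pi_apply (⟨t, h'⟩ : Icc a b)).comp measurable_snd
    · simpa only [h, h', dite_false] using measurable_const

theorem glue_restrict (x : unitInterval → ℝ) :
    glue a b (fun t : outer a b => x t, fun t : Icc a b => x t) = x := by
  funext t
  unfold glue
  by_cases h : t ∈ outer a b
  · simp only [h, dite_true]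
  · have h' : t ∈ Icc a b := by
      rw [mem_outer_iff_not, not_not] at h
      exact ⟨h.1.le, h.2.le⟩
    simp only [h, h', dite_true, dite_false]

/-- The law of a process with conditional law `κ` between the times `a` and `b`, given the process
at the other times, is determined by its law at the other times. -/
theorem map_eq_of_condExp {Z : unitInterval → Ω → ℝ} (hZ : ∀ t, Measurable (Z t))
    (h : ∀ B : Set (Icc a b → ℝ), MeasurableSet B →
      P⟦(fun ω (t : Icc a b) => Z t ω) ⁻¹' B | sigmaOf Z (outer a b)⟧ =ᵐ[P]
        fun ω => (κ (Z a ω, Z b ω)).real B) :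
    P.map (fun ω t => Z t ω) =
      ((P.map fun ω (t : outer a b) => Z t ω) ⊗ₘ κ.comap (fun x : outer a b → ℝ =>
        (x ⟨a, left_mem_outer a b⟩, x ⟨b, right_mem_outer a b⟩))
        ((measurable_pi_apply _).prodMk (measurable_pi_apply _))).map (glue a b) := by
  have hU : Measurable fun ω (t : outer a b) => Z t ω := measurable_pi_iff.2 fun t => hZ t
  have hV : Measurable fun ω (t : Icc a b) => Z t ω := measurable_pi_iff.2 fun t => hZ t
  rw [← map_eq_compProd_of_condExp hU hV, Measure.map_map measurable_glue (hU.prodMk hV)]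
  · congr 1
    funext ω
    exact (glue_restrict fun t => Z t ω).symm
  · intro B hB
    rw [comap_tuple (X := Z) (fun t : outer a b => (t : unitInterval)), Subtype.range_coe]
    exact h B hB

/-- The bridge property conditions on the values at `a` and `b` only; by `hi` the other outer times
add no information. -/
theorem condExp_of_isBridge {ν : Measure (unitInterval → ℝ)} [IsProbabilityMeasure ν]
    (hb : IsBridge ν a b κ)
    (hi : Ind ν (fun t x => x t) {a, b} (Icc a b) (outer a b))
    (B : Set (Icc a b → ℝ)) (hB : MeasurableSet B) :
    ν⟦(fun x (t : Icc a b) => x t) ⁻¹' B | sigmaOf (fun t x => x t) (outer a b)⟧ =ᵐ[ν]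
        fun x => (κ (x a, x b)).real B := by
  have hc : ∀ t, Measurable fun x : unitInterval → ℝ => x t := measurable_pi_apply
  have h1 := (Ind.iff_condExp hc).1 hi.symm ((fun x (t : Icc a b) => x t) ⁻¹' B) ?_
  · rw [union_eq_self_of_subset_left (pair_subset_outer a b)] at h1
    refine h1.trans ?_
    rw [← comap_prodMk_sigmaOf]
    exact condExp_of_map_eq_compProd (P := ν) (U := fun x : unitInterval → ℝ => (x a, x b))
      (V := fun (x : unitInterval → ℝ) (t : Icc a b) => x t) ((hc a).prodMk (hc b))
      (measurable_pi_iff.2 fun t => hc t) hb hB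
  · have := comap_tuple (X := fun t (x : unitInterval → ℝ) => x t)
      (fun t : Icc a b => (t : unitInterval))
    rw [Subtype.range_coe] at this
    rw [← this]
    exact ⟨B, hB, rfl⟩

/-- Both laws arise by gluing the same kernel onto the same outer law. The Markov property is needed
for `ν` alone, since `h` already conditions `Z` on its whole outer part. -/
theorem map_eq_of_isBridge {ν : Measure (unitInterval → ℝ)} [IsProbabilityMeasure ν]
    (hb : IsBridge ν a b κ)
    (hi : Ind ν (fun t x => x t) {a, b} (Icc a b) (outer a b))
    {Z : unitInterval → Ω → ℝ} (hZ : ∀ t, Measurable (Z t))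
    (h : ∀ B : Set (Icc a b → ℝ), MeasurableSet B →
      P⟦(fun ω (t : Icc a b) => Z t ω) ⁻¹' B | sigmaOf Z (outer a b)⟧ =ᵐ[P]
        fun ω => (κ (Z a ω, Z b ω)).real B)
    (ho : P.map (fun ω (t : outer a b) => Z t ω) = ν.map fun x (t : outer a b) => x t) :
    P.map (fun ω t => Z t ω) = ν := by
  have h2 := map_eq_of_condExp (P := ν) (Z := fun t x => x t) (fun t => measurable_pi_apply t)
    (condExp_of_isBridge hb hi)
  rw [map_eq_of_condExp hZ h, ho, ← h2]
  exact Measure.map_id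

end Glue

/-! ### Families of paths -/

section PathFamily

variable {α : Type*}

/-- The points on the paths of a family. -/
def pathSupport (F : Set (unitInterval → α)) : Set α := {p | ∃ σ ∈ F, ∃ t, σ t = p}

/-- Some path of the family visits `p` and, at the same time or later, `q`. -/
def PathLe (F : Set (unitInterval → α)) (p q : α) : Prop :=
  ∃ σ ∈ F, ∃ s t, s ≤ t ∧ σ s = p ∧ σ t = q

/-- The path `σ`, replaced by `e` strictly between the times `a` and `b`. -/
noncomputable def splice (a b : unitInterval) (σ e : unitInterval → α) : unitInterval → α :=
  fun t => by classical exact if a < t ∧ t < b then e t else σ t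

theorem splice_inner {a b : unitInterval} {σ e : unitInterval → α} {t : unitInterval}
    (h : a < t ∧ t < b) : splice a b σ e t = e t :=
  if_pos h

theorem splice_outer {a b : unitInterval} {σ e : unitInterval → α} {t : unitInterval}
    (h : t ∈ outer a b) : splice a b σ e t = σ t :=
  if_neg (mem_outer_iff_not.1 h)

theorem splice_left (a b : unitInterval) (σ e : unitInterval → α) : splice a b σ e a = σ a :=
  splice_outer (left_mem_outer a b)

theorem splice_right (a b : unitInterval) (σ e : unitInterval → α) : splice a b σ e b = σ b :=
  splice_outer (right_mem_outer a b)

theorem mem_or_mem_outer (a b t : unitInterval) : (a < t ∧ t < b) ∨ t ∈ outer a b := by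
  rw [mem_outer_iff_not]; exact em _

/-- The family `F` together with the paths which follow the new connection `e` from `j` to `k`
between the times `a` and `b`. -/
def addConnection (F : Set (unitInterval → α)) (a b : unitInterval) (j k : α)
    (e : unitInterval → α) : Set (unitInterval → α) :=
  F ∪ {σ' | ∃ σ ∈ F, σ a = j ∧ σ b = k ∧ σ' = splice a b σ e}

/-- Every point is visited at one time only. -/
def Graded (F : Set (unitInterval → α)) : Prop :=
  ∀ σ ∈ F, ∀ σ' ∈ F, ∀ s t, σ s = σ' t → s = t

/-- The laws of any two paths agree on the times at which the paths are at the same point. -/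
def ConsistentLaws (F : Set (unitInterval → α))
    (μ : (unitInterval → α) → Measure (unitInterval → ℝ)) : Prop :=
  ∀ σ₁ ∈ F, ∀ σ₂ ∈ F,
    (μ σ₁).map (fun x (t : {t : unitInterval // σ₁ t = σ₂ t}) => x t) =
    (μ σ₂).map (fun x (t : {t : unitInterval // σ₁ t = σ₂ t}) => x t)

/-- Two paths which agree off an interval and are incomparable strictly inside. -/
structure IsSimplePair (F : Set (unitInterval → α)) (a b : unitInterval)
    (σ₁ σ₂ : unitInterval → α) : Prop where
  left : σ₁ ∈ F
  right : σ₂ ∈ F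
  lt : a < b
  eq : ∀ t ∈ outer a b, σ₁ t = σ₂ t
  not_le : ∀ s t, a < s → s < b → a < t → t < b →
    ¬ PathLe F (σ₁ s) (σ₂ t) ∧ ¬ PathLe F (σ₂ t) (σ₁ s)

theorem IsSimplePair.symm {F : Set (unitInterval → α)} {a b : unitInterval}
    {σ₁ σ₂ : unitInterval → α} (h : IsSimplePair F a b σ₁ σ₂) : IsSimplePair F a b σ₂ σ₁ :=
  ⟨h.right, h.left, h.lt, fun t ht => (h.eq t ht).symm,
    fun s t h1 h2 h3 h4 => (h.not_le t s h3 h4 h1 h2).symm⟩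

/-- The laws on the paths of simple pairs satisfy the two-sided Markov property. -/
def SimpleMarkov (F : Set (unitInterval → α))
    (μ : (unitInterval → α) → Measure (unitInterval → ℝ)) : Prop :=
  ∀ a b σ₁ σ₂, IsSimplePair F a b σ₁ σ₂ →
    Ind (μ σ₁) (fun t x => x t) {a, b} (Icc a b) (outer a b)

variable {F F' : Set (unitInterval → α)}

theorem PathLe.mono (h : F ⊆ F') {p q : α} (hp : PathLe F p q) : PathLe F' p q := by
  obtain ⟨σ, hσ, s, t, hst⟩ := hp
  exact ⟨σ, h hσ, s, t, hst⟩

theorem mem_pathSupport {σ : unitInterval → α} (h : σ ∈ F) (t : unitInterval) :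
    σ t ∈ pathSupport F :=
  ⟨σ, h, t, rfl⟩

theorem image_subset_pathSupport {σ : unitInterval → α} (h : σ ∈ F) (A : Set unitInterval) :
    σ '' A ⊆ pathSupport F := by
  rintro _ ⟨t, _, rfl⟩
  exact mem_pathSupport h t

theorem PathLe.left_mem {p q : α} (h : PathLe F p q) : p ∈ pathSupport F := by
  obtain ⟨σ, hσ, s, t, _, rfl, _⟩ := h
  exact mem_pathSupport hσ s

theorem PathLe.right_mem {p q : α} (h : PathLe F p q) : q ∈ pathSupport F := by
  obtain ⟨σ, hσ, s, t, _, _, rfl⟩ := h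
  exact mem_pathSupport hσ t

theorem Graded.mono (h : F ⊆ F') (hg : Graded F') : Graded F :=
  fun σ hσ σ' hσ' => hg σ (h hσ) σ' (h hσ')

theorem Graded.le_iff (hg : Graded F) {σ σ' : unitInterval → α} (h : σ ∈ F) (h' : σ' ∈ F)
    {s t : unitInterval} (hl : PathLe F (σ s) (σ' t)) : s ≤ t := by
  obtain ⟨ρ, hρ, s', t', hst, hs, ht⟩ := hl
  rwa [← hg ρ hρ σ h _ _ hs, ← hg ρ hρ σ' h' _ _ ht]

theorem ConsistentLaws.mono (h : F ⊆ F') {μ : (unitInterval → α) → Measure (unitInterval → ℝ)}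
    (hc : ConsistentLaws F' μ) : ConsistentLaws F μ :=
  fun σ₁ h₁ σ₂ h₂ => hc σ₁ (h h₁) σ₂ (h h₂)

theorem ConsistentLaws.map_eq {μ : (unitInterval → α) → Measure (unitInterval → ℝ)}
    (hc : ConsistentLaws F μ) {σ₁ σ₂ : unitInterval → α} (h₁ : σ₁ ∈ F) (h₂ : σ₂ ∈ F)
    {A : Set unitInterval} (h : ∀ t ∈ A, σ₁ t = σ₂ t) :
    (μ σ₁).map (fun x (t : A) => x t) = (μ σ₂).map (fun x (t : A) => x t) := by
  have := congrArg (Measure.map fun (y : {t : unitInterval // σ₁ t = σ₂ t} → ℝ) (t : A) =>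
    y ⟨t, h t t.2⟩) (hc σ₁ h₁ σ₂ h₂)
  rwa [Measure.map_map, Measure.map_map] at this
  all_goals exact measurable_pi_iff.2 fun t => measurable_pi_apply _

/-- Both sides of the bridge equation are images of the law on `[a,b]`. Hence the kernel obtained
from one full path through an edge serves every other one. -/
theorem IsBridge.congr {ν ν' : Measure (unitInterval → ℝ)} {a b : unitInterval} (hab : a ≤ b)
    {κ : Kernel (ℝ × ℝ) (Icc a b → ℝ)} (h : IsBridge ν a b κ)
    (H : ν.map (fun x (t : Icc a b) => x t) = ν'.map fun x (t : Icc a b) => x t) :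
    IsBridge ν' a b κ := by
  have ha : a ∈ Icc a b := left_mem_Icc.2 hab
  have hb : b ∈ Icc a b := right_mem_Icc.2 hab
  have h1 := congrArg (Measure.map fun (y : Icc a b → ℝ) => (y ⟨a, ha⟩, y ⟨b, hb⟩)) H
  have h2 := congrArg (Measure.map fun (y : Icc a b → ℝ) => ((y ⟨a, ha⟩, y ⟨b, hb⟩), y)) H
  have m1 : Measurable fun (y : Icc a b → ℝ) => (y ⟨a, ha⟩, y ⟨b, hb⟩) :=
    (measurable_pi_apply _).prodMk (measurable_pi_apply _)
  have m2 : Measurable fun (x : unitInterval → ℝ) (t : Icc a b) => x t :=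
    measurable_pi_iff.2 fun t => measurable_pi_apply _
  have m3 : Measurable fun (y : Icc a b → ℝ) => ((y ⟨a, ha⟩, y ⟨b, hb⟩), y) :=
    m1.prodMk measurable_id
  rw [Measure.map_map m1 m2, Measure.map_map m1 m2] at h1
  rw [Measure.map_map m3 m2, Measure.map_map m3 m2] at h2
  unfold IsBridge at h ⊢
  exact h2.symm.trans (h.trans (congrArg (· ⊗ₘ κ) h1))

theorem subset_addConnection {a b : unitInterval} {j k : α} {e : unitInterval → α} :
    F ⊆ addConnection F a b j k e :=
  subset_union_left

theorem splice_mem {a b : unitInterval} {j k : α} {e σ : unitInterval → α} (hσ : σ ∈ F)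
    (hj : σ a = j) (hk : σ b = k) : splice a b σ e ∈ addConnection F a b j k e :=
  .inr ⟨σ, hσ, hj, hk, rfl⟩

/-- A path which visits a new point follows the whole new connection. -/
theorem eq_of_new {a b : unitInterval} {j k : α} {e ρ : unitInterval → α}
    (hρ : ρ ∈ addConnection F a b j k e) (hg : Graded (addConnection F a b j k e))
    {σ : unitInterval → α} (hσ : σ ∈ F) (hj : σ a = j) (hk : σ b = k)
    (hnew : ∀ t, a < t → t < b → e t ∉ pathSupport F) {s u : unitInterval} (h1 : a < s)
    (h2 : s < b) (h : ρ u = e s) : ∃ σ' ∈ F, σ' a = j ∧ σ' b = k ∧ ρ = splice a b σ' e ∧ u = s := by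
  have hu : u = s :=
    hg ρ hρ _ (splice_mem (e := e) hσ hj hk) u s (by rw [h, splice_inner ⟨h1, h2⟩])
  rcases hρ with hρ | ⟨σ', hσ', h3, h4, rfl⟩
  · exact absurd (h ▸ mem_pathSupport hρ u) (hnew s h1 h2)
  · exact ⟨σ', hσ', h3, h4, rfl, hu⟩

/-- A path that visits the interior of the new connection follows it throughout the times between
`a` and `b`, so it meets no old point at these times. This is how (T3) enters the induction along
the construction. -/
theorem isSimplePair_splice {a b : unitInterval} (hab : a < b) {j k : α} {e : unitInterval → α}
    (hg : Graded (addConnection F a b j k e)) {σ : unitInterval → α} (hσ : σ ∈ F)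
    (hj : σ a = j) (hk : σ b = k) (hnew : ∀ t, a < t → t < b → e t ∉ pathSupport F) :
    IsSimplePair (addConnection F a b j k e) a b (splice a b σ e) σ where
  left := splice_mem hσ hj hk
  right := .inl hσ
  lt := hab
  eq _ ht := splice_outer ht
  not_le s t h1 h2 h3 h4 := by
    have key : ∀ ρ ∈ addConnection F a b j k e, ∀ s' t', ρ s' = e s → ρ t' = σ t → False := by
      intro ρ hρ s' t' hs' ht'
      -- Gradedness puts the visit to `σ t` at time `t` itself, where `ρ` is on the new connection.
      have : t' = t := hg ρ hρ σ (.inl hσ) _ _ ht'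
      obtain ⟨σ', _, _, _, rfl, _⟩ := eq_of_new hρ hg hσ hj hk hnew h1 h2 hs'
      subst this
      rw [splice_inner ⟨h3, h4⟩] at ht'
      exact hnew _ h3 h4 (ht' ▸ mem_pathSupport hσ _)
    rw [splice_inner ⟨h1, h2⟩]
    exact ⟨fun ⟨ρ, hρ, s', t', _, hs', ht'⟩ => key ρ hρ s' t' hs' ht',
      fun ⟨ρ, hρ, s', t', _, hs', ht'⟩ => key ρ hρ t' s' ht' hs'⟩

/-- Old points on a spliced path occur at outer times, where it agrees with the old path underneath.
-/
theorem PathLe.of_addConnection {a b : unitInterval} {j k : α} {e : unitInterval → α}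
    (hnew : ∀ t, a < t → t < b → e t ∉ pathSupport F) {p q : α} (hp : p ∈ pathSupport F)
    (hq : q ∈ pathSupport F) (h : PathLe (addConnection F a b j k e) p q) : PathLe F p q := by
  obtain ⟨ρ, hρ | ⟨σ, hσ, -, -, rfl⟩, s, t, hst, rfl, rfl⟩ := h
  · exact ⟨ρ, hρ, s, t, hst, rfl, rfl⟩
  · refine ⟨σ, hσ, s, t, hst, ?_, ?_⟩
    · rcases mem_or_mem_outer a b s with h | h
      · rw [splice_inner h] at hp
        exact absurd hp (hnew s h.1 h.2)
      · rw [splice_outer h]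
    · rcases mem_or_mem_outer a b t with h | h
      · rw [splice_inner h] at hq
        exact absurd hq (hnew t h.1 h.2)
      · rw [splice_outer h]

/-- No comparabilities between old points are created, so simple pairs stay simple. Thus (T3) for
the final graph is inherited by every stage of the construction. -/
theorem SimpleMarkov.of_addConnection {a b : unitInterval} {j k : α} {e : unitInterval → α}
    (hnew : ∀ t, a < t → t < b → e t ∉ pathSupport F)
    {μ : (unitInterval → α) → Measure (unitInterval → ℝ)}
    (h : SimpleMarkov (addConnection F a b j k e) μ) : SimpleMarkov F μ :=
  fun a' b' σ₁ σ₂ H => h a' b' σ₁ σ₂ ⟨.inl H.left, .inl H.right, H.lt, H.eq,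
    fun s t e1 e2 e3 e4 =>
      have m1 := mem_pathSupport H.left s
      have m2 := mem_pathSupport H.right t
      have := H.not_le s t e1 e2 e3 e4
      ⟨fun hl => this.1 (hl.of_addConnection hnew m1 m2),
        fun hl => this.2 (hl.of_addConnection hnew m2 m1)⟩⟩

end PathFamily

/-! ### Processes constructed by adding connections -/

section Construction

variable {α Ω : Type*} {m0 : MeasurableSpace Ω}

/-- The process `X` on the paths of a family is constructed by adding connections, one at a time,
with the conditional laws prescribed by `μ`. -/
inductive Constructed (P : Measure Ω) (X : α → Ω → ℝ)
    (μ : (unitInterval → α) → Measure (unitInterval → ℝ)) : Set (unitInterval → α) → Prop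
  | single (σ : unitInterval → α) (h : P.map (fun ω t => X (σ t) ω) = μ σ) :
      Constructed P X μ {σ}
  | add (F : Set (unitInterval → α)) (a b : unitInterval) (σ e : unitInterval → α)
      (κ : Kernel (ℝ × ℝ) (Icc a b → ℝ)) (hF : Constructed P X μ F) (hab : a < b) (hσ : σ ∈ F)
      (hnew : ∀ t, a < t → t < b → e t ∉ pathSupport F) (hκ : IsMarkovKernel κ)
      (hb : IsBridge (μ (splice a b σ e)) a b κ)
      (hc : ∀ B : Set (Icc a b → ℝ), MeasurableSet B →
        P⟦(fun ω (t : Icc a b) => X (splice a b σ e t) ω) ⁻¹' B | sigmaOf X (pathSupport F)⟧ =ᵐ[P]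
          fun ω => (κ (X (σ a) ω, X (σ b) ω)).real B) :
      Constructed P X μ (addConnection F a b (σ a) (σ b) e)

/-- The Markov structure of a process which is constructed by adding connections. -/
inductive MarkovBuilt (P : Measure Ω) (X : α → Ω → ℝ) : Set (unitInterval → α) → Prop
  | single (σ : unitInterval → α) : MarkovBuilt P X {σ}
  | add (F : Set (unitInterval → α)) (a b : unitInterval) (σ e : unitInterval → α)
      (hF : MarkovBuilt P X F) (hab : a < b) (hσ : σ ∈ F)
      (hnew : ∀ t, a < t → t < b → e t ∉ pathSupport F)
      (hi : Ind P X {σ a, σ b} (e '' Ioo a b) (pathSupport F))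
      (hm : ∀ ρ ∈ F, ρ a = σ a → ρ b = σ b →
        Ind P X {σ a, σ b} (ρ '' Icc a b) (ρ '' outer a b)) :
      MarkovBuilt P X (addConnection F a b (σ a) (σ b) e)

variable {P : Measure Ω} {X : α → Ω → ℝ}
  {μ : (unitInterval → α) → Measure (unitInterval → ℝ)} {F : Set (unitInterval → α)}

theorem Constructed.nonempty (h : Constructed P X μ F) : F.Nonempty := by
  cases h with
  | single σ h => exact ⟨σ, rfl⟩
  | add F a b σ e κ hF hab hσ => exact ⟨σ, .inl hσ⟩

/-- The type of points changes at every step of a tower. Injectivity keeps new points new, and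
ensures that an image path passes through the images of the two ends only if the path passes through
the ends. -/
theorem Constructed.map {β : Type*} {f : β → α} (hf : Function.Injective f)
    {F : Set (unitInterval → β)}
    (h : Constructed P (fun p => X (f p)) (fun σ => μ fun t => f (σ t)) F) :
    Constructed P X μ ((fun σ t => f (σ t)) '' F) := by
  induction h with
  | single σ h => rw [image_singleton]; exact .single _ h
  | add F a b σ e κ hF hab hσ hnew hκ hb hc ih =>
    have hs : ∀ ρ : unitInterval → β,
        (fun t => f (splice a b ρ e t)) = splice a b (fun t => f (ρ t)) fun t => f (e t) := by
      intro ρ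
      funext t
      rcases mem_or_mem_outer a b t with h | h
      · rw [splice_inner h, splice_inner h]
      · rw [splice_outer h, splice_outer h]
    have hsupp : pathSupport ((fun (σ : unitInterval → β) t => f (σ t)) '' F) =
        f '' pathSupport F := by
      ext p
      constructor
      · rintro ⟨_, ⟨ρ, hρ, rfl⟩, t, rfl⟩
        exact ⟨_, mem_pathSupport hρ t, rfl⟩
      · rintro ⟨_, ⟨ρ, hρ, t, rfl⟩, rfl⟩
        exact ⟨_, ⟨ρ, hρ, rfl⟩, t, rfl⟩
    have hF' : (fun (σ : unitInterval → β) t => f (σ t)) '' addConnection F a b (σ a) (σ b) e =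
        addConnection ((fun (σ : unitInterval → β) t => f (σ t)) '' F) a b (f (σ a)) (f (σ b))
          fun t => f (e t) := by
      rw [addConnection, image_union]
      congr 1
      ext ρ
      constructor
      · rintro ⟨_, ⟨σ', h1, h2, h3, rfl⟩, rfl⟩
        exact ⟨_, ⟨σ', h1, rfl⟩, congrArg f h2, congrArg f h3, hs σ'⟩
      · rintro ⟨_, ⟨σ', h1, rfl⟩, h2, h3, rfl⟩
        exact ⟨_, ⟨σ', h1, hf h2, hf h3, rfl⟩, hs σ'⟩
    rw [hF']
    refine .add _ a b (fun t => f (σ t)) _ κ ih hab ⟨σ, hσ, rfl⟩ ?_ hκ ?_ ?_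
    · intro t h1 h2
      rw [hsupp, hf.mem_set_image]
      exact hnew t h1 h2
    · rw [← hs]; exact hb
    · rw [← hs, hsupp, sigmaOf_image]
      exact hc

variable [IsProbabilityMeasure P] (hX : ∀ p, Measurable (X p))
include hX

/-- The constructed process has the prescribed law on every path. -/
theorem Constructed.map_eq (h : Constructed P X μ F) (hμ : ∀ σ ∈ F, IsProbabilityMeasure (μ σ))
    (hg : Graded F) (hc : ConsistentLaws F μ) (hm : SimpleMarkov F μ) :
    ∀ σ ∈ F, P.map (fun ω t => X (σ t) ω) = μ σ := by
  induction h with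
  | single σ h => rintro _ rfl; exact h
  | add F a b σ e κ hF hab hσ hnew hκ hb hlaw ih =>
    have hsub : F ⊆ addConnection F a b (σ a) (σ b) e := subset_addConnection
    have ih' := ih (fun σ h => hμ σ (hsub h)) (hg.mono hsub) (hc.mono hsub)
      (hm.of_addConnection hnew)
    rintro _ (hρ | ⟨ρ, hρ, hj, hk, rfl⟩)
    · exact ih' _ hρ
    · have hm1 : splice a b ρ e ∈ addConnection F a b (σ a) (σ b) e := splice_mem hρ hj hk
      have hm2 : splice a b σ e ∈ addConnection F a b (σ a) (σ b) e := splice_mem hσ rfl rfl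
      have := hμ _ hm1
      -- The kernel was chosen from the splice of `σ`; it applies to `ρ` because all spliced paths
      -- coincide on `[a,b]`.
      have hIcc : ∀ t ∈ Icc a b, splice a b σ e t = splice a b ρ e t := by
        intro t ht
        rcases mem_or_mem_outer a b t with h | h
        · rw [splice_inner h, splice_inner h]
        · rcases h with h | h
          · rw [le_antisymm h ht.1, splice_left, splice_left, hj]
          · rw [le_antisymm ht.2 h, splice_right, splice_right, hk]
      refine map_eq_of_isBridge (Z := fun t => X (splice a b ρ e t))
        (hb.congr hab.le (hc.map_eq hm2 hm1 hIcc))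
        (hm _ _ _ _ (isSimplePair_splice hab hg hρ hj hk hnew)) (fun t => hX _) ?_ ?_
      -- Given the whole old process the conditional law is a function of the two end values, hence
      -- it is the same given only the outer part of `ρ`.
      · intro B hB
        have e1 : (fun ω (t : Icc a b) => X (splice a b ρ e t) ω) =
            fun ω (t : Icc a b) => X (splice a b σ e t) ω := by
          funext ω t
          rw [hIcc t t.2]
        have e2 : sigmaOf (fun t => X (splice a b ρ e t)) (outer a b) =
            sigmaOf X (ρ '' outer a b) := by
          rw [← sigmaOf_image (X := X) (splice a b ρ e)]
          congr 1
          exact image_congr fun t ht => splice_outer ht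
        have hpair : ({σ a, σ b} : Set α) ⊆ ρ '' outer a b := by
          rw [← hj, ← hk]
          exact insert_subset ⟨a, left_mem_outer a b, rfl⟩
            (singleton_subset_iff.2 ⟨b, right_mem_outer a b, rfl⟩)
        have hκm : Measurable[sigmaOf X {σ a, σ b}]
            fun ω => (κ (X (σ a) ω, X (σ b) ω)).real B := by
          rw [← comap_prodMk_sigmaOf]
          exact (measurable_kernel_real hB).comp (comap_measurable _)
        simp only [splice_left, splice_right]
        rw [e1, e2, hj, hk]
        exact condExp_eq_of_le_of_le (sigmaOf_mono hpair)
          (sigmaOf_mono (image_subset_pathSupport hρ _)) (sigmaOf_le hX _)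
          hκm.stronglyMeasurable
          ((integrable_kernel_real hB _).comp_measurable ((hX _).prodMk (hX _)))
          (hlaw B hB)
      -- At outer times the path is the old `ρ`: the induction hypothesis gives the law of `X`
      -- there, and consistency identifies it with that of the spliced path.
      · have e1 : (fun ω (t : outer a b) => X (splice a b ρ e t) ω) =
            fun ω (t : outer a b) => X (ρ t) ω := by
          funext ω t
          rw [splice_outer t.2]
        have hr : Measurable fun (x : unitInterval → ℝ) (t : outer a b) => x t :=
          measurable_pi_iff.2 fun t => measurable_pi_apply _
        rw [e1, hc.map_eq hm1 (hsub hρ) (A := outer a b) fun t ht => splice_outer ht,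
          ← ih' ρ hρ, Measure.map_map hr (measurable_pi_iff.2 fun t => hX _)]
        rfl

/-- From here on laws and kernels are forgotten; only two independence statements per step survive.
-/
theorem Constructed.markovBuilt (h : Constructed P X μ F)
    (hμ : ∀ σ ∈ F, IsProbabilityMeasure (μ σ)) (hg : Graded F) (hc : ConsistentLaws F μ)
    (hm : SimpleMarkov F μ) : MarkovBuilt P X F := by
  have hmap := h.map_eq hX hμ hg hc hm
  induction h with
  | single σ h => exact .single σ
  | add F a b σ e κ hF hab hσ hnew hκ hb hlaw ih =>
    have hsub : F ⊆ addConnection F a b (σ a) (σ b) e := subset_addConnection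
    refine .add F a b σ e (ih (fun σ h => hμ σ (hsub h)) (hg.mono hsub) (hc.mono hsub)
      (hm.of_addConnection hnew) fun σ h => hmap σ (hsub h)) hab hσ hnew ?_ ?_
    · have hpair : ({σ a, σ b} : Set α) ⊆ pathSupport F :=
        insert_subset (mem_pathSupport hσ _) (singleton_subset_iff.2 (mem_pathSupport hσ _))
      have h0 : Ind P X {σ a, σ b} (pathSupport F) (splice a b σ e '' Icc a b) := by
        refine CondIndepGiven.of_condExp_eq (sigmaOf_le hX _) (sigmaOf_le hX _)
          (sigmaOf_le hX _) fun E hE => ?_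
        have := comap_tuple (X := X) (fun t : Icc a b => splice a b σ e t)
        rw [range_comp' (splice a b σ e) (Subtype.val : Icc a b → unitInterval),
          Subtype.range_coe] at this
        rw [← this] at hE
        obtain ⟨B, hB, rfl⟩ := hE
        refine ⟨fun ω => (κ (X (σ a) ω, X (σ b) ω)).real B, Measurable.stronglyMeasurable ?_,
          (integrable_kernel_real hB _).comp_measurable ((hX (σ a)).prodMk (hX (σ b))), ?_⟩
        · rw [← comap_prodMk_sigmaOf]
          exact (measurable_kernel_real hB).comp (comap_measurable _)
        · rw [← sigmaOf_union, union_eq_self_of_subset_left hpair]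
          exact hlaw B hB
      refine (h0.weaken hX subset_rfl (fun x hx => .inl (.inl hx)) subset_union_left ?_).symm
      rintro _ ⟨t, ht, rfl⟩
      exact .inl ⟨t, ⟨ht.1.le, ht.2.le⟩, splice_inner ht⟩
    -- The old path `ρ` is the second side of the simple cell formed with the new connection; its
    -- law under `X` is the prescribed one.
    · intro ρ hρ hj hk
      have := hm _ _ _ _ (isSimplePair_splice hab hg hρ hj hk hnew).symm
      rw [← hmap ρ (hsub hρ), Ind.map_iff (measurable_pi_iff.2 fun t => hX _)
        fun t => measurable_pi_apply _] at this
      have h2 := (Ind.image (P := P) (X := X) (f := ρ)).2 this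
      rwa [image_pair, hj, hk] at h2

end Construction

/-! ### The order of the points of a family of paths -/

section Order

variable {α : Type*}

/-- The path which follows `σ` up to time `t` and `σ'` thereafter. -/
noncomputable def joinAt (t : unitInterval) (σ σ' : unitInterval → α) : unitInterval → α :=
  fun s => by classical exact if s ≤ t then σ s else σ' s

theorem joinAt_of_le {t s : unitInterval} {σ σ' : unitInterval → α} (h : s ≤ t) :
    joinAt t σ σ' s = σ s :=
  if_pos h

theorem joinAt_of_ge {t s : unitInterval} {σ σ' : unitInterval → α} (h : t ≤ s)
    (e : σ t = σ' t) : joinAt t σ σ' s = σ' s := by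
  rcases h.eq_or_lt with rfl | h
  · rw [joinAt_of_le le_rfl, e]
  · exact if_neg h.not_ge

/-- One may change from one path to another where they meet. -/
def JoinClosed (F : Set (unitInterval → α)) : Prop :=
  ∀ σ ∈ F, ∀ σ' ∈ F, ∀ t, σ t = σ' t → joinAt t σ σ' ∈ F

/-- The points between `p` and `q`. -/
def between (F : Set (unitInterval → α)) (p q : α) : Set α := {r | PathLe F p r ∧ PathLe F r q}

/-- The points before `p` or after `q`. -/
def beyond (F : Set (unitInterval → α)) (p q : α) : Set α := {r | PathLe F r p ∨ PathLe F q r}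

variable {F : Set (unitInterval → α)}

theorem between_subset (p q : α) : between F p q ⊆ pathSupport F := fun _ h => h.1.right_mem

theorem beyond_subset (p q : α) : beyond F p q ⊆ pathSupport F :=
  fun _ h => h.elim PathLe.left_mem PathLe.right_mem

theorem pathLe_of_le {σ : unitInterval → α} (h : σ ∈ F) {s t : unitInterval} (hst : s ≤ t) :
    PathLe F (σ s) (σ t) :=
  ⟨σ, h, s, t, hst, rfl, rfl⟩

/-- By gradedness both paths are at `q` at the same time, so one may change paths there. -/
theorem PathLe.trans (hg : Graded F) (hj : JoinClosed F) {p q r : α} (h : PathLe F p q)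
    (h' : PathLe F q r) : PathLe F p r := by
  obtain ⟨σ, hσ, s, t, hst, rfl, rfl⟩ := h
  obtain ⟨σ', hσ', s', t', hst', h1, rfl⟩ := h'
  obtain rfl := hg σ' hσ' σ hσ _ _ h1
  exact ⟨_, hj σ hσ σ' hσ' _ h1.symm, s, t', hst.trans hst', joinAt_of_le hst,
    joinAt_of_ge hst' h1.symm⟩

theorem image_Icc_subset_between {σ : unitInterval → α} (h : σ ∈ F) (s t : unitInterval) :
    σ '' Icc s t ⊆ between F (σ s) (σ t) := by
  rintro _ ⟨u, hu, rfl⟩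
  exact ⟨pathLe_of_le h hu.1, pathLe_of_le h hu.2⟩

theorem image_outer_subset_beyond {σ : unitInterval → α} (h : σ ∈ F) (s t : unitInterval) :
    σ '' outer s t ⊆ beyond F (σ s) (σ t) := by
  rintro _ ⟨u, hu | hu, rfl⟩
  · exact .inl (pathLe_of_le h hu)
  · exact .inr (pathLe_of_le h hu)

theorem mem_or_new {a b : unitInterval} {σ e : unitInterval → α} {r : α} (hr : r ∈ pathSupport (addConnection F a b (σ a) (σ b) e)) :
    r ∈ pathSupport F ∨ ∃ u, a < u ∧ u < b ∧ r = e u := by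
  obtain ⟨ρ, hρ | ⟨σ', hσ', -, -, rfl⟩, t, rfl⟩ := hr
  · exact .inl (mem_pathSupport hρ t)
  · rcases mem_or_mem_outer a b t with h | h
    · exact .inr ⟨t, h.1, h.2, splice_inner h⟩
    · rw [splice_outer h]
      exact .inl (mem_pathSupport hσ' t)

/-- The path `e` is a new connection between the points of `σ` at the times `a` and `b`. -/
structure IsConnection (F : Set (unitInterval → α)) (a b : unitInterval)
    (σ e : unitInterval → α) : Prop where
  lt : a < b
  mem : σ ∈ F
  new : ∀ t, a < t → t < b → e t ∉ pathSupport F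
  graded : Graded (addConnection F a b (σ a) (σ b) e)
  joinClosed : JoinClosed F

namespace IsConnection

variable {a b : unitInterval} {σ e : unitInterval → α} (c : IsConnection F a b σ e)
include c

theorem gradedOld : Graded F := c.graded.mono subset_addConnection

theorem trans {p q r : α} (h : PathLe F p q) (h' : PathLe F q r) : PathLe F p r :=
  h.trans c.gradedOld c.joinClosed h'

theorem not_le : ¬ PathLe F (σ b) (σ a) := fun h =>
  (c.gradedOld.le_iff c.mem c.mem h).not_gt c.lt

theorem le : PathLe F (σ a) (σ b) := pathLe_of_le c.mem c.lt.le

theorem eq_of_new {ρ : unitInterval → α} (hρ : ρ ∈ addConnection F a b (σ a) (σ b) e)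
    {s u : unitInterval} (h1 : a < s) (h2 : s < b) (h : ρ u = e s) :
    ∃ σ' ∈ F, σ' a = σ a ∧ σ' b = σ b ∧ ρ = splice a b σ' e ∧ u = s :=
  _root_.eq_of_new hρ c.graded c.mem rfl rfl c.new h1 h2 h

theorem joinClosed_addConnection : JoinClosed (addConnection F a b (σ a) (σ b) e) := by
  have hbase : ∀ ρ ∈ addConnection F a b (σ a) (σ b) e, ∃ σ' ∈ F,
      (∀ t ∈ outer a b, ρ t = σ' t) ∧
        (ρ = σ' ∨ σ' a = σ a ∧ σ' b = σ b ∧ ρ = splice a b σ' e) := by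
    rintro ρ (hρ | ⟨σ', hσ', h1, h2, rfl⟩)
    · exact ⟨ρ, hρ, fun _ _ => rfl, .inl rfl⟩
    · exact ⟨σ', hσ', fun _ ht => splice_outer ht, .inr ⟨h1, h2, rfl⟩⟩
  intro ρ hρ ρ' hρ' t ht
  rcases mem_or_mem_outer a b t with hi | ho
  · by_cases hold : ρ ∈ F ∧ ρ' ∈ F
    · exact .inl (c.joinClosed ρ hold.1 ρ' hold.2 t ht)
    · have hnew : ρ t = e t := by
        rcases hρ with h | ⟨σ', -, -, -, rfl⟩
        · rcases hρ' with h' | ⟨σ', -, -, -, rfl⟩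
          · exact absurd ⟨h, h'⟩ hold
          · rw [ht, splice_inner hi]
        · rw [splice_inner hi]
      obtain ⟨τ, hτ, h1, h2, rfl, -⟩ := c.eq_of_new hρ hi.1 hi.2 hnew
      obtain ⟨τ', hτ', h1', h2', rfl, -⟩ := c.eq_of_new hρ' hi.1 hi.2 (ht ▸ hnew)
      have hb : τ b = τ' b := h2.trans h2'.symm
      -- The underlying paths need not meet at `t`, but both pass through `σ b`. They are joined at
      -- `b` instead, and the connection is spliced in afterwards.
      refine .inr ⟨_, c.joinClosed τ hτ τ' hτ' b hb, ?_, ?_, ?_⟩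
      · rw [joinAt_of_le c.lt.le, h1]
      · rw [joinAt_of_le le_rfl, h2]
      · funext s
        rcases mem_or_mem_outer a b s with hs | hs
        · rw [splice_inner hs]
          rcases le_total s t with h | h
          · rw [joinAt_of_le h, splice_inner hs]
          · rw [joinAt_of_ge h ht, splice_inner hs]
        · rw [splice_outer hs]
          rcases hs with h | h
          · have h' : s ≤ a := h
            rw [joinAt_of_le (h'.trans hi.1.le), joinAt_of_le (h'.trans c.lt.le),
              splice_outer (.inl h)]
          · have h' : b ≤ s := h
            rw [joinAt_of_ge (hi.2.le.trans h') ht, joinAt_of_ge h' hb, splice_outer (.inr h)]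
  · obtain ⟨τ, hτ, h1, h2⟩ := hbase ρ hρ
    obtain ⟨τ', hτ', h1', h2'⟩ := hbase ρ' hρ'
    have ht' : τ t = τ' t := by rw [← h1 t ho, ← h1' t ho, ht]
    have hmem := c.joinClosed τ hτ τ' hτ' t ht'
    have hout : ∀ s ∈ outer a b, joinAt t ρ ρ' s = joinAt t τ τ' s := by
      intro s hs
      rcases le_total s t with h | h
      · rw [joinAt_of_le h, joinAt_of_le h, h1 s hs]
      · rw [joinAt_of_ge h ht, joinAt_of_ge h ht', h1' s hs]
    -- A junction at an outer time leaves all of `[a,b]` to one of the two paths; `ρ₀` is that path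
    -- and `τ₀` the old path underneath.
    have key : ∀ {τ₀ ρ₀ : unitInterval → α}, (ρ₀ = τ₀ ∨ τ₀ a = σ a ∧ τ₀ b = σ b ∧
        ρ₀ = splice a b τ₀ e) → (∀ s, a ≤ s → s ≤ b → joinAt t ρ ρ' s = ρ₀ s) →
        (∀ s, a ≤ s → s ≤ b → joinAt t τ τ' s = τ₀ s) →
        joinAt t ρ ρ' ∈ addConnection F a b (σ a) (σ b) e := by
      intro τ₀ ρ₀ h hρ₀ hτ₀
      rcases h with rfl | ⟨ha, hb, rfl⟩
      · left
        convert hmem using 1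
        funext s
        rcases mem_or_mem_outer a b s with hs | hs
        · rw [hρ₀ s hs.1.le hs.2.le, hτ₀ s hs.1.le hs.2.le]
        · exact hout s hs
      · refine .inr ⟨_, hmem, ?_, ?_, ?_⟩
        · rw [hτ₀ a le_rfl c.lt.le, ha]
        · rw [hτ₀ b c.lt.le le_rfl, hb]
        · funext s
          rcases mem_or_mem_outer a b s with hs | hs
          · rw [hρ₀ s hs.1.le hs.2.le, splice_inner hs, splice_inner hs]
          · rw [splice_outer hs, hout s hs]
    rcases ho with h | h
    · have h' : t ≤ a := h
      exact key h2' (fun s hs _ => joinAt_of_ge (h'.trans hs) ht)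
        fun s hs _ => joinAt_of_ge (h'.trans hs) ht'
    · have h' : b ≤ t := h
      exact key h2 (fun s _ hs => joinAt_of_le (hs.trans h'))
        fun s _ hs => joinAt_of_le (hs.trans h')

theorem le_old {p q : α} (hp : p ∈ pathSupport F) (hq : q ∈ pathSupport F)
    (h : PathLe (addConnection F a b (σ a) (σ b) e) p q) : PathLe F p q :=
  h.of_addConnection c.new hp hq

/-- The interior of the connection can be entered only through its lower end and, in the next lemma,
left only through its upper end. -/
theorem le_new_right {p : α} (hp : p ∈ pathSupport F) {t : unitInterval} (h1 : a < t)
    (h2 : t < b) (h : PathLe (addConnection F a b (σ a) (σ b) e) p (e t)) :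
    PathLe F p (σ a) := by
  obtain ⟨ρ, hρ, s, u, hsu, rfl, hu⟩ := h
  obtain ⟨σ', hσ', h3, -, rfl, rfl⟩ := c.eq_of_new hρ h1 h2 hu
  rcases mem_or_mem_outer a b s with hs | hs
  · rw [splice_inner hs] at hp
    exact absurd hp (c.new s hs.1 hs.2)
  · rw [splice_outer hs, ← h3]
    exact pathLe_of_le hσ' (hs.resolve_right (hsu.trans_lt h2).not_ge)

theorem le_new_left {p : α} (hp : p ∈ pathSupport F) {t : unitInterval} (h1 : a < t)
    (h2 : t < b) (h : PathLe (addConnection F a b (σ a) (σ b) e) (e t) p) :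
    PathLe F (σ b) p := by
  obtain ⟨ρ, hρ, u, s, hsu, hu, rfl⟩ := h
  obtain ⟨σ', hσ', -, h3, rfl, rfl⟩ := c.eq_of_new hρ h1 h2 hu
  rcases mem_or_mem_outer a b s with hs | hs
  · rw [splice_inner hs] at hp
    exact absurd hp (c.new s hs.1 hs.2)
  · rw [splice_outer hs, ← h3]
    exact pathLe_of_le hσ' (hs.resolve_left (h1.trans_le hsu).not_ge)

theorem le_new_new {s t : unitInterval} (h1 : a < s) (h2 : s < b) (h3 : a < t) (h4 : t < b)
    (h : PathLe (addConnection F a b (σ a) (σ b) e) (e s) (e t)) : s ≤ t := by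
  obtain ⟨ρ, hρ, u, v, huv, hu, hv⟩ := h
  obtain ⟨-, -, -, -, -, rfl⟩ := c.eq_of_new hρ h1 h2 hu
  obtain ⟨-, -, -, -, -, rfl⟩ := c.eq_of_new hρ h3 h4 hv
  exact huv

/-- The effect of a new connection on the intervals between old points. -/
theorem between_beyond {p q : α} (hp : p ∈ pathSupport F) (hq : q ∈ pathSupport F) :
    let F' := addConnection F a b (σ a) (σ b) e
    (between F' p q ⊆ between F p q ∧ beyond F' p q ⊆ beyond F p q) ∨
    ({σ a, σ b} ⊆ between F p q ∧ between F' p q ⊆ between F p q ∪ e '' Ioo a b ∧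
      beyond F' p q ⊆ beyond F p q) ∨
    ({σ a, σ b} ⊆ beyond F p q ∧ between F' p q ⊆ between F p q ∧
      beyond F' p q ⊆ beyond F p q ∪ e '' Ioo a b) := by
  intro F'
  have hI : ∀ r ∈ between F' p q, r ∈ between F p q ∨
      r ∈ e '' Ioo a b ∧ PathLe F p (σ a) ∧ PathLe F (σ b) q := by
    intro r hr
    rcases mem_or_new hr.1.right_mem with h | ⟨u, h1, h2, rfl⟩
    · exact .inl ⟨c.le_old hp h hr.1, c.le_old h hq hr.2⟩
    · exact .inr ⟨⟨u, ⟨h1, h2⟩, rfl⟩, c.le_new_right hp h1 h2 hr.1, c.le_new_left hq h1 h2 hr.2⟩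
  have hO : ∀ r ∈ beyond F' p q, r ∈ beyond F p q ∨
      r ∈ e '' Ioo a b ∧ (PathLe F (σ b) p ∨ PathLe F q (σ a)) := by
    intro r hr
    rcases hr with hr | hr
    · rcases mem_or_new hr.left_mem with h | ⟨u, h1, h2, rfl⟩
      · exact .inl (.inl (c.le_old h hp hr))
      · exact .inr ⟨⟨u, ⟨h1, h2⟩, rfl⟩, .inl (c.le_new_left hp h1 h2 hr)⟩
    · rcases mem_or_new hr.right_mem with h | ⟨u, h1, h2, rfl⟩
      · exact .inl (.inr (c.le_old hq h hr))
      · exact .inr ⟨⟨u, ⟨h1, h2⟩, rfl⟩, .inr (c.le_new_right hq h1 h2 hr)⟩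
  -- A new point in the interval forces `p ≤ σ a` and `σ b ≤ q`; a new point in the exterior forces
  -- `σ b ≤ p` or `q ≤ σ a`. Together these would give `σ b ≤ σ a`.
  by_cases hi : PathLe F p (σ a) ∧ PathLe F (σ b) q
  · refine .inr (.inl ⟨insert_subset ⟨hi.1, c.trans c.le hi.2⟩
      (singleton_subset_iff.2 ⟨c.trans hi.1 c.le, hi.2⟩),
      fun r hr => (hI r hr).imp_right And.left, fun r hr => ?_⟩)
    rcases hO r hr with h | ⟨-, h | h⟩
    · exact h
    · exact absurd (c.trans h hi.1) c.not_le
    · exact absurd (c.trans hi.2 h) c.not_le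
  · have hI' : between F' p q ⊆ between F p q := fun r hr =>
      (hI r hr).resolve_right fun h => hi h.2
    by_cases ho : PathLe F (σ b) p ∨ PathLe F q (σ a)
    · refine .inr (.inr ⟨insert_subset ?_ (singleton_subset_iff.2 ?_), hI',
        fun r hr => (hO r hr).imp_right And.left⟩)
      · exact ho.imp (fun h => c.trans c.le h) id
      · exact ho.imp id fun h => c.trans h c.le
    · exact .inl ⟨hI', fun r hr => (hO r hr).resolve_right fun h => ho h.2⟩

end IsConnection

end Order

/-! ### The Markov property of intervals relative to a path -/

section Spine

variable {α Ω : Type*} {m0 : MeasurableSpace Ω} {P : Measure Ω} [IsProbabilityMeasure P]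
  {X : α → Ω → ℝ} (hX : ∀ p, Measurable (X p))
include hX

/-- A part `N` which depends on the rest only through `J` may be added to a part containing `J`. -/
theorem Ind.extend {J N S A B C : Set α} (hN : Ind P X J N S) (h : Ind P X C A B) (hJ : J ⊆ C ∪ A)
    (hA : A ⊆ S) (hB : B ⊆ S) (hC : C ⊆ S) : Ind P X C (A ∪ N) B :=
  h.contraction hX <| hN.weaken hX hJ
    (fun _ hx => .inr (hx.elim (fun h => hC h) fun h => hA h)) subset_union_left
    fun _ hx => .inl (hB hx)

/-- Here `π` is the bypassed segment, `c` the retained part of the path on the side of `I`, and `o`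
its part on the other side. By `hm`, `π` is independent of `o` given `c`; by `hO`, with `c` moved
into the conditioning, it is independent of `O` given `c ∪ o`. Contraction makes `π` independent of
`O` given `c`, and a second contraction, with `hI`, removes `π`. -/
theorem Ind.drop {J π c o I O : Set α} (hI : Ind P X (c ∪ π) I O) (hO : Ind P X o I O)
    (hm : Ind P X J π (c ∪ o)) (hJ : J ⊆ c) (hc : c ⊆ I) (hπ : π ⊆ I) : Ind P X c I O := by
  have h1 : Ind P X c o π :=
    (hm.weaken hX hJ (fun _ hx => .inr (.inl hx)) subset_union_left
      fun _ hx => .inl (.inr hx)).symm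
  have h2 : Ind P X (c ∪ o) O π :=
    (hO.weaken hX subset_union_right
      (fun _ hx => hx.elim (fun h => .inl (.inr (hc h))) fun h => .inl (.inl h))
      (fun _ hx => .inl (hπ hx)) subset_union_left).symm
  have h3 : Ind P X c π O :=
    (h1.contraction hX h2).symm.weaken hX subset_rfl (fun _ hx => .inl (.inl hx))
      subset_union_left fun _ hx => .inl (.inr hx)
  exact (h3.contraction hX hI).weaken hX subset_rfl (fun _ hx => .inl (.inl hx))
    (fun _ hx => .inl (.inr hx)) subset_union_left

/-- The interval between two points of a path and its exterior are conditionally independent given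
the part of the path inside, and given the part of the path outside. -/
def SpineMarkov (P : Measure Ω) (X : α → Ω → ℝ) (F : Set (unitInterval → α)) : Prop :=
  ∀ σ ∈ F, ∀ s t, s ≤ t →
    Ind P X (σ '' Icc s t) (between F (σ s) (σ t)) (beyond F (σ s) (σ t)) ∧
    Ind P X (σ '' outer s t) (between F (σ s) (σ t)) (beyond F (σ s) (σ t))

variable {F : Set (unitInterval → α)} {a b : unitInterval} {σ e : unitInterval → α}

/-- By `between_beyond` the new connection is attached to whichever of the two parts contains its
ends, or to neither. -/
theorem IsConnection.ind_old (c : IsConnection F a b σ e)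
    (hN : Ind P X {σ a, σ b} (e '' Ioo a b) (pathSupport F)) {p q : α} (hp : p ∈ pathSupport F)
    (hq : q ∈ pathSupport F) {C : Set α} (hC : C ⊆ pathSupport F)
    (h : Ind P X C (between F p q) (beyond F p q)) :
    Ind P X C (between (addConnection F a b (σ a) (σ b) e) p q)
      (beyond (addConnection F a b (σ a) (σ b) e) p q) := by
  have hI := between_subset (F := F) p q
  have hO := beyond_subset (F := F) p q
  have sub : ∀ {A B : Set α}, C ⊆ C ∪ A ∪ B := by
    intro A B x hx
    exact .inl (.inl hx)
  rcases c.between_beyond hp hq with ⟨h1, h2⟩ | ⟨hJ, h1, h2⟩ | ⟨hJ, h1, h2⟩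
  · exact h.weaken hX subset_rfl sub (fun _ hx => .inl (h1 hx)) fun _ hx => .inl (h2 hx)
  · exact (hN.extend hX h (fun _ hx => .inr (hJ hx)) hI hO hC).weaken hX subset_rfl sub
      (fun _ hx => .inl (h1 hx)) fun _ hx => .inl (h2 hx)
  · exact (hN.extend hX h.symm (fun _ hx => .inr (hJ hx)) hO hI hC).symm.weaken hX subset_rfl sub
      (fun _ hx => .inl (h1 hx)) fun _ hx => .inl (h2 hx)

omit hX in
theorem IsConnection.between_subset_union (c : IsConnection F a b σ e) {p q : α}
    (hp : p ∈ pathSupport F) (hq : q ∈ pathSupport F) :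
    between (addConnection F a b (σ a) (σ b) e) p q ⊆ between F p q ∪ e '' Ioo a b ∧
    beyond (addConnection F a b (σ a) (σ b) e) p q ⊆ beyond F p q ∪ e '' Ioo a b := by
  rcases c.between_beyond hp hq with ⟨h1, h2⟩ | ⟨-, h1, h2⟩ | ⟨-, h1, h2⟩
  · exact ⟨fun _ h => .inl (h1 h), fun _ h => .inl (h2 h)⟩
  · exact ⟨h1, fun _ h => .inl (h2 h)⟩
  · exact ⟨fun _ h => .inl (h1 h), h2⟩

/-- The case of a path along the new connection, between two times which are not strictly inside
the new connection. -/
theorem IsConnection.ind_splice_outer (c : IsConnection F a b σ e)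
    (hN : Ind P X {σ a, σ b} (e '' Ioo a b) (pathSupport F))
    {ρ : unitInterval → α} (hρ : ρ ∈ F) (hj : ρ a = σ a) (hk : ρ b = σ b)
    (hm : Ind P X {σ a, σ b} (ρ '' Icc a b) (ρ '' outer a b))
    {s t : unitInterval} (hs : s ∈ outer a b) (ht : t ∈ outer a b)
    (ih : Ind P X (ρ '' Icc s t) (between F (ρ s) (ρ t)) (beyond F (ρ s) (ρ t)) ∧
      Ind P X (ρ '' outer s t) (between F (ρ s) (ρ t)) (beyond F (ρ s) (ρ t))) :
    Ind P X (splice a b ρ e '' Icc s t) (between (addConnection F a b (σ a) (σ b) e) (ρ s) (ρ t))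
      (beyond (addConnection F a b (σ a) (σ b) e) (ρ s) (ρ t)) ∧
    Ind P X (splice a b ρ e '' outer s t)
      (between (addConnection F a b (σ a) (σ b) e) (ρ s) (ρ t))
      (beyond (addConnection F a b (σ a) (σ b) e) (ρ s) (ρ t)) := by
  have hI := between_subset (F := F) (ρ s) (ρ t)
  have hO := beyond_subset (F := F) (ρ s) (ρ t)
  have hsub : ∀ A, ρ '' A ⊆ pathSupport F := image_subset_pathSupport hρ
  obtain ⟨hI', hO'⟩ := c.between_subset_union (mem_pathSupport hρ s) (mem_pathSupport hρ t)
  have hpair : ∀ T : Set unitInterval, a ∈ T → b ∈ T → {σ a, σ b} ⊆ ρ '' (T ∩ outer a b) := by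
    intro T h1 h2
    rw [← hj, ← hk]
    exact insert_subset ⟨a, ⟨h1, left_mem_outer a b⟩, rfl⟩
      (singleton_subset_iff.2 ⟨b, ⟨h2, right_mem_outer a b⟩, rfl⟩)
  have hsame : ∀ T : Set unitInterval, T ⊆ outer a b → splice a b ρ e '' T = ρ '' T :=
    fun T hT => image_congr fun u hu => splice_outer (hT hu)
  have hparts : ∀ T : Set unitInterval, Icc a b ⊆ T →
      ρ '' T = ρ '' (T ∩ outer a b) ∪ ρ '' Icc a b := by
    intro T hT
    rw [← image_union]
    congr 1
    ext u
    constructor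
    · intro hu
      rcases mem_or_mem_outer a b u with h | h
      · exact .inr ⟨h.1.le, h.2.le⟩
      · exact .inl ⟨hu, h⟩
    · rintro (h | h)
      exacts [h.1, hT h]
  have hnew : ∀ T : Set unitInterval, Icc a b ⊆ T → e '' Ioo a b ⊆ splice a b ρ e '' T := by
    rintro T hT _ ⟨u, hu, rfl⟩
    exact ⟨u, hT ⟨hu.1.le, hu.2.le⟩, splice_inner hu⟩
  have hkeep : ∀ T : Set unitInterval, ρ '' (T ∩ outer a b) ⊆ splice a b ρ e '' T := by
    rintro T _ ⟨u, hu, rfl⟩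
    exact ⟨u, hu.1, splice_outer hu.2⟩
  have hle : ∀ T : Set unitInterval, splice a b ρ e '' T ⊆
      ρ '' (T ∩ outer a b) ∪ e '' Ioo a b := by
    rintro T _ ⟨u, hu, rfl⟩
    rcases mem_or_mem_outer a b u with h | h
    · exact .inr ⟨u, h, (splice_inner h).symm⟩
    · exact .inl ⟨u, ⟨hu, h⟩, (splice_outer h).symm⟩
  have hab : ∀ T : Set unitInterval, Icc a b ⊆ T → {σ a, σ b} ⊆ ρ '' (T ∩ outer a b) :=
    fun T hT => hpair T (hT (left_mem_Icc.2 c.lt.le)) (hT (right_mem_Icc.2 c.lt.le))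
  -- Either the connection runs within `[s,t]`, or `[s,t]` avoids the times strictly between `a` and
  -- `b`. The second case is the first with interval and exterior exchanged.
  by_cases hcase : s ≤ a ∧ b ≤ t
  · have hT : Icc a b ⊆ Icc s t := Icc_subset_Icc hcase.1 hcase.2
    refine ⟨?_, ?_⟩
    -- The bypassed segment is dropped from the conditioning; then the connection is attached to the
    -- interval and moved into the conditioning.
    · have h1 : Ind P X (ρ '' (Icc s t ∩ outer a b)) (between F (ρ s) (ρ t))
          (beyond F (ρ s) (ρ t)) := by
        refine Ind.drop hX (hparts _ hT ▸ ih.1) ih.2 (hm.weaken hX subset_rfl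
          (fun _ h => .inl (.inl h)) subset_union_left ?_) (hab _ hT) ?_ ?_
        · rintro _ (⟨u, hu, rfl⟩ | ⟨u, hu, rfl⟩)
          · exact .inl ⟨u, hu.2, rfl⟩
          · exact .inl ⟨u, hu.imp (fun h => le_trans h hcase.1) fun h => le_trans hcase.2 h, rfl⟩
        · exact (image_mono inter_subset_left).trans (image_Icc_subset_between hρ s t)
        · exact (image_mono hT).trans (image_Icc_subset_between hρ s t)
      refine (hN.extend hX h1 (fun _ h => .inl (hab _ hT h)) hI hO (hsub _)).weaken hX (hkeep _)
        (fun _ h => .inl ((hle _ h).imp id .inr)) (fun _ h => .inl (hI' h)) fun x h => ?_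
      exact (hO' h).imp id fun h => hnew _ hT h
    · rw [hsame]
      · exact c.ind_old hX hN (mem_pathSupport hρ s) (mem_pathSupport hρ t) (hsub _) ih.2
      · rintro u (hu | hu)
        · exact .inl (le_trans hu hcase.1)
        · exact .inr (le_trans hcase.2 hu)
  · have hcase' : t ≤ a ∨ b ≤ s := by
      rcases hs with hs | hs
      · exact ht.imp id fun ht => absurd ⟨hs, ht⟩ hcase
      · exact .inr hs
    have hT : Icc a b ⊆ outer s t := fun u hu =>
      hcase'.symm.imp (fun h => le_trans hu.2 h) fun h => le_trans h hu.1
    refine ⟨?_, ?_⟩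
    · rw [hsame]
      · exact c.ind_old hX hN (mem_pathSupport hρ s) (mem_pathSupport hρ t) (hsub _) ih.1
      · intro u hu
        exact hcase'.imp (fun h => le_trans hu.2 h) fun h => le_trans h hu.1
    · have h1 : Ind P X (ρ '' (outer s t ∩ outer a b)) (beyond F (ρ s) (ρ t))
          (between F (ρ s) (ρ t)) := by
        refine Ind.drop hX (hparts _ hT ▸ ih.2.symm) ih.1.symm (hm.weaken hX subset_rfl
          (fun _ h => .inl (.inl h)) subset_union_left ?_) (hab _ hT) ?_ ?_
        · rintro _ (⟨u, hu, rfl⟩ | ⟨u, hu, rfl⟩)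
          · exact .inl ⟨u, hu.2, rfl⟩
          · exact .inl ⟨u, hcase'.imp (fun h => le_trans hu.2 h) fun h => le_trans h hu.1, rfl⟩
        · exact (image_mono inter_subset_left).trans (image_outer_subset_beyond hρ s t)
        · exact (image_mono hT).trans (image_outer_subset_beyond hρ s t)
      refine ((hN.extend hX h1 (fun _ h => .inl (hab _ hT h)) hO hI (hsub _)).weaken hX (hkeep _)
        (fun _ h => .inl ((hle _ h).imp id .inr)) (fun _ h => .inl (hO' h)) fun x h => ?_).symm
      exact (hI' h).imp id fun h => hnew _ hT h

/-- The case of a path along the new connection, between two times strictly inside it. -/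
theorem IsConnection.ind_splice_inner (c : IsConnection F a b σ e)
    (hN : Ind P X {σ a, σ b} (e '' Ioo a b) (pathSupport F))
    {ρ : unitInterval → α} (hρ : ρ ∈ F) (hj : ρ a = σ a) (hk : ρ b = σ b)
    {s t : unitInterval} (hs : a < s ∧ s < b) (ht : a < t ∧ t < b) :
    Ind P X (splice a b ρ e '' Icc s t) (between (addConnection F a b (σ a) (σ b) e) (e s) (e t))
      (beyond (addConnection F a b (σ a) (σ b) e) (e s) (e t)) ∧
    Ind P X (splice a b ρ e '' outer s t)
      (between (addConnection F a b (σ a) (σ b) e) (e s) (e t))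
      (beyond (addConnection F a b (σ a) (σ b) e) (e s) (e t)) := by
  -- The interval is just a piece of the connection: an old point in it would lie after `σ b` and
  -- before `σ a`. Hence the first claim is trivial and the second is a weakening of `hN`.
  have hI : between (addConnection F a b (σ a) (σ b) e) (e s) (e t) ⊆
      splice a b ρ e '' Icc s t := by
    intro r hr
    rcases mem_or_new hr.1.right_mem with h | ⟨u, h1, h2, rfl⟩
    · exact absurd (c.trans (c.le_new_left h hs.1 hs.2 hr.1) (c.le_new_right h ht.1 ht.2 hr.2))
        c.not_le
    · exact ⟨u, ⟨c.le_new_new hs.1 hs.2 h1 h2 hr.1, c.le_new_new h1 h2 ht.1 ht.2 hr.2⟩,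
        splice_inner ⟨h1, h2⟩⟩
  have hO : beyond (addConnection F a b (σ a) (σ b) e) (e s) (e t) ⊆
      pathSupport F ∪ splice a b ρ e '' outer s t := by
    intro r hr
    have hr' := hr.elim PathLe.left_mem PathLe.right_mem
    rcases mem_or_new hr' with h | ⟨u, h1, h2, rfl⟩
    · exact .inl h
    · exact .inr ⟨u, hr.imp (c.le_new_new h1 h2 hs.1 hs.2) (c.le_new_new ht.1 ht.2 h1 h2),
        splice_inner ⟨h1, h2⟩⟩
  refine ⟨.of_subset_left hX hI, hN.weaken hX ?_ ?_ ?_ hO⟩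
  · rw [← hj, ← hk]
    exact insert_subset ⟨a, .inl hs.1.le, splice_left ..⟩
      (singleton_subset_iff.2 ⟨b, .inr ht.2.le, splice_right ..⟩)
  · rintro _ ⟨u, -, rfl⟩
    rcases mem_or_mem_outer a b u with h | h
    · exact .inl (.inr ⟨u, h, (splice_inner h).symm⟩)
    · rw [splice_outer h]
      exact .inr (mem_pathSupport hρ u)
  · intro r hr
    obtain ⟨u, hu, rfl⟩ := hI hr
    have h : a < u ∧ u < b := ⟨hs.1.trans_le hu.1, hu.2.trans_lt ht.2⟩
    exact .inl ⟨u, h, (splice_inner h).symm⟩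

/-- The case of a path along the new connection which is left through its upper end. -/
theorem IsConnection.ind_splice_upper (c : IsConnection F a b σ e)
    (hN : Ind P X {σ a, σ b} (e '' Ioo a b) (pathSupport F))
    {ρ : unitInterval → α} (hρ : ρ ∈ F) (hj : ρ a = σ a) (hk : ρ b = σ b)
    {s t : unitInterval} (hs : a < s ∧ s < b) (ht : b ≤ t)
    (ih₁ : Ind P X (ρ '' Icc b t) (between F (ρ b) (ρ t)) (beyond F (ρ b) (ρ t)))
    (ih₂ : Ind P X (ρ '' outer a t) (between F (ρ a) (ρ t)) (beyond F (ρ a) (ρ t))) :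
    Ind P X (splice a b ρ e '' Icc s t) (between (addConnection F a b (σ a) (σ b) e) (e s) (ρ t))
      (beyond (addConnection F a b (σ a) (σ b) e) (e s) (ρ t)) ∧
    Ind P X (splice a b ρ e '' outer s t)
      (between (addConnection F a b (σ a) (σ b) e) (e s) (ρ t))
      (beyond (addConnection F a b (σ a) (σ b) e) (e s) (ρ t)) := by
  have hbt : PathLe F (σ b) (ρ t) := hk ▸ pathLe_of_le hρ ht
  have hI : ∀ r ∈ between (addConnection F a b (σ a) (σ b) e) (e s) (ρ t),
      r ∈ between F (σ b) (ρ t) ∨ ∃ u, s ≤ u ∧ u < b ∧ r = e u := by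
    intro r hr
    rcases mem_or_new hr.1.right_mem with h | ⟨u, h1, h2, rfl⟩
    · exact .inl ⟨c.le_new_left h hs.1 hs.2 hr.1, c.le_old h (mem_pathSupport hρ t) hr.2⟩
    · exact .inr ⟨u, c.le_new_new hs.1 hs.2 h1 h2 hr.1, h2, rfl⟩
  have hO : ∀ r ∈ beyond (addConnection F a b (σ a) (σ b) e) (e s) (ρ t),
      r ∈ beyond F (σ a) (ρ t) ∨ ∃ u, a < u ∧ u ≤ s ∧ r = e u := by
    rintro r (hr | hr)
    · rcases mem_or_new hr.left_mem with h | ⟨u, h1, h2, rfl⟩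
      · exact .inl (.inl (c.le_new_right h hs.1 hs.2 hr))
      · exact .inr ⟨u, h1, c.le_new_new h1 h2 hs.1 hs.2 hr, rfl⟩
    · rcases mem_or_new hr.right_mem with h | ⟨u, h1, h2, rfl⟩
      · exact .inl (.inr (c.le_old (mem_pathSupport hρ t) h hr))
      · exact absurd (c.trans hbt (c.le_new_right (mem_pathSupport hρ t) h1 h2 hr)) c.not_le
  rw [hk] at ih₁
  rw [hj] at ih₂
  refine ⟨?_, ?_⟩
  -- Inside: start from the times `b`, `t`. The connection then belongs to the exterior, and its
  -- piece after `s` is moved into the conditioning.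
  · have hJ : {σ a, σ b} ⊆ beyond F (σ b) (ρ t) :=
      insert_subset (.inl c.le) (singleton_subset_iff.2 (.inl (pathLe_of_le c.mem le_rfl)))
    refine ((hN.extend hX ih₁.symm (fun _ h => .inr (hJ h)) (beyond_subset _ _)
      (between_subset _ _) (image_subset_pathSupport hρ _)).symm).weaken hX ?_ ?_ ?_ ?_
    · rintro _ ⟨u, hu, rfl⟩
      exact ⟨u, ⟨hs.2.le.trans hu.1, hu.2⟩, splice_outer (.inr hu.1)⟩
    · rintro _ ⟨u, hu, rfl⟩
      rcases mem_or_mem_outer a b u with h | h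
      · exact .inr (.inr ⟨u, h, (splice_inner h).symm⟩)
      · rw [splice_outer h]
        exact .inl (.inl ⟨u, ⟨h.resolve_left (hs.1.trans_le hu.1).not_ge, hu.2⟩, rfl⟩)
    · intro r hr
      rcases hI r hr with h | ⟨u, h1, h2, rfl⟩
      · exact .inl h
      · exact .inr ⟨u, ⟨h1, h2.le.trans ht⟩, splice_inner ⟨hs.1.trans_le h1, h2⟩⟩
    · intro r hr
      rcases hO r hr with h | ⟨u, h1, h2, rfl⟩
      · exact .inl (.inl (h.imp (fun h => c.trans h c.le) id))
      · exact .inl (.inr ⟨u, ⟨h1, h2.trans_lt hs.2⟩, rfl⟩)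
  -- Outside: start from the times `a`, `t`. The connection then belongs to the interval, and its
  -- piece up to `s` is moved into the conditioning.
  · have hJ : {σ a, σ b} ⊆ between F (σ a) (ρ t) :=
      insert_subset ⟨pathLe_of_le c.mem le_rfl, c.trans c.le hbt⟩
        (singleton_subset_iff.2 ⟨c.le, hbt⟩)
    refine (hN.extend hX ih₂ (fun _ h => .inr (hJ h)) (between_subset _ _)
      (beyond_subset _ _) (image_subset_pathSupport hρ _)).weaken hX ?_ ?_ ?_ ?_
    · rintro _ ⟨u, hu, rfl⟩
      exact ⟨u, hu.imp (fun h => le_trans h hs.1.le) id,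
        splice_outer (hu.imp id fun h => ht.trans h)⟩
    · rintro _ ⟨u, hu, rfl⟩
      rcases mem_or_mem_outer a b u with h | h
      · exact .inl (.inr (.inr ⟨u, h, (splice_inner h).symm⟩))
      · rw [splice_outer h]
        refine .inl (.inl ⟨u, ?_, rfl⟩)
        rcases hu with hu | hu
        · exact .inl (h.resolve_right (lt_of_le_of_lt hu hs.2).not_ge)
        · exact .inr hu
    · intro r hr
      rcases hI r hr with h | ⟨u, h1, h2, rfl⟩
      · exact .inl (.inl ⟨c.trans c.le h.1, h.2⟩)
      · exact .inl (.inr ⟨u, ⟨hs.1.trans_le h1, h2⟩, rfl⟩)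
    · intro r hr
      rcases hO r hr with h | ⟨u, h1, h2, rfl⟩
      · exact .inl h
      · exact .inr ⟨u, .inl h2, splice_inner ⟨h1, h2.trans_lt hs.2⟩⟩

/-- The case of a path along the new connection which is entered through its lower end. -/
theorem IsConnection.ind_splice_lower (c : IsConnection F a b σ e)
    (hN : Ind P X {σ a, σ b} (e '' Ioo a b) (pathSupport F))
    {ρ : unitInterval → α} (hρ : ρ ∈ F) (hj : ρ a = σ a) (hk : ρ b = σ b)
    {s t : unitInterval} (hs : s ≤ a) (ht : a < t ∧ t < b)
    (ih₁ : Ind P X (ρ '' Icc s a) (between F (ρ s) (ρ a)) (beyond F (ρ s) (ρ a)))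
    (ih₂ : Ind P X (ρ '' outer s b) (between F (ρ s) (ρ b)) (beyond F (ρ s) (ρ b))) :
    Ind P X (splice a b ρ e '' Icc s t) (between (addConnection F a b (σ a) (σ b) e) (ρ s) (e t))
      (beyond (addConnection F a b (σ a) (σ b) e) (ρ s) (e t)) ∧
    Ind P X (splice a b ρ e '' outer s t)
      (between (addConnection F a b (σ a) (σ b) e) (ρ s) (e t))
      (beyond (addConnection F a b (σ a) (σ b) e) (ρ s) (e t)) := by
  have hsa : PathLe F (ρ s) (σ a) := hj ▸ pathLe_of_le hρ hs
  have hI : ∀ r ∈ between (addConnection F a b (σ a) (σ b) e) (ρ s) (e t),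
      r ∈ between F (ρ s) (σ a) ∨ ∃ u, a < u ∧ u ≤ t ∧ r = e u := by
    intro r hr
    rcases mem_or_new hr.1.right_mem with h | ⟨u, h1, h2, rfl⟩
    · exact .inl ⟨c.le_old (mem_pathSupport hρ s) h hr.1, c.le_new_right h ht.1 ht.2 hr.2⟩
    · exact .inr ⟨u, h1, c.le_new_new h1 h2 ht.1 ht.2 hr.2, rfl⟩
  have hO : ∀ r ∈ beyond (addConnection F a b (σ a) (σ b) e) (ρ s) (e t),
      r ∈ beyond F (ρ s) (σ b) ∨ ∃ u, t ≤ u ∧ u < b ∧ r = e u := by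
    rintro r (hr | hr)
    · rcases mem_or_new hr.left_mem with h | ⟨u, h1, h2, rfl⟩
      · exact .inl (.inl (c.le_old h (mem_pathSupport hρ s) hr))
      · exact absurd (c.trans (c.le_new_left (mem_pathSupport hρ s) h1 h2 hr) hsa) c.not_le
    · rcases mem_or_new hr.right_mem with h | ⟨u, h1, h2, rfl⟩
      · exact .inl (.inr (c.le_new_left h ht.1 ht.2 hr))
      · exact .inr ⟨u, c.le_new_new ht.1 ht.2 h1 h2 hr, h2, rfl⟩
  rw [hj] at ih₁
  rw [hk] at ih₂
  refine ⟨?_, ?_⟩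
  -- The time reversal of the upper case: the starting times are `s`, `a` for the inside and `s`,
  -- `b` for the outside.
  · have hJ : {σ a, σ b} ⊆ beyond F (ρ s) (σ a) :=
      insert_subset (.inr (pathLe_of_le c.mem le_rfl)) (singleton_subset_iff.2 (.inr c.le))
    refine ((hN.extend hX ih₁.symm (fun _ h => .inr (hJ h)) (beyond_subset _ _)
      (between_subset _ _) (image_subset_pathSupport hρ _)).symm).weaken hX ?_ ?_ ?_ ?_
    · rintro _ ⟨u, hu, rfl⟩
      exact ⟨u, ⟨hu.1, hu.2.trans ht.1.le⟩, splice_outer (.inl hu.2)⟩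
    · rintro _ ⟨u, hu, rfl⟩
      rcases mem_or_mem_outer a b u with h | h
      · exact .inr (.inr ⟨u, h, (splice_inner h).symm⟩)
      · rw [splice_outer h]
        exact .inl (.inl ⟨u, ⟨hu.1, h.resolve_right (hu.2.trans_lt ht.2).not_ge⟩, rfl⟩)
    · intro r hr
      rcases hI r hr with h | ⟨u, h1, h2, rfl⟩
      · exact .inl h
      · exact .inr ⟨u, ⟨hs.trans h1.le, h2⟩, splice_inner ⟨h1, h2.trans_lt ht.2⟩⟩
    · intro r hr
      rcases hO r hr with h | ⟨u, h1, h2, rfl⟩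
      · exact .inl (.inl (h.imp id fun h => c.trans c.le h))
      · exact .inl (.inr ⟨u, ⟨ht.1.trans_le h1, h2⟩, rfl⟩)
  · have hJ : {σ a, σ b} ⊆ between F (ρ s) (σ b) :=
      insert_subset ⟨hsa, c.le⟩
        (singleton_subset_iff.2 ⟨c.trans hsa c.le, pathLe_of_le c.mem le_rfl⟩)
    refine (hN.extend hX ih₂ (fun _ h => .inr (hJ h)) (between_subset _ _)
      (beyond_subset _ _) (image_subset_pathSupport hρ _)).weaken hX ?_ ?_ ?_ ?_
    · rintro _ ⟨u, hu, rfl⟩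
      exact ⟨u, hu.imp id fun h => ht.2.le.trans h,
        splice_outer (hu.imp (fun h => le_trans h hs) id)⟩
    · rintro _ ⟨u, hu, rfl⟩
      rcases mem_or_mem_outer a b u with h | h
      · exact .inl (.inr (.inr ⟨u, h, (splice_inner h).symm⟩))
      · rw [splice_outer h]
        refine .inl (.inl ⟨u, ?_, rfl⟩)
        rcases hu with hu | hu
        · exact .inl hu
        · exact .inr (h.resolve_left (lt_of_lt_of_le ht.1 hu).not_ge)
    · intro r hr
      rcases hI r hr with h | ⟨u, h1, h2, rfl⟩
      · exact .inl (.inl ⟨h.1, c.trans h.2 c.le⟩)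
      · exact .inl (.inr ⟨u, ⟨h1, h2.trans_lt ht.2⟩, rfl⟩)
    · intro r hr
      rcases hO r hr with h | ⟨u, h1, h2, rfl⟩
      · exact .inl h
      · exact .inr ⟨u, .inr h1, splice_inner ⟨ht.1.trans_le h1, h2⟩⟩

/-- The Markov property `hm` of the bypassed segments matters only for spliced paths with both times
outer; in the other cases no old segment has to be dropped. -/
theorem SpineMarkov.addConnection (ih : SpineMarkov P X F) (c : IsConnection F a b σ e)
    (hN : Ind P X {σ a, σ b} (e '' Ioo a b) (pathSupport F))
    (hm : ∀ ρ ∈ F, ρ a = σ a → ρ b = σ b →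
      Ind P X {σ a, σ b} (ρ '' Icc a b) (ρ '' outer a b)) :
    SpineMarkov P X (addConnection F a b (σ a) (σ b) e) := by
  rintro _ (hρ | ⟨ρ, hρ, hj, hk, rfl⟩) s t hst
  · have := ih _ hρ s t hst
    have hs := mem_pathSupport hρ s
    have ht := mem_pathSupport hρ t
    have hsub := image_subset_pathSupport hρ
    exact ⟨c.ind_old hX hN hs ht (hsub _) this.1, c.ind_old hX hN hs ht (hsub _) this.2⟩
  · rcases mem_or_mem_outer a b s with hs | hs <;> rcases mem_or_mem_outer a b t with ht | ht
    · rw [splice_inner hs, splice_inner ht]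
      exact c.ind_splice_inner hX hN hρ hj hk hs ht
    · have hbt : b ≤ t := ht.resolve_left (hs.1.trans_le hst).not_ge
      rw [splice_inner hs, splice_outer ht]
      exact c.ind_splice_upper hX hN hρ hj hk hs hbt (ih ρ hρ b t hbt).1
        (ih ρ hρ a t (c.lt.le.trans hbt)).2
    · have hsa : s ≤ a := hs.resolve_right (hst.trans_lt ht.2).not_ge
      rw [splice_outer hs, splice_inner ht]
      exact c.ind_splice_lower hX hN hρ hj hk hsa ht (ih ρ hρ s a hsa).1
        (ih ρ hρ s b (hsa.trans c.lt.le)).2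
    · rw [splice_outer hs, splice_outer ht]
      exact c.ind_splice_outer hX hN hρ hj hk (hm ρ hρ hj hk) hs ht (ih ρ hρ s t hst)

omit hX in
theorem joinClosed_singleton (σ : unitInterval → α) : JoinClosed {σ} := by
  rintro _ rfl _ rfl t -
  refine mem_singleton_iff.2 (funext fun s => ?_)
  rcases le_total s t with h | h
  · exact joinAt_of_le h
  · exact joinAt_of_ge h rfl

/-- On a single path the interval lies in the inside part and the exterior in the outside part, so
one of the two sides is always part of the conditioning. -/
theorem spineMarkov_singleton (hg : Graded {σ}) : SpineMarkov P X {σ} := by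
  rintro _ rfl s t -
  refine ⟨.of_subset_left hX ?_, .of_subset_right hX ?_⟩
  · rintro r ⟨⟨_, rfl, u, v, huv, h1, rfl⟩, ⟨_, rfl, w, z, hwz, h2, h3⟩⟩
    rw [hg _ rfl _ rfl _ _ h1] at huv
    rw [hg _ rfl _ rfl _ _ h2, hg _ rfl _ rfl _ _ h3] at hwz
    exact ⟨v, ⟨huv, hwz⟩, rfl⟩
  · rintro r (⟨_, rfl, u, v, huv, rfl, h1⟩ | ⟨_, rfl, u, v, huv, h1, rfl⟩)
    · rw [hg _ rfl _ rfl _ _ h1] at huv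
      exact ⟨u, .inl huv, rfl⟩
    · rw [hg _ rfl _ rfl _ _ h1] at huv
      exact ⟨v, .inr huv, rfl⟩

theorem MarkovBuilt.spineMarkov (h : MarkovBuilt P X F) (hg : Graded F) :
    JoinClosed F ∧ SpineMarkov P X F := by
  induction h with
  | single σ => exact ⟨joinClosed_singleton σ, spineMarkov_singleton hX hg⟩
  | add F a b σ e hF hab hσ hnew hi hm ih =>
    obtain ⟨h1, h2⟩ := ih (hg.mono subset_addConnection)
    have c : IsConnection F a b σ e := ⟨hab, hσ, hnew, hg, h1⟩
    exact ⟨c.joinClosed_addConnection, h2.addConnection hX c hi hm⟩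

/-- If a path satisfies the two-sided Markov property at two times, then so does the whole
process at the points of the path at these times. -/
theorem SpineMarkov.ind_between_beyond (h : SpineMarkov P X F) (hσ : σ ∈ F) {s t : unitInterval}
    (hst : s ≤ t) (hm : Ind P X {σ s, σ t} (σ '' Icc s t) (σ '' outer s t)) :
    Ind P X {σ s, σ t} (between F (σ s) (σ t)) (beyond F (σ s) (σ t)) := by
  obtain ⟨h1, h2⟩ := h σ hσ s t hst
  have hI := image_Icc_subset_between hσ s t
  have hpi : ({σ s, σ t} : Set α) ⊆ σ '' Icc s t :=
    insert_subset ⟨s, left_mem_Icc.2 hst, rfl⟩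
      (singleton_subset_iff.2 ⟨t, right_mem_Icc.2 hst, rfl⟩)
  have hpo : ({σ s, σ t} : Set α) ⊆ σ '' outer s t :=
    insert_subset ⟨s, left_mem_outer s t, rfl⟩
      (singleton_subset_iff.2 ⟨t, right_mem_outer s t, rfl⟩)
  -- The half of the invariant conditioned on the outside enlarges the outside of the path to the
  -- whole exterior.
  have h3 : Ind P X ({σ s, σ t} ∪ σ '' outer s t) (beyond F (σ s) (σ t)) (σ '' Icc s t) := by
    rw [union_eq_self_of_subset_left hpo]
    exact (h2.weaken hX subset_rfl (fun _ h => .inl (.inl h)) (fun _ h => .inl (hI h))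
      subset_union_left).symm
  have h4 := (hm.symm.contraction hX h3).symm
  have h5 : Ind P X {σ s, σ t} (σ '' Icc s t) (beyond F (σ s) (σ t)) :=
    h4.weaken hX subset_rfl (fun _ h => .inl (.inl h)) subset_union_left
      fun _ h => .inl (.inr h)
  -- The half conditioned on the inside then enlarges the inside of the path to the whole interval.
  refine (h5.contraction hX (D := between F (σ s) (σ t)) ?_).weaken hX subset_rfl
    (fun _ h => .inl (.inl h)) (fun _ h => .inl (.inr h)) subset_union_left
  rwa [union_eq_self_of_subset_left hpi]

end Spine

/-! ### Cells of a family of paths -/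

section Cells

variable {α : Type*}

/-- `r` and `r'` are comparable points strictly between `p` and `q`. -/
def InnerComparable (F : Set (unitInterval → α)) (p q r r' : α) : Prop :=
  (r ∈ between F p q ∧ r ≠ p ∧ r ≠ q) ∧ (r' ∈ between F p q ∧ r' ≠ p ∧ r' ≠ q) ∧
    (PathLe F r r' ∨ PathLe F r' r)

/-- Two paths with common points at the times `s` and `t` whose parts strictly between these times
are not linked by any chain of comparable points of the interval. -/
structure IsTrulySimplePair (F : Set (unitInterval → α)) (s t : unitInterval)
    (ρ₁ ρ₂ : unitInterval → α) : Prop where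
  left : ρ₁ ∈ F
  right : ρ₂ ∈ F
  lt : s < t
  eq_start : ρ₁ s = ρ₂ s
  eq_end : ρ₁ t = ρ₂ t
  not_linked : ∀ u w, s < u → u < t → s < w → w < t →
    ¬ Relation.ReflTransGen (InnerComparable F (ρ₁ s) (ρ₁ t)) (ρ₁ u) (ρ₂ w)

variable {F F' : Set (unitInterval → α)}

theorem between_mono (h : F ⊆ F') (p q : α) : between F p q ⊆ between F' p q :=
  fun _ hr => ⟨hr.1.mono h, hr.2.mono h⟩

theorem InnerComparable.symm {p q r r' : α} (h : InnerComparable F p q r r') :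
    InnerComparable F p q r' r :=
  ⟨h.2.1, h.1, h.2.2.symm⟩

theorem InnerComparable.mono (hF : F ⊆ F') {p q r r' : α} (h : InnerComparable F p q r r') :
    InnerComparable F' p q r r' :=
  ⟨⟨between_mono hF p q h.1.1, h.1.2⟩, ⟨between_mono hF p q h.2.1.1, h.2.1.2⟩,
    h.2.2.imp (PathLe.mono hF) (PathLe.mono hF)⟩

theorem innerComparable_of_mem (hg : Graded F) {ρ : unitInterval → α} (h : ρ ∈ F)
    {s t u w : unitInterval} (hu : s < u ∧ u < t) (hw : s < w ∧ w < t) :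
    InnerComparable F (ρ s) (ρ t) (ρ u) (ρ w) := by
  have key : ∀ {u}, s < u ∧ u < t →
      ρ u ∈ between F (ρ s) (ρ t) ∧ ρ u ≠ ρ s ∧ ρ u ≠ ρ t := fun {u} hu =>
    ⟨⟨pathLe_of_le h hu.1.le, pathLe_of_le h hu.2.le⟩,
      fun e => hu.1.ne' (hg _ h _ h _ _ e), fun e => hu.2.ne (hg _ h _ h _ _ e)⟩
  exact ⟨key hu, key hw, (le_total u w).imp (pathLe_of_le h) (pathLe_of_le h)⟩

namespace IsTrulySimplePair

variable {s t : unitInterval} {ρ₁ ρ₂ : unitInterval → α}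

theorem symm (h : IsTrulySimplePair F s t ρ₁ ρ₂) : IsTrulySimplePair F s t ρ₂ ρ₁ where
  left := h.right
  right := h.left
  lt := h.lt
  eq_start := h.eq_start.symm
  eq_end := h.eq_end.symm
  not_linked u w h1 h2 h3 h4 hl := h.not_linked w u h3 h4 h1 h2 <| by
    rw [h.eq_start, h.eq_end]
    have : Std.Symm (InnerComparable F (ρ₂ s) (ρ₂ t)) := ⟨fun _ _ => InnerComparable.symm⟩
    exact Std.Symm.symm _ _ hl

theorem ne (h : IsTrulySimplePair F s t ρ₁ ρ₂) {u : unitInterval} (h1 : s < u) (h2 : u < t) :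
    ρ₁ u ≠ ρ₂ u := fun e => h.not_linked u u h1 h2 h1 h2 (e ▸ .refl)

variable {a b : unitInterval} {σ e : unitInterval → α}

/-- If a cell began or ended strictly inside the connection, both sides would run along it and
coincide at an interior time. -/
theorem splice_outer_ends (h : IsTrulySimplePair (addConnection F a b (σ a) (σ b) e) s t ρ₁ ρ₂)
    (c : IsConnection F a b σ e) {ρ : unitInterval → α} (hρ : ρ₁ = splice a b ρ e) :
    s ∈ outer a b ∧ t ∈ outer a b := by
  have key : ∀ u, (a < u ∧ u < b) → ρ₁ u = ρ₂ u → ∃ ρ', ρ₂ = splice a b ρ' e := by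
    intro u hu he
    obtain ⟨ρ', -, -, -, h', -⟩ := c.eq_of_new h.right hu.1 hu.2 (u := u)
      (by rw [← he, hρ, splice_inner hu])
    exact ⟨ρ', h'⟩
  constructor
  · rcases mem_or_mem_outer a b s with hs | hs
    · obtain ⟨ρ', hρ'⟩ := key s hs h.eq_start
      obtain ⟨u, h1, h2⟩ := exists_between (lt_min h.lt hs.2)
      have hu : a < u ∧ u < b := ⟨hs.1.trans h1, h2.trans_le (min_le_right _ _)⟩
      exact absurd (by rw [hρ, hρ', splice_inner hu, splice_inner hu])
        (h.ne h1 (h2.trans_le (min_le_left _ _)))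
    · exact hs
  · rcases mem_or_mem_outer a b t with ht | ht
    · obtain ⟨ρ', hρ'⟩ := key t ht h.eq_end
      obtain ⟨u, h1, h2⟩ := exists_between (max_lt h.lt ht.1)
      have hu : a < u ∧ u < b := ⟨(le_max_right _ _).trans_lt h1, h2.trans ht.2⟩
      exact absurd (by rw [hρ, hρ', splice_inner hu, splice_inner hu])
        (h.ne ((le_max_left _ _).trans_lt h1) h2)
    · exact ht

/-- A side of a cell is either old or follows the whole new connection. -/
theorem side (h : IsTrulySimplePair (addConnection F a b (σ a) (σ b) e) s t ρ₁ ρ₂)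
    (c : IsConnection F a b σ e) :
    (∃ ρ ∈ F, ∀ u ∈ Icc s t, ρ₁ u = ρ u) ∨
      (s ≤ a ∧ b ≤ t ∧ ∃ ρ ∈ F, ρ a = σ a ∧ ρ b = σ b ∧ ρ₁ = splice a b ρ e) := by
  rcases h.left with hρ | ⟨ρ, hρ, hj, hk, he⟩
  · exact .inl ⟨ρ₁, hρ, fun _ _ => rfl⟩
  · obtain ⟨hs, ht⟩ := h.splice_outer_ends c he
    by_cases hc : s ≤ a ∧ b ≤ t
    · exact .inr ⟨hc.1, hc.2, ρ, hρ, hj, hk, he⟩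
    · refine .inl ⟨ρ, hρ, fun u hu => ?_⟩
      rw [he, splice_outer]
      rcases hs with hs | hs
      · exact .inl (hu.2.trans (ht.resolve_right fun ht => hc ⟨hs, ht⟩))
      · exact .inr (le_trans hs hu.1)

end IsTrulySimplePair

variable {Ω : Type*} {m0 : MeasurableSpace Ω} {P : Measure Ω} [IsProbabilityMeasure P]
  {X : α → Ω → ℝ} (hX : ∀ p, Measurable (X p))

include hX

/-- The case of a cell with one side along the new connection. -/
theorem IsConnection.ind_cell_new {a b : unitInterval} {σ e : unitInterval → α}
    (c : IsConnection F a b σ e) (hN : Ind P X {σ a, σ b} (e '' Ioo a b) (pathSupport F))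
    (ih : ∀ s t ρ₁ ρ₂, IsTrulySimplePair F s t ρ₁ ρ₂ →
      Ind P X {ρ₁ s, ρ₁ t} (ρ₁ '' Icc s t) (ρ₂ '' Icc s t))
    {s t : unitInterval} {ρ₁ ρ₂ ρ₁' ρ₂' : unitInterval → α}
    (h : IsTrulySimplePair (addConnection F a b (σ a) (σ b) e) s t ρ₁ ρ₂) (hs : s ≤ a)
    (ht : b ≤ t) (hρ₁ : ρ₁' ∈ F) (hj : ρ₁' a = σ a) (hk : ρ₁' b = σ b)
    (he : ρ₁ = splice a b ρ₁' e) (hρ₂ : ρ₂' ∈ F) (h₂ : ∀ u ∈ Icc s t, ρ₂ u = ρ₂' u) :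
    Ind P X {ρ₁ s, ρ₁ t} (ρ₁ '' Icc s t) (ρ₂ '' Icc s t) := by
  have h1s : ρ₁ s = ρ₁' s := by rw [he, splice_outer (.inl hs)]
  have h1t : ρ₁ t = ρ₁' t := by rw [he, splice_outer (.inr ht)]
  have himg : ρ₂ '' Icc s t = ρ₂' '' Icc s t := image_congr h₂
  -- In this case the side is the connection itself, which is independent of everything old given
  -- its ends.
  by_cases hends : s = a ∧ t = b
  · obtain ⟨rfl, rfl⟩ := hends
    rw [h1s, h1t, hj, hk]
    refine hN.weaken hX subset_rfl (fun _ h => .inl (.inl h)) ?_ ?_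
    · rintro _ ⟨u, hu, rfl⟩
      rw [he]
      rcases mem_or_mem_outer s t u with h | h | h
      · exact .inl ⟨u, h, (splice_inner h).symm⟩
      · rw [le_antisymm h hu.1, splice_left, hj]
        exact .inr (.inl rfl)
      · rw [le_antisymm hu.2 h, splice_right, hk]
        exact .inr (.inr rfl)
    · rw [himg]
      exact fun _ h => .inl (image_subset_pathSupport hρ₂ _ h)
  · have hIs : s ∈ Icc s t := left_mem_Icc.2 h.lt.le
    have hIt : t ∈ Icc s t := right_mem_Icc.2 h.lt.le
    have hpair : IsTrulySimplePair F s t ρ₁' ρ₂' := by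
      refine ⟨hρ₁, hρ₂, h.lt, ?_, ?_, ?_⟩
      · rw [← h1s, h.eq_start, h₂ s hIs]
      · rw [← h1t, h.eq_end, h₂ t hIt]
      · intro u w hu hu' hw hw' hl
        -- Points of `ρ₁'` at outer times also lie on `ρ₁`, so a chain from them is excluded. A
        -- chain from the bypassed segment is prolonged backwards to the point at time `a` or `b`,
        -- at least one of which is strictly between `s` and `t`.
        have hmain : ∀ v, v ∈ outer a b → s < v → v < t →
            ¬ Relation.ReflTransGen (InnerComparable F (ρ₁' s) (ρ₁' t)) (ρ₁' v) (ρ₂' w) := by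
          intro v hv hv1 hv2 hl
          refine h.not_linked v w hv1 hv2 hw hw' ?_
          rw [h₂ w ⟨hw.le, hw'.le⟩, h1s, h1t, he, splice_outer hv]
          exact Relation.ReflTransGen.mono (fun _ _ => InnerComparable.mono subset_addConnection) _ _ hl
        rcases mem_or_mem_outer a b u with hi | ho
        · by_cases hsa : s < a
          · have ha : s < a ∧ a < t := ⟨hsa, c.lt.trans_le ht⟩
            exact hmain a (left_mem_outer a b) ha.1 ha.2
              (.head (innerComparable_of_mem c.gradedOld hρ₁ ha ⟨hu, hu'⟩) hl)
          · have hsa' : s = a := le_antisymm hs (not_lt.1 hsa)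
            have hb : s < b ∧ b < t := ⟨hs.trans_lt c.lt,
              lt_of_le_of_ne ht fun h => hends ⟨hsa', h.symm⟩⟩
            exact hmain b (right_mem_outer a b) hb.1 hb.2
              (.head (innerComparable_of_mem c.gradedOld hρ₁ hb ⟨hu, hu'⟩) hl)
        · exact hmain u ho hu hu' hl
    have hJ : {σ a, σ b} ⊆ ρ₁' '' Icc s t := by
      rw [← hj, ← hk]
      exact insert_subset ⟨a, ⟨hs, c.lt.le.trans ht⟩, rfl⟩
        (singleton_subset_iff.2 ⟨b, ⟨hs.trans c.lt.le, ht⟩, rfl⟩)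
    have hC : ({ρ₁' s, ρ₁' t} : Set α) ⊆ pathSupport F :=
      insert_subset (mem_pathSupport hρ₁ s) (singleton_subset_iff.2 (mem_pathSupport hρ₁ t))
    rw [h1s, h1t, himg]
    refine (hN.extend hX (ih _ _ _ _ hpair) (fun _ h => .inr (hJ h))
      (image_subset_pathSupport hρ₁ _) (image_subset_pathSupport hρ₂ _) hC).weaken hX subset_rfl
      (fun _ h => .inl (.inl h)) ?_ subset_union_left
    rintro _ ⟨u, hu, rfl⟩
    rw [he]
    rcases mem_or_mem_outer a b u with h | h
    · exact .inl (.inr ⟨u, h, (splice_inner h).symm⟩)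
    · exact .inl (.inl ⟨u, hu, (splice_outer h).symm⟩)

/-- The sides of truly simple cells are conditionally independent. -/
theorem MarkovBuilt.ind_cell (h : MarkovBuilt P X F) (hg : Graded F) :
    ∀ s t ρ₁ ρ₂, IsTrulySimplePair F s t ρ₁ ρ₂ →
      Ind P X {ρ₁ s, ρ₁ t} (ρ₁ '' Icc s t) (ρ₂ '' Icc s t) := by
  induction h with
  | single σ =>
    intro s t ρ₁ ρ₂ hp
    obtain ⟨u, h1, h2⟩ := exists_between hp.lt
    obtain rfl := mem_singleton_iff.1 hp.left
    obtain rfl := mem_singleton_iff.1 hp.right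
    exact absurd rfl (hp.ne h1 h2)
  | add F a b σ e hF hab hσ hnew hi hm ih =>
    have hg' := hg.mono subset_addConnection
    have c : IsConnection F a b σ e := ⟨hab, hσ, hnew, hg, (hF.spineMarkov hX hg').1⟩
    intro s t ρ₁ ρ₂ hp
    rcases hp.side c with ⟨ρ₁', hρ₁, h₁⟩ | ⟨hs, ht, ρ₁', hρ₁, hj, hk, h₁⟩ <;>
      rcases hp.symm.side c with ⟨ρ₂', hρ₂, h₂⟩ | ⟨hs', ht', ρ₂', hρ₂, hj', hk', h₂⟩
    · have hIs : s ∈ Icc s t := left_mem_Icc.2 hp.lt.le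
      have hIt : t ∈ Icc s t := right_mem_Icc.2 hp.lt.le
      have hpair : IsTrulySimplePair F s t ρ₁' ρ₂' := by
        refine ⟨hρ₁, hρ₂, hp.lt, ?_, ?_, ?_⟩
        · rw [← h₁ s hIs, ← h₂ s hIs, hp.eq_start]
        · rw [← h₁ t hIt, ← h₂ t hIt, hp.eq_end]
        · intro u w hu hu' hw hw' hl
          refine hp.not_linked u w hu hu' hw hw' ?_
          rw [h₁ u ⟨hu.le, hu'.le⟩, h₂ w ⟨hw.le, hw'.le⟩, h₁ s hIs, h₁ t hIt]
          exact Relation.ReflTransGen.mono (fun _ _ => InnerComparable.mono subset_addConnection) _ _ hl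
      have := ih hg' _ _ _ _ hpair
      rwa [← h₁ s hIs, ← h₁ t hIt, ← image_congr h₁, ← image_congr h₂] at this
    · have := c.ind_cell_new hX hi (ih hg') hp.symm hs' ht' hρ₂ hj' hk' h₂ hρ₁ h₁
      rw [hp.eq_start, hp.eq_end]
      exact this.symm
    · exact c.ind_cell_new hX hi (ih hg') hp hs ht hρ₁ hj hk h₁ hρ₂ h₂
    -- Both sides cannot run along the connection, since they have no common interior points.
    · obtain ⟨u, h1, h2⟩ := exists_between hab
      exact absurd (by rw [h₁, h₂, splice_inner ⟨h1, h2⟩, splice_inner ⟨h1, h2⟩])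
        (hp.ne (hs.trans_lt h1) (h2.trans_le ht))

end Cells

/-! ### Points and time-paths of a time-like graph -/

namespace TLG

variable {G : TLG}

theorem pt_inner {e : G.E} {t : unitInterval} (h : G.time (G.src e) < t ∧ t < G.time (G.tgt e)) :
    G.pt e t = .inner e t h :=
  dif_pos h

theorem pt_of_le {e : G.E} {t : unitInterval} (h : t ≤ G.time (G.src e)) :
    G.pt e t = .vertex (G.src e) := by
  rw [pt, dif_neg fun h' => h.not_gt h'.1, if_pos h]

theorem pt_of_ge {e : G.E} {t : unitInterval} (h : G.time (G.tgt e) ≤ t) :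
    G.pt e t = .vertex (G.tgt e) := by
  rw [pt, dif_neg fun h' => h.not_gt h'.2, if_neg ((G.src_lt_tgt e).trans_le h).not_ge]

theorem pt_cases (e : G.E) (t : unitInterval) :
    (t ≤ G.time (G.src e) ∧ G.pt e t = .vertex (G.src e)) ∨
    (G.time (G.tgt e) ≤ t ∧ G.pt e t = .vertex (G.tgt e)) ∨
    ∃ h : G.time (G.src e) < t ∧ t < G.time (G.tgt e), G.pt e t = .inner e t h := by
  by_cases h1 : t ≤ G.time (G.src e)
  · exact .inl ⟨h1, pt_of_le h1⟩
  · by_cases h2 : G.time (G.tgt e) ≤ t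
    · exact .inr (.inl ⟨h2, pt_of_ge h2⟩)
    · exact .inr (.inr ⟨⟨not_le.1 h1, not_le.1 h2⟩, pt_inner _⟩)

/-- The time of a point. -/
def Point.time : G.Point → unitInterval
  | .vertex v => G.time v
  | .inner _ t _ => t

/-- The vertex at the lower end of the edge of a point. -/
def Point.lower : G.Point → G.V
  | .vertex v => v
  | .inner e _ _ => G.src e

/-- The vertex at the upper end of the edge of a point. -/
def Point.upper : G.Point → G.V
  | .vertex v => v
  | .inner e _ _ => G.tgt e

theorem isPath_append {u v : G.V} {l m : List G.E} :
    IsPath u (l ++ m) v ↔ ∃ w, IsPath u l w ∧ IsPath w m v := by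
  constructor
  · intro h
    induction l generalizing u with
    | nil => exact ⟨u, rfl, h⟩
    | cons e l ih =>
      obtain ⟨w, h1, h2⟩ := ih h.2
      exact ⟨w, ⟨h.1, h1⟩, h2⟩
  · rintro ⟨w, h1, h2⟩
    exact h1.append h2

theorem IsPath.split {u v : G.V} {l : List G.E} (h : IsPath u l v) {e : G.E} (he : e ∈ l) :
    ∃ l₁ l₂, l = l₁ ++ e :: l₂ ∧ IsPath u l₁ (G.src e) ∧ IsPath (G.tgt e) l₂ v := by
  obtain ⟨l₁, l₂, rfl⟩ := List.append_of_mem he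
  obtain ⟨w, h1, rfl, h2⟩ := isPath_append.1 h
  exact ⟨l₁, l₂, rfl, h1, h2⟩

theorem IsPath.cons {e : G.E} {v : G.V} {l : List G.E} (h : IsPath (G.tgt e) l v) :
    IsPath (G.src e) (e :: l) v :=
  ⟨rfl, h⟩

theorem isPath_singleton (e : G.E) : IsPath (G.src e) [e] (G.tgt e) := ⟨rfl, rfl⟩

theorem IsPath.time_le {u v : G.V} {l : List G.E} (h : IsPath u l v) : G.time u ≤ G.time v := by
  induction l generalizing u with
  | nil => cases h; exact le_rfl
  | cons e l ih =>
    obtain ⟨rfl, h⟩ := h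
    exact (G.src_lt_tgt e).le.trans (ih h)

theorem IsPath.time_lt {u v : G.V} {l : List G.E} (h : IsPath u l v) (hl : l ≠ []) :
    G.time u < G.time v := by
  cases l with
  | nil => exact absurd rfl hl
  | cons e l =>
    obtain ⟨rfl, h⟩ := h
    exact (G.src_lt_tgt e).trans_le h.time_le

theorem IsPath.eq_nil {u : G.V} {l : List G.E} (h : IsPath u l u) : l = [] := by
  by_contra hl
  exact (h.time_lt hl).false

theorem Reach.refl (u : G.V) : Reach u u := ⟨[], rfl⟩

theorem Reach.trans {u v w : G.V} (h : Reach u v) (h' : Reach v w) : Reach u w := by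
  obtain ⟨l, h⟩ := h
  obtain ⟨m, h'⟩ := h'
  exact ⟨l ++ m, h.append h'⟩

theorem Reach.time_le {u v : G.V} (h : Reach u v) : G.time u ≤ G.time v :=
  h.choose_spec.time_le

theorem reach_edge (e : G.E) : Reach (G.src e) (G.tgt e) := ⟨[e], isPath_singleton e⟩

theorem Reach.eq_of_time_le {u v : G.V} (h : Reach u v) (h' : G.time v ≤ G.time u) : u = v := by
  obtain ⟨l, h⟩ := h
  cases l with
  | nil => exact h
  | cons e l => exact absurd h' (h.time_lt (List.cons_ne_nil e l)).not_ge

/-- Outgoing edges lead upwards in time, and there are finitely many vertices. The start is not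
required to have an outgoing edge, which is why `h0` is assumed. -/
theorem reach_finish (h0 : Reach G.start G.finish) (v : G.V) : Reach v G.finish := by
  have := G.finV
  have hwf : WellFounded fun a b : G.V => G.time b < G.time a :=
    Finite.wellFounded_of_trans_of_irrefl (r := fun a b : G.V => G.time b < G.time a)
  induction v using hwf.induction with
  | h v ih =>
    by_cases h1 : v = G.finish
    · exact h1 ▸ Reach.refl _
    · by_cases h2 : v = G.start
      · exact h2 ▸ h0
      · obtain ⟨e, rfl⟩ := G.exists_outgoing v h2 h1
        exact (reach_edge e).trans (ih _ (G.src_lt_tgt e))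

theorem reach_start (h0 : Reach G.start G.finish) (v : G.V) : Reach G.start v := by
  have := G.finV
  have hwf : WellFounded fun a b : G.V => G.time a < G.time b :=
    Finite.wellFounded_of_trans_of_irrefl (r := fun a b : G.V => G.time a < G.time b)
  induction v using hwf.induction with
  | h v ih =>
    by_cases h1 : v = G.start
    · exact h1 ▸ Reach.refl _
    · by_cases h2 : v = G.finish
      · exact h2 ▸ h0
      · obtain ⟨e, rfl⟩ := G.exists_incoming v h1 h2
        exact (ih _ (G.src_lt_tgt e)).trans (reach_edge e)

/-! ### The point of a time-path at a given time -/

section PathPoint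

variable {u v w : G.V} {l l₁ l₂ : List G.E} {e : G.E} {t : unitInterval}

theorem pathPoint_of_le (h : IsPath u l v) (ht : t ≤ G.time u) :
    pathPoint u l t = .vertex u := by
  cases l with
  | nil => rfl
  | cons e l =>
    obtain ⟨rfl, h⟩ := h
    rw [pathPoint, if_pos (ht.trans (G.src_lt_tgt e).le), pt_of_le ht]

theorem pathPoint_cons_of_ge (h : IsPath (G.tgt e) l v) (ht : G.time (G.tgt e) ≤ t) :
    pathPoint u (e :: l) t = pathPoint (G.tgt e) l t := by
  rw [pathPoint]
  split_ifs with h'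
  · rw [pathPoint_of_le h h', pt_of_ge ht]
  · rfl

theorem pathPoint_of_ge (h : IsPath u l v) (ht : G.time v ≤ t) :
    pathPoint u l t = .vertex v := by
  induction l generalizing u with
  | nil => cases h; rfl
  | cons e l ih => rw [pathPoint_cons_of_ge h.2 (h.2.time_le.trans ht), ih h.2]

theorem pathPoint_append_of_ge (h₁ : IsPath u l₁ w) (h₂ : IsPath w l₂ v) (ht : G.time w ≤ t) :
    pathPoint u (l₁ ++ l₂) t = pathPoint w l₂ t := by
  induction l₁ generalizing u with
  | nil => cases h₁; rfl
  | cons e l ih =>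
    rw [List.cons_append, pathPoint_cons_of_ge (h₁.2.append h₂) (h₁.2.time_le.trans ht), ih h₁.2]

theorem pathPoint_append_of_le (h₁ : IsPath u l₁ w) (h₂ : IsPath w l₂ v) (ht : t ≤ G.time w) :
    pathPoint u (l₁ ++ l₂) t = pathPoint u l₁ t := by
  induction l₁ generalizing u with
  | nil => cases h₁; exact pathPoint_of_le h₂ ht
  | cons e l ih =>
    rw [List.cons_append, pathPoint, pathPoint, ih h₁.2]

theorem pathPoint_append_self (h₁ : IsPath u l₁ w) (h₂ : IsPath w l₂ v) :
    pathPoint u (l₁ ++ l₂) (G.time w) = .vertex w := by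
  rw [pathPoint_append_of_ge h₁ h₂ le_rfl, pathPoint_of_le h₂ le_rfl]

theorem pathPoint_of_mem (h : IsPath u l v) (he : e ∈ l) (h1 : G.time (G.src e) ≤ t)
    (h2 : t ≤ G.time (G.tgt e)) : pathPoint u l t = G.pt e t := by
  obtain ⟨l₁, l₂, rfl, h₁, h₂⟩ := h.split he
  rw [pathPoint_append_of_ge h₁ h₂.cons h1, pathPoint, if_pos h2]

theorem exists_split_of_pathPoint (h : IsPath u l v) (hw : pathPoint u l t = .vertex w) :
    ∃ l₁ l₂, l = l₁ ++ l₂ ∧ IsPath u l₁ w ∧ IsPath w l₂ v := by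
  induction l generalizing u with
  | nil =>
    cases h; cases hw
    exact ⟨[], [], rfl, rfl, rfl⟩
  | cons e l ih =>
    obtain ⟨rfl, h⟩ := h
    by_cases ht : t ≤ G.time (G.tgt e)
    · rw [pathPoint, if_pos ht] at hw
      rcases pt_cases e t with ⟨-, h'⟩ | ⟨-, h'⟩ | ⟨h', h''⟩
      · obtain rfl := Point.vertex.inj (h'.symm.trans hw)
        exact ⟨[], e :: l, rfl, rfl, rfl, h⟩
      · obtain rfl := Point.vertex.inj (h'.symm.trans hw)
        exact ⟨[e], l, rfl, isPath_singleton e, h⟩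
      · rw [h''] at hw; cases hw
    · rw [pathPoint, if_neg ht] at hw
      obtain ⟨l₁, l₂, rfl, h1, h2⟩ := ih h hw
      exact ⟨e :: l₁, l₂, rfl, ⟨rfl, h1⟩, h2⟩

theorem mem_of_pathPoint {s : unitInterval} {h' : G.time (G.src e) < s ∧ s < G.time (G.tgt e)}
    (hp : pathPoint u l t = .inner e s h') : e ∈ l := by
  induction l generalizing u with
  | nil => cases hp
  | cons e' l ih =>
    rw [pathPoint] at hp
    split_ifs at hp with ht
    · rcases pt_cases e' t with ⟨-, h⟩ | ⟨-, h⟩ | ⟨h, h''⟩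
      · rw [h] at hp; cases hp
      · rw [h] at hp; cases hp
      · rw [h''] at hp; cases hp; exact List.mem_cons_self
    · exact List.mem_cons_of_mem _ (ih hp)

theorem time_pathPoint (h : IsPath u l v) (h1 : G.time u ≤ t) (h2 : t ≤ G.time v) :
    (pathPoint u l t).time = t := by
  induction l generalizing u with
  | nil => cases h; exact le_antisymm h1 h2
  | cons e l ih =>
    obtain ⟨rfl, h⟩ := h
    rw [pathPoint]
    split_ifs with ht
    · rcases pt_cases e t with ⟨h', h''⟩ | ⟨h', h''⟩ | ⟨h', h''⟩
      · rw [h'']; exact le_antisymm h1 h'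
      · rw [h'']; exact le_antisymm h' ht
      · rw [h'']; rfl
    · exact ih h (not_le.1 ht).le

theorem reach_lower_pathPoint (h : IsPath u l v) : Reach u (pathPoint u l t).lower := by
  induction l generalizing u with
  | nil => exact Reach.refl u
  | cons e l ih =>
    obtain ⟨rfl, h⟩ := h
    rw [pathPoint]
    split_ifs with ht
    · rcases pt_cases e t with ⟨_, h''⟩ | ⟨_, h''⟩ | ⟨_, h''⟩ <;> rw [h'']
      · exact Reach.refl _
      · exact reach_edge e
      · exact Reach.refl _
    · exact (reach_edge e).trans (ih h)

theorem pathPoint_mem_pathPoints (hl : l ≠ []) : pathPoint u l t ∈ pathPoints l := by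
  induction l generalizing u with
  | nil => exact absurd rfl hl
  | cons e l ih =>
    rw [pathPoint]
    split_ifs with ht
    · exact ⟨e, List.mem_cons_self, t, rfl⟩
    · by_cases h : l = []
      · subst h
        exact ⟨e, List.mem_cons_self, t, (pt_of_ge (not_le.1 ht).le).symm⟩
      · obtain ⟨e', he', t', h'⟩ := ih (u := G.tgt e) h
        exact ⟨e', List.mem_cons_of_mem _ he', t', h'⟩

/-- `pt` clamps to the edge and `pathPoint` to the whole path, so `s` must be the time of the
clamped point, which may differ from `t`. -/
theorem exists_pathPoint_eq (h : IsPath u l v) (he : e ∈ l) (t : unitInterval) :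
    ∃ s ∈ Icc (G.time u) (G.time v), pathPoint u l s = G.pt e t := by
  obtain ⟨l₁, l₂, -, h₁, h₂⟩ := h.split he
  have h1 := h₁.time_le
  have h2 := h₂.time_le
  have h3 := (G.src_lt_tgt e).le
  rcases pt_cases e t with ⟨-, h'⟩ | ⟨-, h'⟩ | ⟨h', h''⟩
  · refine ⟨_, ⟨h1, h3.trans h2⟩, ?_⟩
    rw [pathPoint_of_mem h he le_rfl h3, pt_of_le le_rfl, h']
  · refine ⟨_, ⟨h1.trans h3, h2⟩, ?_⟩
    rw [pathPoint_of_mem h he h3 le_rfl, pt_of_ge le_rfl, h']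
  · exact ⟨t, ⟨h1.trans h'.1.le, h'.2.le.trans h2⟩, pathPoint_of_mem h he h'.1.le h'.2.le⟩

end PathPoint

/-! ### The family of the full time-paths -/

variable (G) in
/-- The full time-paths, as functions of time. -/
def pathFamily : Set (unitInterval → G.Point) := range FullPath.point

theorem FullPath.mem_pathFamily (σ : G.FullPath) : σ.point ∈ G.pathFamily := ⟨σ, rfl⟩

theorem FullPath.time_point (σ : G.FullPath) (t : unitInterval) : (σ.point t).time = t :=
  time_pathPoint σ.2 (G.time_start ▸ t.2.1) (G.time_finish ▸ t.2.2)

theorem graded_pathFamily : Graded G.pathFamily := by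
  rintro _ ⟨σ, rfl⟩ _ ⟨σ', rfl⟩ s t h
  rw [← σ.time_point s, h, σ'.time_point t]

theorem FullPath.point_vertex {σ : G.FullPath} {w : G.V} {l₁ l₂ : List G.E}
    (h : σ.1 = l₁ ++ l₂) (h₁ : IsPath G.start l₁ w) (h₂ : IsPath w l₂ G.finish) :
    σ.point (G.time w) = .vertex w := by
  rw [FullPath.point, h, pathPoint_append_self h₁ h₂]

theorem FullPath.point_inner {σ : G.FullPath} {e : G.E} (he : e ∈ σ.1) {t : unitInterval}
    (h : G.time (G.src e) < t ∧ t < G.time (G.tgt e)) : σ.point t = .inner e t h := by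
  rw [FullPath.point, pathPoint_of_mem σ.2 he h.1.le h.2.le, pt_inner h]

/-- The edges through which a point is left. -/
def Point.edges : G.Point → List G.E
  | .vertex _ => []
  | .inner e _ _ => [e]

theorem Point.isPath_edges (p : G.Point) : IsPath p.lower p.edges p.upper := by
  cases p with
  | vertex v => rfl
  | inner e t h => exact isPath_singleton e

theorem Point.time_lower_le (p : G.Point) : G.time p.lower ≤ p.time := by
  cases p with
  | vertex v => exact le_rfl
  | inner e t h => exact h.1.le

theorem Point.time_le_upper (p : G.Point) : p.time ≤ G.time p.upper := by
  cases p with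
  | vertex v => exact le_rfl
  | inner e t h => exact h.2.le

theorem FullPath.point_time {σ : G.FullPath} {p : G.Point} {l₁ l₂ : List G.E}
    (h : σ.1 = l₁ ++ (p.edges ++ l₂)) (h₁ : IsPath G.start l₁ p.lower)
    (h₂ : IsPath p.upper l₂ G.finish) : σ.point p.time = p := by
  cases p with
  | vertex v => exact FullPath.point_vertex h h₁ h₂
  | inner e t ht => exact FullPath.point_inner (by rw [h]; simp [Point.edges]) ht

theorem reach_of_pathPoint {u v : G.V} {l : List G.E} (h : IsPath u l v) {s t : unitInterval}
    (hst : s ≤ t) (hs : (pathPoint u l s).time = s) (ht : (pathPoint u l t).time = t) :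
    Reach (pathPoint u l s).upper (pathPoint u l t).lower ∨
      ∃ e h h', pathPoint u l s = .inner e s h ∧ pathPoint u l t = .inner e t h' := by
  cases hp : pathPoint u l s with
  | vertex w =>
    left
    rw [hp] at hs
    obtain ⟨l₁, l₂, rfl, h₁, h₂⟩ := exists_split_of_pathPoint h hp
    rw [pathPoint_append_of_ge h₁ h₂ (le_of_eq_of_le hs hst)]
    exact reach_lower_pathPoint h₂
  | inner e s' h' =>
    rw [hp] at hs
    obtain rfl : s' = s := hs
    have he := mem_of_pathPoint hp
    by_cases hte : t < G.time (G.tgt e)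
    · right
      refine ⟨e, h', ⟨h'.1.trans_le hst, hte⟩, rfl, ?_⟩
      rw [pathPoint_of_mem h he (h'.1.le.trans hst) hte.le, pt_inner]
    · left
      obtain ⟨l₁, l₂, rfl, h₁, h₂⟩ := h.split he
      rw [pathPoint_append_of_ge h₁ h₂.cons (h'.1.le.trans hst),
        pathPoint_cons_of_ge h₂ (not_lt.1 hte)]
      exact reach_lower_pathPoint h₂

/-- The order of the points of a time-like graph. -/
theorem pathLe_iff (h0 : Reach G.start G.finish) {p q : G.Point} :
    PathLe G.pathFamily p q ↔ Reach p.upper q.lower ∨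
      ∃ e s t hs ht, s ≤ t ∧ p = .inner e s hs ∧ q = .inner e t ht := by
  constructor
  · rintro ⟨_, ⟨σ, rfl⟩, s, t, hst, rfl, rfl⟩
    refine (reach_of_pathPoint σ.2 hst (σ.time_point s) (σ.time_point t)).imp id ?_
    rintro ⟨e, h, h', h1, h2⟩
    exact ⟨e, s, t, h, h', hst, h1, h2⟩
  · rintro (h | ⟨e, s, t, hs, ht, hst, rfl, rfl⟩)
    · obtain ⟨l₁, h₁⟩ := reach_start h0 p.lower
      obtain ⟨l₂, h₂⟩ := h
      obtain ⟨l₃, h₃⟩ := reach_finish h0 q.upper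
      have h23 := h₂.append (q.isPath_edges.append h₃)
      have h12 := h₁.append (p.isPath_edges.append h₂)
      refine ⟨_, FullPath.mem_pathFamily ⟨_, h₁.append (p.isPath_edges.append h23)⟩, p.time,
        q.time, p.time_le_upper.trans (h₂.time_le.trans q.time_lower_le),
        FullPath.point_time rfl h₁ h23, FullPath.point_time ?_ h12 h₃⟩
      simp only [List.append_assoc]
    · obtain ⟨l₁, h₁⟩ := reach_start h0 (G.src e)
      obtain ⟨l₂, h₂⟩ := reach_finish h0 (G.tgt e)
      have he : e ∈ l₁ ++ e :: l₂ := by simp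
      exact ⟨_, FullPath.mem_pathFamily ⟨l₁ ++ e :: l₂, h₁.append ⟨rfl, h₂⟩⟩, s, t, hst,
        FullPath.point_inner he hs, FullPath.point_inner he ht⟩

theorem pathLe_vertex_left (h0 : Reach G.start G.finish) {v : G.V} {q : G.Point} :
    PathLe G.pathFamily (.vertex v) q ↔ Reach v q.lower := by
  rw [pathLe_iff h0]
  exact or_iff_left fun ⟨_, _, _, _, _, _, h, _⟩ => nomatch h

theorem pathLe_vertex_right (h0 : Reach G.start G.finish) {v : G.V} {p : G.Point} :
    PathLe G.pathFamily p (.vertex v) ↔ Reach p.upper v := by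
  rw [pathLe_iff h0]
  exact or_iff_left fun ⟨_, _, _, _, _, _, _, h⟩ => nomatch h

theorem Point.reach_lower_upper (p : G.Point) : Reach p.lower p.upper := ⟨_, p.isPath_edges⟩

/-- The points of an interval graph. -/
theorem intervalPoints_eq (h0 : Reach G.start G.finish) (u v : G.V) :
    intervalPoints u v = between G.pathFamily (.vertex u) (.vertex v) := by
  ext p
  simp only [between, mem_ofPred_eq, pathLe_vertex_left h0, pathLe_vertex_right h0]
  constructor
  · rintro (⟨w, hw, rfl⟩ | ⟨e, he, t, rfl⟩)
    · exact hw
    · rcases pt_cases e t with ⟨_, h⟩ | ⟨_, h⟩ | ⟨_, h⟩ <;> rw [h]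
      · exact he.1
      · exact he.2
      · exact ⟨he.1.1, he.2.2⟩
  · rintro ⟨h1, h2⟩
    cases p with
    | vertex w => exact .inl ⟨w, ⟨h1, h2⟩, rfl⟩
    | inner e t h =>
      exact .inr ⟨e, ⟨⟨h1, (reach_edge e).trans h2⟩, (Reach.trans h1 (reach_edge e)), h2⟩, t,
        (pt_inner h).symm⟩

/-- Everything is reachable from the start and reaches the finish, so only one condition remains for
each of the two intervals. -/
theorem intervalPoints_union_eq (h0 : Reach G.start G.finish) (u v : G.V) :
    intervalPoints G.start u ∪ intervalPoints v G.finish =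
      beyond G.pathFamily (.vertex u) (.vertex v) := by
  rw [intervalPoints_eq h0, intervalPoints_eq h0]
  ext p
  simp only [between, beyond, mem_union, mem_ofPred_eq, pathLe_vertex_left h0,
    pathLe_vertex_right h0, reach_start h0, reach_finish h0, true_and, and_true]

/-- The points of a part of a full time-path. -/
theorem pathPoints_eq_image {σ : G.FullPath} {u v : G.V} {l₁ l l₂ : List G.E}
    (h : σ.1 = l₁ ++ (l ++ l₂)) (h₁ : IsPath G.start l₁ u) (hl : IsPath u l v)
    (h₂ : IsPath v l₂ G.finish) (hne : l ≠ []) :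
    pathPoints l = σ.point '' Icc (G.time u) (G.time v) := by
  have key : ∀ t ∈ Icc (G.time u) (G.time v), σ.point t = pathPoint u l t := by
    intro t ht
    rw [FullPath.point, h, pathPoint_append_of_ge h₁ (hl.append h₂) ht.1,
      pathPoint_append_of_le hl h₂ ht.2]
  ext p
  constructor
  · rintro ⟨e, he, t, rfl⟩
    obtain ⟨s, hs, h'⟩ := exists_pathPoint_eq hl he t
    exact ⟨s, hs, (key s hs).trans h'⟩
  · rintro ⟨t, ht, rfl⟩
    rw [key t ht]
    exact pathPoint_mem_pathPoints hne

end TLG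

/-! ### Cells of a time-like graph -/

namespace TLG

variable {G : TLG}

theorem mem_interiorV {u v w : G.V} {l : List G.E} (h : IsPath u l v) :
    w ∈ interiorV l ↔
      ∃ l₁ l₂, l₁ ≠ [] ∧ l₂ ≠ [] ∧ l = l₁ ++ l₂ ∧ IsPath u l₁ w ∧ IsPath w l₂ v := by
  induction l generalizing u with
  | nil =>
    refine iff_of_false (fun h => by simp [interiorV] at h) ?_
    rintro ⟨l₁, l₂, h1, -, h3, -⟩
    exact h1 (List.append_eq_nil_iff.1 h3.symm).1
  | cons e l ih =>
    obtain ⟨rfl, h⟩ := h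
    cases l with
    | nil =>
      refine iff_of_false (fun h => by simp [interiorV] at h) ?_
      rintro ⟨l₁, l₂, h1, h2, h3, -⟩
      have := congrArg List.length h3
      have h4 := List.length_pos_of_ne_nil h1
      have h5 := List.length_pos_of_ne_nil h2
      simp only [List.length_cons, List.length_nil, List.length_append] at this
      omega
    | cons e' l =>
      have hi : w ∈ interiorV (e :: e' :: l) ↔ w = G.tgt e ∨ w ∈ interiorV (e' :: l) := by
        simp [interiorV]
      rw [hi, ih h]
      constructor
      · rintro (rfl | ⟨l₁, l₂, h1, h2, h3, h4, h5⟩)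
        · exact ⟨[e], _, List.cons_ne_nil _ _, List.cons_ne_nil _ _, rfl, isPath_singleton e, h⟩
        · exact ⟨e :: l₁, l₂, List.cons_ne_nil _ _, h2, by rw [h3, List.cons_append], h4.cons, h5⟩
      · rintro ⟨l₁, l₂, h1, h2, h3, h4, h5⟩
        cases l₁ with
        | nil => exact absurd rfl h1
        | cons e₁ l₁ =>
          obtain ⟨rfl, h6⟩ := List.cons.inj h3
          by_cases hl : l₁ = []
          · subst hl; exact .inl h4.2.symm
          · exact .inr ⟨l₁, l₂, hl, h2, h6, h4.2, h5⟩

theorem time_of_mem_interiorV {u v w : G.V} {l : List G.E} (h : IsPath u l v)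
    (hw : w ∈ interiorV l) : G.time u < G.time w ∧ G.time w < G.time v := by
  obtain ⟨l₁, l₂, h1, h2, -, h3, h4⟩ := (mem_interiorV h).1 hw
  exact ⟨h3.time_lt h1, h4.time_lt h2⟩

theorem reach_of_mem_interiorV {u v w : G.V} {l : List G.E} (h : IsPath u l v)
    (hw : w ∈ interiorV l) : w ∈ intervalV u v := by
  obtain ⟨l₁, l₂, -, -, -, h3, h4⟩ := (mem_interiorV h).1 hw
  exact ⟨⟨_, h3⟩, _, h4⟩

theorem mem_interiorV_of_split {u v w : G.V} {l₁ l₂ : List G.E} (h₁ : IsPath u l₁ w)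
    (h₂ : IsPath w l₂ v) (hu : w ≠ u) (hv : w ≠ v) : w ∈ interiorV (l₁ ++ l₂) := by
  refine (mem_interiorV (h₁.append h₂)).2 ⟨l₁, l₂, ?_, ?_, rfl, h₁, h₂⟩
  · rintro rfl; exact hu h₁.symm
  · rintro rfl; exact hv h₂

theorem src_mem_interiorV {u v : G.V} {l : List G.E} {e : G.E} (h : IsPath u l v) (he : e ∈ l)
    (hu : G.src e ≠ u) : G.src e ∈ interiorV l := by
  obtain ⟨l₁, l₂, rfl, h₁, h₂⟩ := h.split he
  exact mem_interiorV_of_split h₁ h₂.cons hu fun h =>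
    ((G.src_lt_tgt e).trans_le h₂.time_le).ne (congrArg G.time h)

theorem tgt_mem_interiorV {u v : G.V} {l : List G.E} {e : G.E} (h : IsPath u l v) (he : e ∈ l)
    (hv : G.tgt e ≠ v) : G.tgt e ∈ interiorV l := by
  obtain ⟨l₁, l₂, rfl, h₁, h₂⟩ := h.split he
  rw [List.append_cons]
  exact mem_interiorV_of_split (h₁.append (isPath_singleton e)) h₂ (fun h =>
    (h₁.time_le.trans_lt (G.src_lt_tgt e)).ne' (congrArg G.time h)) hv

theorem IsPath.eq_singleton {l : List G.E} {e : G.E} (h : IsPath (G.src e) l (G.tgt e))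
    (he : e ∈ l) : l = [e] := by
  obtain ⟨l₁, l₂, rfl, h₁, h₂⟩ := h.split he
  rw [h₁.eq_nil, h₂.eq_nil, List.nil_append]

theorem IsCell.time_lt {u v : G.V} {l₁ l₂ : List G.E} (h : IsCell u v l₁ l₂) :
    G.time u < G.time v := by
  by_cases h1 : l₁ = []
  · have h' := h.left
    subst h1
    obtain rfl : u = v := h'
    exact absurd h.right.eq_nil.symm h.ne
  · exact h.left.time_lt h1

theorem IsCell.ne_nil {u v : G.V} {l₁ l₂ : List G.E} (h : IsCell u v l₁ l₂) :
    l₁ ≠ [] ∧ l₂ ≠ [] := by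
  constructor
  · rintro rfl; exact h.time_lt.ne (congrArg G.time h.left)
  · rintro rfl; exact h.time_lt.ne (congrArg G.time h.right)

/-- An end of a shared edge other than `u` and `v` would be a common interior vertex. If there is
none, the edge runs from `u` to `v` and is all of both sides. -/
theorem IsCell.disjoint_edges {u v : G.V} {l₁ l₂ : List G.E} (h : IsCell u v l₁ l₂) {e : G.E}
    (h₁ : e ∈ l₁) (h₂ : e ∈ l₂) : False := by
  by_cases hu : G.src e = u
  · by_cases hv : G.tgt e = v
    · obtain rfl := hu
      obtain rfl := hv
      exact h.ne ((h.left.eq_singleton h₁).trans (h.right.eq_singleton h₂).symm)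
    · exact h.disjoint.le_bot
        ⟨tgt_mem_interiorV h.left h₁ hv, tgt_mem_interiorV h.right h₂ hv⟩
  · exact h.disjoint.le_bot ⟨src_mem_interiorV h.left h₁ hu, src_mem_interiorV h.right h₂ hu⟩

theorem InnerAdj.symm {u v a b : G.V} (h : InnerAdj u v a b) : InnerAdj u v b a :=
  ⟨h.2.2.1, h.2.2.2.1, h.1, h.2.1, h.2.2.2.2.imp fun _ he => ⟨he.1, he.2.symm⟩⟩

theorem reflTransGen_innerAdj_symm {u v a b : G.V}
    (h : Relation.ReflTransGen (InnerAdj u v) a b) :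
    Relation.ReflTransGen (InnerAdj u v) b a := by
  have : Std.Symm (InnerAdj u v) := ⟨fun _ _ => InnerAdj.symm⟩
  exact Std.Symm.symm _ _ h

theorem intervalV_of_reach {u v x w y : G.V} (hx : x ∈ intervalV u v) (hy : y ∈ intervalV u v)
    (h : Reach x w) (h' : Reach w y) : w ∈ intervalV u v :=
  ⟨hx.1.trans h, h'.trans hy.2⟩

theorem innerAdj_edge {u v : G.V} {e : G.E} (he : e ∈ intervalE u v) (hu : G.src e ≠ u)
    (hv : G.tgt e ≠ v) : InnerAdj u v (G.src e) (G.tgt e) := by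
  refine ⟨hu, fun h => ?_, fun h => ?_, hv, e, he, .inl ⟨rfl, rfl⟩⟩
  · exact ((G.src_lt_tgt e).trans_le he.2.2.time_le).ne (congrArg G.time h)
  · exact (he.1.1.time_le.trans_lt (G.src_lt_tgt e)).ne' (congrArg G.time h)

/-- Vertices of an interval which are joined by a time-path avoiding its ends are linked. -/
theorem reflTransGen_of_reach {u v x y : G.V} (hx : x ∈ intervalV u v) (hy : y ∈ intervalV u v)
    (hxu : x ≠ u) (hyv : y ≠ v) (h : Reach x y) :
    Relation.ReflTransGen (InnerAdj u v) x y := by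
  obtain ⟨l, h⟩ := h
  induction l generalizing x with
  | nil => cases h; exact .refl
  | cons e l ih =>
    obtain ⟨rfl, h⟩ := h
    have he : G.tgt e ∈ intervalV u v := intervalV_of_reach hx hy (reach_edge e) ⟨l, h⟩
    have hv : G.tgt e ≠ v := by
      rintro rfl
      exact hyv (hy.2.eq_of_time_le h.time_le)
    have hadj := innerAdj_edge ⟨hx, he⟩ hxu hv
    exact .head hadj (ih he hadj.2.2.1 h)

/-- A time-path between interior vertices stays strictly between the times of `u` and `v`, hence
avoids both. This makes (T3) applicable to truly simple cells. -/
theorem IsTrulySimpleCell.isSimpleCell {u v : G.V} {l₁ l₂ : List G.E}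
    (h : IsTrulySimpleCell u v l₁ l₂) : IsSimpleCell u v l₁ l₂ where
  toIsCell := h.toIsCell
  simple a ha b hb := by
    have h1 := reach_of_mem_interiorV h.left ha
    have h2 := reach_of_mem_interiorV h.right hb
    have t1 := time_of_mem_interiorV h.left ha
    have t2 := time_of_mem_interiorV h.right hb
    exact ⟨fun hr => h.trulySimple a ha b hb (reflTransGen_of_reach h1 h2
        (fun e => t1.1.ne' (congrArg G.time e)) (fun e => t2.2.ne (congrArg G.time e)) hr),
      fun hr => h.trulySimple a ha b hb (reflTransGen_innerAdj_symm (reflTransGen_of_reach h2 h1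
        (fun e => t2.1.ne' (congrArg G.time e)) (fun e => t1.2.ne (congrArg G.time e)) hr))⟩

theorem lower_upper_of_between (h0 : Reach G.start G.finish) {u v : G.V} {p : G.Point}
    (h : p ∈ between G.pathFamily (.vertex u) (.vertex v)) :
    p.lower ∈ intervalV u v ∧ p.upper ∈ intervalV u v := by
  have h1 := (pathLe_vertex_left h0).1 h.1
  have h2 := (pathLe_vertex_right h0).1 h.2
  exact ⟨⟨h1, p.reach_lower_upper.trans h2⟩, h1.trans p.reach_lower_upper, h2⟩

theorem upper_ne_left (h0 : Reach G.start G.finish) {u v : G.V} {p : G.Point}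
    (h : p ∈ between G.pathFamily (.vertex u) (.vertex v)) (hu : p ≠ .vertex u) :
    p.upper ≠ u := by
  have h1 := (pathLe_vertex_left h0).1 h.1
  cases p with
  | vertex w => exact fun e => hu (congrArg Point.vertex e)
  | inner e t ht => exact fun e' => ((h1.time_le.trans_lt (G.src_lt_tgt e)).ne'
      (congrArg G.time e'))

theorem lower_ne_right (h0 : Reach G.start G.finish) {u v : G.V} {p : G.Point}
    (h : p ∈ between G.pathFamily (.vertex u) (.vertex v)) (hv : p ≠ .vertex v) :
    p.lower ≠ v := by
  have h2 := (pathLe_vertex_right h0).1 h.2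
  cases p with
  | vertex w => exact fun e => hv (congrArg Point.vertex e)
  | inner e t ht => exact fun e' => (((G.src_lt_tgt e).trans_le h2.time_le).ne
      (congrArg G.time e'))

/-- The point is linked to the interior of `l` within the interval from `u` to `v`. -/
def LinkedTo (u v : G.V) (l : List G.E) : G.Point → Prop
  | .vertex w => ∃ a ∈ interiorV l, Relation.ReflTransGen (InnerAdj u v) a w
  | .inner e _ _ => e ∈ l ∨ (∃ a ∈ interiorV l, Relation.ReflTransGen (InnerAdj u v) a (G.src e)) ∨
      ∃ a ∈ interiorV l, Relation.ReflTransGen (InnerAdj u v) a (G.tgt e)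

section LinkedTo

variable {u v : G.V} {l : List G.E} (hl : IsPath u l v)
include hl

theorem ne_of_linked {a w : G.V} (ha : a ∈ interiorV l)
    (h : Relation.ReflTransGen (InnerAdj u v) a w) : w ≠ u ∧ w ≠ v := by
  rcases h.cases_tail with rfl | ⟨x, -, hx⟩
  · have := time_of_mem_interiorV hl ha
    exact ⟨fun e => this.1.ne' (congrArg G.time e), fun e => this.2.ne (congrArg G.time e)⟩
  · exact ⟨hx.2.2.1, hx.2.2.2.1⟩

theorem LinkedTo.upper {p : G.Point} (h : LinkedTo u v l p) (hp : p.lower ∈ intervalV u v)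
    (hp' : p.upper ∈ intervalV u v) (hv : p.upper ≠ v) : LinkedTo u v l (.vertex p.upper) := by
  cases p with
  | vertex w => exact h
  | inner e t ht =>
    rcases h with h | ⟨a, ha, h⟩ | h
    · exact ⟨_, tgt_mem_interiorV hl h hv, .refl⟩
    · exact ⟨a, ha, h.tail (innerAdj_edge ⟨hp, hp'⟩ (ne_of_linked hl ha h).1 hv)⟩
    · exact h

theorem LinkedTo.lower {p : G.Point} (h : LinkedTo u v l p) (hp : p.lower ∈ intervalV u v)
    (hp' : p.upper ∈ intervalV u v) (hu : p.lower ≠ u) : LinkedTo u v l (.vertex p.lower) := by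
  cases p with
  | vertex w => exact h
  | inner e t ht =>
    rcases h with h | h | ⟨a, ha, h⟩
    · exact ⟨_, src_mem_interiorV hl h hu, .refl⟩
    · exact h
    · exact ⟨a, ha, h.tail (innerAdj_edge ⟨hp, hp'⟩ hu (ne_of_linked hl ha h).2).symm⟩

omit hl in
theorem LinkedTo.of_lower {p : G.Point} (h : LinkedTo u v l (.vertex p.lower)) :
    LinkedTo u v l p := by
  cases p with
  | vertex w => exact h
  | inner e t ht => exact .inr (.inl h)

omit hl in
theorem LinkedTo.of_upper {p : G.Point} (h : LinkedTo u v l (.vertex p.upper)) :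
    LinkedTo u v l p := by
  cases p with
  | vertex w => exact h
  | inner e t ht => exact .inr (.inr h)

/-- Comparability of points becomes adjacency of vertices: unless the points share an edge, a
time-path leads from the upper vertex of the earlier point to the lower vertex of the later one, and
it avoids `u` and `v`. -/
theorem LinkedTo.step (h0 : Reach G.start G.finish) {r r' : G.Point} (h : LinkedTo u v l r)
    (hc : InnerComparable G.pathFamily (.vertex u) (.vertex v) r r') : LinkedTo u v l r' := by
  obtain ⟨⟨hr, hru, hrv⟩, ⟨hr', hru', hrv'⟩, hle⟩ := hc
  obtain ⟨hlo, hup⟩ := lower_upper_of_between h0 hr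
  obtain ⟨hlo', hup'⟩ := lower_upper_of_between h0 hr'
  rw [pathLe_iff h0, pathLe_iff h0] at hle
  rcases hle with (hle | ⟨e, s, t, hs, ht, -, rfl, rfl⟩) | (hle | ⟨e, s, t, hs, ht, -, rfl, rfl⟩)
  · have hyv := lower_ne_right h0 hr' hrv'
    have hxu := upper_ne_left h0 hr hru
    have hxv : r.upper ≠ v := fun e =>
      hyv (hlo'.2.eq_of_time_le (e ▸ hle.time_le))
    obtain ⟨a, ha, h'⟩ := h.upper hl hlo hup hxv
    exact LinkedTo.of_lower ⟨a, ha, h'.trans (reflTransGen_of_reach hup hlo' hxu hyv hle)⟩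
  · exact h
  · have hxv := lower_ne_right h0 hr hrv
    have hyu := upper_ne_left h0 hr' hru'
    have hxu : r.lower ≠ u := fun e =>
      hyu (hup'.1.eq_of_time_le (e ▸ hle.time_le)).symm
    obtain ⟨a, ha, h'⟩ := h.lower hl hlo hup hxu
    exact LinkedTo.of_upper ⟨a, ha,
      h'.trans (reflTransGen_innerAdj_symm (reflTransGen_of_reach hup' hlo hyu hxv hle))⟩
  · exact h

theorem pathPoint_cases {t : unitInterval} (h1 : G.time u < t) (h2 : t < G.time v) :
    (∃ w ∈ interiorV l, pathPoint u l t = .vertex w) ∨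
      ∃ e ∈ l, ∃ h, pathPoint u l t = .inner e t h := by
  have ht := time_pathPoint hl h1.le h2.le
  cases hp : pathPoint u l t with
  | vertex w =>
    left
    rw [hp] at ht
    obtain rfl : G.time w = t := ht
    obtain ⟨l₁, l₂, rfl, h₁, h₂⟩ := exists_split_of_pathPoint hl hp
    exact ⟨w, mem_interiorV_of_split h₁ h₂ (fun e => h1.ne' (congrArg G.time e))
      (fun e => h2.ne (congrArg G.time e)), rfl⟩
  | inner e s h =>
    right
    rw [hp] at ht
    obtain rfl : s = t := ht
    exact ⟨e, mem_of_pathPoint hp, h, rfl⟩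

end LinkedTo

theorem FullPath.point_of_split {σ : G.FullPath} {u v : G.V} {m l n : List G.E}
    (h : σ.1 = m ++ (l ++ n)) (hm : IsPath G.start m u) (hl : IsPath u l v)
    (hn : IsPath v n G.finish) {t : unitInterval} (h1 : G.time u ≤ t) (h2 : t ≤ G.time v) :
    σ.point t = pathPoint u l t := by
  rw [FullPath.point, h, pathPoint_append_of_ge hm (hl.append hn) h1,
    pathPoint_append_of_le hl hn h2]

/-- Full time-paths through the two sides of a truly simple cell. -/
theorem IsTrulySimpleCell.isTrulySimplePair {u v : G.V} {l₁ l₂ m n : List G.E}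
    (h : IsTrulySimpleCell u v l₁ l₂) {σ₁ σ₂ : G.FullPath} (h₁ : σ₁.1 = m ++ (l₁ ++ n))
    (h₂ : σ₂.1 = m ++ (l₂ ++ n)) (hm : IsPath G.start m u) (hn : IsPath v n G.finish) :
    IsTrulySimplePair G.pathFamily (G.time u) (G.time v) σ₁.point σ₂.point := by
  have h0 : Reach G.start G.finish := ⟨_, σ₁.2⟩
  have hlt := h.time_lt
  have e1 : ∀ t, G.time u ≤ t → t ≤ G.time v → σ₁.point t = pathPoint u l₁ t :=
    fun t => FullPath.point_of_split h₁ hm h.left hn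
  have e2 : ∀ t, G.time u ≤ t → t ≤ G.time v → σ₂.point t = pathPoint u l₂ t :=
    fun t => FullPath.point_of_split h₂ hm h.right hn
  have e1u : σ₁.point (G.time u) = .vertex u := by
    rw [e1 _ le_rfl hlt.le, pathPoint_of_le h.left le_rfl]
  have e1v : σ₁.point (G.time v) = .vertex v := by
    rw [e1 _ hlt.le le_rfl, pathPoint_of_ge h.left le_rfl]
  refine ⟨σ₁.mem_pathFamily, σ₂.mem_pathFamily, hlt, ?_, ?_, ?_⟩
  · rw [e1u, e2 _ le_rfl hlt.le, pathPoint_of_le h.right le_rfl]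
  · rw [e1v, e2 _ hlt.le le_rfl, pathPoint_of_ge h.right le_rfl]
  · intro s t hs hs' ht ht' hl
    rw [e1u, e1v] at hl
    have hstart : LinkedTo u v l₁ (σ₁.point s) := by
      rw [e1 s hs.le hs'.le]
      rcases pathPoint_cases h.left hs hs' with ⟨w, hw, e⟩ | ⟨e, he, _, e'⟩
      · rw [e]; exact ⟨w, hw, .refl⟩
      · rw [e']; exact .inl he
    -- Being linked to the first side propagates along the chain. On the second side it yields a
    -- shared edge or linked interior vertices of the two sides, both impossible.
    have hend : LinkedTo u v l₁ (σ₂.point t) := by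
      generalize σ₂.point t = q at hl
      induction hl with
      | refl => exact hstart
      | tail _ hc ih => exact ih.step h.left h0 hc
    rw [e2 t ht.le ht'.le] at hend
    rcases pathPoint_cases h.right ht ht' with ⟨w, hw, e⟩ | ⟨e, he, _, e'⟩
    · rw [e] at hend
      obtain ⟨a, ha, ha'⟩ := hend
      exact h.trulySimple a ha w hw ha'
    · rw [e'] at hend
      rcases hend with he' | ⟨a, ha, ha'⟩ | ⟨a, ha, ha'⟩
      · exact h.disjoint_edges he' he
      · exact h.trulySimple a ha _ (src_mem_interiorV h.right he (ne_of_linked h.left ha ha').1) ha'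
      · exact h.trulySimple a ha _ (tgt_mem_interiorV h.right he (ne_of_linked h.left ha ha').2) ha'

theorem FullPath.exists_split {σ : G.FullPath} {u v : G.V} {a b : unitInterval} (hab : a ≤ b)
    (ha : σ.point a = .vertex u) (hb : σ.point b = .vertex v) :
    G.time u = a ∧ G.time v = b ∧ ∃ m l n, σ.1 = m ++ (l ++ n) ∧ IsPath G.start m u ∧
      IsPath u l v ∧ IsPath v n G.finish := by
  have hu : G.time u = a := by rw [← σ.time_point a, ha]; rfl
  have hv : G.time v = b := by rw [← σ.time_point b, hb]; rfl
  obtain ⟨m, k, h1, hm, hk⟩ := exists_split_of_pathPoint σ.2 ha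
  rw [FullPath.point, h1, pathPoint_append_of_ge hm hk (hu.trans_le hab)] at hb
  obtain ⟨l, n, rfl, hl, hn⟩ := exists_split_of_pathPoint hk hb
  exact ⟨hu, hv, m, l, n, h1, hm, hl, hn⟩

/-- The ends of simple pairs are vertices. -/
theorem exists_vertex_of_isSimplePair {σ₁ σ₂ : G.FullPath} {a b : unitInterval}
    (h : IsSimplePair G.pathFamily a b σ₁.point σ₂.point) :
    (∃ u, σ₁.point a = .vertex u) ∧ ∃ v, σ₁.point b = .vertex v := by
  have hne : ∀ t, a < t → t < b → σ₁.point t ≠ σ₂.point t := fun t h1 h2 e =>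
    (h.not_le t t h1 h2 h1 h2).1 (e ▸ pathLe_of_le σ₁.mem_pathFamily le_rfl)
  have key : ∀ {e : G.E} {s t h'}, σ₁.point s = .inner e t h' → s ∈ outer a b →
      e ∈ σ₁.1 ∧ e ∈ σ₂.1 := fun h1 h2 =>
    ⟨mem_of_pathPoint h1, mem_of_pathPoint ((h.eq _ h2).symm.trans h1)⟩
  constructor
  · cases hp : σ₁.point a with
    | vertex u => exact ⟨u, rfl⟩
    | inner e t ht =>
      obtain rfl : t = a := by rw [← σ₁.time_point a, hp]; rfl
      -- If the paths were inside an edge at time `a`, both would still be on it shortly afterwards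
      -- and coincide strictly between `a` and `b`.
      obtain ⟨s, h1, h2⟩ := exists_between (lt_min h.lt ht.2)
      obtain ⟨k1, k2⟩ := key hp (left_mem_outer _ _)
      have hs : G.time (G.src e) < s ∧ s < G.time (G.tgt e) :=
        ⟨ht.1.trans h1, h2.trans_le (min_le_right _ _)⟩
      exact absurd ((FullPath.point_inner k1 hs).trans (FullPath.point_inner k2 hs).symm)
        (hne s h1 (h2.trans_le (min_le_left _ _)))
  · cases hp : σ₁.point b with
    | vertex u => exact ⟨u, rfl⟩
    | inner e t ht =>
      obtain rfl : t = b := by rw [← σ₁.time_point b, hp]; rfl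
      obtain ⟨s, h1, h2⟩ := exists_between (max_lt h.lt ht.1)
      obtain ⟨k1, k2⟩ := key hp (right_mem_outer _ _)
      have hs : G.time (G.src e) < s ∧ s < G.time (G.tgt e) :=
        ⟨(le_max_right _ _).trans_lt h1, h2.trans ht.2⟩
      exact absurd ((FullPath.point_inner k1 hs).trans (FullPath.point_inner k2 hs).symm)
        (hne s ((le_max_left _ _).trans_lt h1) h2)

/-- Simple pairs of full time-paths come from simple cells. -/
theorem exists_isSimpleCell {σ₁ σ₂ : G.FullPath} {a b : unitInterval}
    (h : IsSimplePair G.pathFamily a b σ₁.point σ₂.point) :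
    ∃ u v l₁ l₂, IsSimpleCell u v l₁ l₂ ∧ G.time u = a ∧ G.time v = b ∧ l₁ <:+: σ₁.1 := by
  have h0 : Reach G.start G.finish := ⟨_, σ₁.2⟩
  obtain ⟨⟨u, hu⟩, v, hv⟩ := exists_vertex_of_isSimplePair h
  have hu' := (h.eq a (left_mem_outer a b)).symm.trans hu
  have hv' := (h.eq b (right_mem_outer a b)).symm.trans hv
  obtain ⟨rfl, rfl, m₁, l₁, n₁, h₁, hm₁, hl₁, hn₁⟩ := FullPath.exists_split h.lt.le hu hv
  obtain ⟨-, -, m₂, l₂, n₂, h₂, hm₂, hl₂, hn₂⟩ := FullPath.exists_split h.lt.le hu' hv'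
  have hsimple : ∀ x ∈ interiorV l₁, ∀ y ∈ interiorV l₂, ¬ Reach x y ∧ ¬ Reach y x := by
    intro x hx y hy
    have tx := time_of_mem_interiorV hl₁ hx
    have ty := time_of_mem_interiorV hl₂ hy
    have := h.not_le _ _ tx.1 tx.2 ty.1 ty.2
    obtain ⟨p₁, p₂, -, -, rfl, hp₁, hp₂⟩ := (mem_interiorV hl₁).1 hx
    obtain ⟨q₁, q₂, -, -, rfl, hq₁, hq₂⟩ := (mem_interiorV hl₂).1 hy
    rw [FullPath.point_of_split h₁ hm₁ hl₁ hn₁ tx.1.le tx.2.le,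
      FullPath.point_of_split h₂ hm₂ hl₂ hn₂ ty.1.le ty.2.le, pathPoint_append_self hp₁ hp₂,
      pathPoint_append_self hq₁ hq₂, pathLe_vertex_left h0, pathLe_vertex_left h0] at this
    exact this
  refine ⟨u, v, l₁, l₂, ⟨⟨hl₁, hl₂, ?_, ?_⟩, hsimple⟩, rfl, rfl, m₁, n₁, ?_⟩
  · rintro rfl
    obtain ⟨t, h1, h2⟩ := exists_between h.lt
    refine (h.not_le t t h1 h2 h1 h2).1 ?_
    rw [FullPath.point_of_split h₂ hm₂ hl₂ hn₂ h1.le h2.le,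
      ← FullPath.point_of_split h₁ hm₁ hl₁ hn₁ h1.le h2.le]
    exact pathLe_of_le σ₁.mem_pathFamily le_rfl
  · exact Set.disjoint_left.2 fun x h1 h2 => (hsimple x h1 x h2).1 (Reach.refl x)
  · rw [h₁, List.append_assoc]

end TLG

/-! ### The full time-paths along a tower -/

namespace TLG

theorem pathPoint_singleton {G : TLG} (u : G.V) (e : G.E) (t : unitInterval) :
    pathPoint u [e] t = G.pt e t := by
  rw [pathPoint]
  split_ifs with h
  · rfl
  · rw [pt_of_ge (not_le.1 h).le, pathPoint]

theorem mem_pathSupport_pathFamily {G : TLG} (h0 : Reach G.start G.finish) (p : G.Point) :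
    p ∈ pathSupport G.pathFamily := by
  refine PathLe.left_mem (q := p) ((pathLe_iff h0).2 ?_)
  cases p with
  | vertex v => exact .inl (Reach.refl v)
  | inner e t h => exact .inr ⟨e, t, t, h, h, le_rfl, rfl, rfl⟩

/-- Every edge ends at the finish, so a full time-path cannot continue after its first edge. -/
theorem IsMinimal.pathFamily_eq {G : TLG} (h : IsMinimal G) :
    ∃ σ : G.FullPath, G.pathFamily = {σ.point} := by
  obtain ⟨e, ⟨h1, h2⟩, huniq⟩ := h.edge
  have hpath : IsPath G.start [e] G.finish := ⟨h1, h2⟩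
  refine ⟨⟨[e], hpath⟩, ?_⟩
  have key : ∀ σ : G.FullPath, σ = ⟨[e], hpath⟩ := by
    rintro ⟨l, hl⟩
    refine Subtype.ext ?_
    cases l with
    | nil => exact absurd hl fun e' => (hpath.time_lt (List.cons_ne_nil _ _)).ne (congrArg G.time e')
    | cons e' l =>
      have h3 := hl.2
      rw [(h.edges e').2] at h3
      change e' :: l = [e]
      rw [h3.eq_nil, huniq e' (h.edges e')]
  ext ρ
  constructor
  · rintro ⟨σ, rfl⟩
    rw [key σ]
    rfl
  · rintro rfl
    exact FullPath.mem_pathFamily _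

/-! ### Adding a vertex: the family of full time-paths is unchanged. -/

namespace VertexStep

variable {G G' : TLG} (s : VertexStep G G')

theorem src_lower_def : G'.src s.lower = s.onV (some (G.src s.e₀)) := s.src_lower
theorem tgt_lower_def : G'.tgt s.lower = s.onV none := s.tgt_lower
theorem src_upper_def : G'.src s.upper = s.onV none := s.src_upper
theorem tgt_upper_def : G'.tgt s.upper = s.onV (some (G.tgt s.e₀)) := s.tgt_upper

theorem onEdge_self : s.onEdge s.e₀ = [s.lower, s.upper] := dif_pos rfl

theorem onEdge_of_ne {e : G.E} (h : e ≠ s.e₀) : s.onEdge e = [s.onE (.inl ⟨e, h⟩)] := dif_neg h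

theorem pathPoint_onEdge (e : G.E) (t : unitInterval) :
    pathPoint (s.onV (some (G.src e))) (s.onEdge e) t = s.onPoint (G.pt e t) := by
  by_cases he : e = s.e₀
  · subst he
    rw [onEdge_self, pathPoint, pathPoint_singleton, s.tgt_lower_def, s.time_new]
    rcases pt_cases s.e₀ t with ⟨h, h'⟩ | ⟨h, h'⟩ | ⟨h, h'⟩
    · rw [h', if_pos (h.trans s.lt_τ.le), pt_of_le, s.src_lower_def]
      · rfl
      · rwa [s.src_lower_def, s.time_old]
    · rw [h', if_neg (s.τ_lt.trans_le h).not_ge, pt_of_ge, s.tgt_upper_def]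
      · rfl
      · rwa [s.tgt_upper_def, s.time_old]
    · rw [h', onPoint, dif_pos rfl]
  · rw [s.onEdge_of_ne he, pathPoint_singleton]
    rcases pt_cases e t with ⟨h, h'⟩ | ⟨h, h'⟩ | ⟨h, h'⟩
    · rw [h', pt_of_le, s.src_old]
      · rfl
      · rwa [s.src_old, s.time_old]
    · rw [h', pt_of_ge, s.tgt_old]
      · rfl
      · rwa [s.tgt_old, s.time_old]
    · rw [h', onPoint, dif_neg he]

theorem isPath_onEdge (e : G.E) :
    IsPath (s.onV (some (G.src e))) (s.onEdge e) (s.onV (some (G.tgt e))) := by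
  have := s.isPath_flatMap (isPath_singleton e)
  rwa [List.flatMap_singleton] at this

theorem pathPoint_flatMap {u v : G.V} {l : List G.E} (h : IsPath u l v) (t : unitInterval) :
    pathPoint (s.onV (some u)) (l.flatMap s.onEdge) t = s.onPoint (pathPoint u l t) := by
  induction l generalizing u with
  | nil => rfl
  | cons e l ih =>
    obtain ⟨rfl, h⟩ := h
    rw [List.flatMap_cons, pathPoint]
    split_ifs with ht
    · rw [pathPoint_append_of_le (s.isPath_onEdge e) (s.isPath_flatMap h)
        (by rwa [s.time_old]), s.pathPoint_onEdge]
    · rw [pathPoint_append_of_ge (s.isPath_onEdge e) (s.isPath_flatMap h)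
        (by rw [s.time_old]; exact (not_le.1 ht).le), ih h]

theorem point_onFullPath (σ : G.FullPath) :
    (s.onFullPath σ).point = fun t => s.onPoint (σ.point t) := by
  funext t
  have := s.pathPoint_flatMap σ.2 t
  rwa [← s.start_eq] at this

/-- The point of `G` which is represented by a point of `G'`. -/
noncomputable def ofPoint : G'.Point → G.Point
  | .vertex v => match s.onV.symm v with
    | some w => .vertex w
    | none => G.pt s.e₀ s.τ
  | .inner e t _ => match s.onE.symm e with
    | .inl e' => G.pt e'.1 t
    | .inr _ => G.pt s.e₀ t

theorem ofPoint_vertex_some (v : G.V) : s.ofPoint (.vertex (s.onV (some v))) = .vertex v := by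
  rw [ofPoint, Equiv.symm_apply_apply]

theorem ofPoint_vertex_none : s.ofPoint (.vertex (s.onV none)) = G.pt s.e₀ s.τ := by
  rw [ofPoint, Equiv.symm_apply_apply]

theorem ofPoint_onPoint (p : G.Point) : s.ofPoint (s.onPoint p) = p := by
  cases p with
  | vertex v => exact s.ofPoint_vertex_some v
  | inner e t h =>
    by_cases he : e = s.e₀
    · subst he
      rw [onPoint, dif_pos rfl]
      split_ifs with ht
      · rcases ht.eq_or_lt with rfl | ht
        · rw [pt_of_ge (by rw [s.tgt_lower_def, s.time_new]), s.tgt_lower_def,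
            ofPoint_vertex_none, pt_inner h]
        · rw [pt_inner ⟨by rw [s.src_lower_def, s.time_old]; exact h.1,
            by rwa [s.tgt_lower_def, s.time_new]⟩, ofPoint, lower, Equiv.symm_apply_apply]
          exact pt_inner h
      · rw [pt_inner ⟨by rw [s.src_upper_def, s.time_new]; exact not_le.1 ht,
          by rw [s.tgt_upper_def, s.time_old]; exact h.2⟩, ofPoint, upper, Equiv.symm_apply_apply]
        exact pt_inner h
    · rw [onPoint, dif_neg he, pt_inner ⟨by rw [s.src_old, s.time_old]; exact h.1,
          by rw [s.tgt_old, s.time_old]; exact h.2⟩, ofPoint, Equiv.symm_apply_apply]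
      exact pt_inner h

theorem onPoint_injective : Function.Injective s.onPoint :=
  Function.LeftInverse.injective s.ofPoint_onPoint

/-- The induction is on a bound for the length, because the two halves of the divided edge are
consumed together: the lower half leads to the new vertex, which only the upper half leaves. -/
theorem exists_flatMap_eq (n : ℕ) : ∀ {u v : G.V} {l' : List G'.E}, l'.length ≤ n →
    IsPath (s.onV (some u)) l' (s.onV (some v)) →
    ∃ l, IsPath u l v ∧ l' = l.flatMap s.onEdge := by
  have hsome : ∀ {x y : G.V}, s.onV (some x) = s.onV (some y) → x = y := fun h =>
    Option.some.inj (s.onV.injective h)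
  have hnone : ∀ {x : G.V}, s.onV (some x) ≠ s.onV none := fun h =>
    Option.some_ne_none _ (s.onV.injective h)
  induction n with
  | zero =>
    intro u v l' hn h
    obtain rfl := List.eq_nil_of_length_eq_zero (Nat.le_zero.1 hn)
    exact ⟨[], hsome h, rfl⟩
  | succ n ih =>
    intro u v l' hn h
    cases l' with
    | nil => exact ⟨[], hsome h, rfl⟩
    | cons e' m =>
      obtain ⟨x, rfl⟩ := s.onE.surjective e'
      obtain ⟨h1, h2⟩ := h
      have hn' := Nat.le_of_succ_le_succ hn
      rcases x with ⟨e, he⟩ | (_ | _)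
      · rw [s.src_old] at h1
        rw [s.tgt_old] at h2
        obtain ⟨l, h3, rfl⟩ := ih hn' h2
        refine ⟨e :: l, ⟨hsome h1, h3⟩, ?_⟩
        rw [List.flatMap_cons, s.onEdge_of_ne he]
        rfl
      · rw [s.src_lower] at h1
        rw [s.tgt_lower] at h2
        cases m with
        | nil => exact absurd h2.symm hnone
        | cons e'' m =>
          obtain ⟨y, rfl⟩ := s.onE.surjective e''
          obtain ⟨h3, h4⟩ := h2
          rcases y with ⟨e, he⟩ | (_ | _)
          · rw [s.src_old] at h3; exact absurd h3 hnone
          · rw [s.src_lower] at h3; exact absurd h3 hnone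
          · rw [s.tgt_upper] at h4
            obtain ⟨l, h5, rfl⟩ := ih ((Nat.le_succ _).trans hn') h4
            refine ⟨s.e₀ :: l, ⟨hsome h1, h5⟩, ?_⟩
            rw [List.flatMap_cons, s.onEdge_self]
            rfl
      · rw [s.src_upper] at h1
        exact absurd h1.symm hnone

theorem pathFamily_eq :
    G'.pathFamily = (fun (σ : unitInterval → G.Point) t => s.onPoint (σ t)) '' G.pathFamily := by
  ext ρ
  constructor
  · rintro ⟨⟨l', hl'⟩, rfl⟩
    have h := hl'
    rw [s.start_eq, s.finish_eq] at h
    obtain ⟨l, hl, rfl⟩ := s.exists_flatMap_eq _ le_rfl h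
    exact ⟨_, FullPath.mem_pathFamily ⟨l, hl⟩, (s.point_onFullPath ⟨l, hl⟩).symm⟩
  · rintro ⟨_, ⟨σ, rfl⟩, rfl⟩
    exact ⟨s.onFullPath σ, s.point_onFullPath σ⟩

end VertexStep

/-! ### Adding an edge: the new full time-paths are splices of old ones. -/

namespace EdgeStep

variable {G G' : TLG} (s : EdgeStep G G')

theorem src_newEdge : G'.src s.newEdge = s.onV s.j := s.src_new
theorem tgt_newEdge : G'.tgt s.newEdge = s.onV s.k := s.tgt_new

theorem onPoint_pt (e : G.E) (t : unitInterval) :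
    s.onPoint (G.pt e t) = G'.pt (s.onE (some e)) t := by
  rcases pt_cases e t with ⟨h, h'⟩ | ⟨h, h'⟩ | ⟨h, h'⟩
  · rw [h', pt_of_le, s.src_old]
    · rfl
    · rwa [s.src_old, s.time_eq]
  · rw [h', pt_of_ge, s.tgt_old]
    · rfl
    · rwa [s.tgt_old, s.time_eq]
  · rw [h']; rfl

theorem pathPoint_map (u : G.V) (l : List G.E) (t : unitInterval) :
    pathPoint (s.onV u) (l.map fun e => s.onE (some e)) t = s.onPoint (pathPoint u l t) := by
  induction l generalizing u with
  | nil => rfl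
  | cons e l ih =>
    rw [List.map_cons, pathPoint, pathPoint, s.tgt_old, s.time_eq, ih, apply_ite s.onPoint,
      onPoint_pt]

theorem point_onFullPath (σ : G.FullPath) :
    (s.onFullPath σ).point = fun t => s.onPoint (σ.point t) := by
  funext t
  have := s.pathPoint_map G.start σ.1 t
  rwa [← s.start_eq] at this

theorem onPoint_inner {e : G.E} {t : unitInterval} (h : G.time (G.src e) < t ∧
    t < G.time (G.tgt e)) : ∃ h', s.onPoint (.inner e t h) = .inner (s.onE (some e)) t h' :=
  ⟨⟨by rw [s.src_old, s.time_eq]; exact h.1, by rw [s.tgt_old, s.time_eq]; exact h.2⟩,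
    pt_inner _⟩

theorem onPoint_injective : Function.Injective s.onPoint := by
  intro p q h
  cases p with
  | vertex v =>
    cases q with
    | vertex w => exact congrArg _ (s.onV.injective (Point.vertex.inj h))
    | inner e t h1 =>
      obtain ⟨h', e1⟩ := s.onPoint_inner h1
      rw [e1] at h; cases h
  | inner e t h1 =>
    obtain ⟨h', e1⟩ := s.onPoint_inner h1
    rw [e1] at h
    cases q with
    | vertex w => cases h
    | inner e' t' h2 =>
      obtain ⟨h'', e2⟩ := s.onPoint_inner h2
      rw [e2] at h
      obtain ⟨h3, rfl⟩ := Point.inner.inj h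
      obtain rfl := Option.some.inj (s.onE.injective h3)
      rfl

theorem onPoint_ne_new (p : G.Point) {t : unitInterval} (h1 : G.time s.j < t)
    (h2 : t < G.time s.k) : s.onPoint p ≠ G'.pt s.newEdge t := by
  rw [pt_inner ⟨by rwa [s.src_newEdge, s.time_eq], by rwa [s.tgt_newEdge, s.time_eq]⟩]
  cases p with
  | vertex v => exact fun h => nomatch h
  | inner e t' h =>
    obtain ⟨h', e1⟩ := s.onPoint_inner h
    rw [e1]
    intro h3
    exact Option.some_ne_none e (s.onE.injective (Point.inner.inj h3).1)

theorem exists_map_eq {u v : G.V} {l' : List G'.E} (h : IsPath (s.onV u) l' (s.onV v))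
    (hn : s.newEdge ∉ l') : ∃ l, IsPath u l v ∧ l' = l.map fun e => s.onE (some e) := by
  induction l' generalizing u with
  | nil => exact ⟨[], s.onV.injective h, rfl⟩
  | cons e' m ih =>
    obtain ⟨x, rfl⟩ := s.onE.surjective e'
    cases x with
    | none => exact absurd List.mem_cons_self hn
    | some e =>
      obtain ⟨h1, h2⟩ := h
      rw [s.src_old] at h1
      rw [s.tgt_old] at h2
      obtain ⟨l, h3, rfl⟩ := ih h2 fun h => hn (List.mem_cons_of_mem _ h)
      exact ⟨e :: l, ⟨s.onV.injective h1, h3⟩, rfl⟩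

theorem point_splice {σ : G.FullPath} {σ' : G'.FullPath} {l₁ m l₂ : List G.E}
    (h : σ.1 = l₁ ++ (m ++ l₂)) (h₁ : IsPath G.start l₁ s.j) (hm : IsPath s.j m s.k)
    (h₂ : IsPath s.k l₂ G.finish)
    (h' : σ'.1 = l₁.map (fun e => s.onE (some e)) ++
      s.newEdge :: l₂.map fun e => s.onE (some e)) :
    σ'.point = splice (G.time s.j) (G.time s.k) (fun t => s.onPoint (σ.point t))
      fun t => G'.pt s.newEdge t := by
  have p₁ := s.isPath_map h₁
  have p₂ := s.isPath_map h₂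
  have pe : IsPath (s.onV s.j) [s.newEdge] (s.onV s.k) := ⟨s.src_newEdge, s.tgt_newEdge⟩
  have pe' : IsPath (s.onV s.j) (s.newEdge :: l₂.map fun e => s.onE (some e))
      (s.onV G.finish) := pe.append p₂
  have hs := s.start_eq
  funext t
  rw [FullPath.point, h', hs]
  rcases mem_or_mem_outer (G.time s.j) (G.time s.k) t with ht | ht
  · rw [splice_inner ht]
    refine pathPoint_of_mem (v := s.onV G.finish) (p₁.append pe') (by simp) ?_ ?_
    · rw [s.src_newEdge, s.time_eq]; exact ht.1.le
    · rw [s.tgt_newEdge, s.time_eq]; exact ht.2.le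
  · rw [splice_outer ht]
    rcases ht with ht | ht
    · have ht' : t ≤ G.time s.j := ht
      rw [pathPoint_append_of_le p₁ pe' (by rwa [s.time_eq]), s.pathPoint_map,
        FullPath.point, h, pathPoint_append_of_le h₁ (hm.append h₂) ht']
    · have ht' : G.time s.k ≤ t := ht
      rw [List.append_cons, pathPoint_append_of_ge (p₁.append pe) p₂ (by rwa [s.time_eq]),
        s.pathPoint_map, FullPath.point, h, ← List.append_assoc,
        pathPoint_append_of_ge (h₁.append hm) h₂ ht']

/-- A full time-path through the new edge is obtained from an old one. -/
theorem exists_splice {σ' : G'.FullPath} (h : s.newEdge ∈ σ'.1) :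
    ∃ σ : G.FullPath, σ.point (G.time s.j) = .vertex s.j ∧ σ.point (G.time s.k) = .vertex s.k ∧
      σ'.point = splice (G.time s.j) (G.time s.k) (fun t => s.onPoint (σ.point t))
        fun t => G'.pt s.newEdge t := by
  obtain ⟨l₁', l₂', h', h₁', h₂'⟩ := σ'.2.split h
  rw [s.src_newEdge, s.start_eq] at h₁'
  rw [s.tgt_newEdge, s.finish_eq] at h₂'
  have hlt : G'.time (s.onV s.j) < G'.time (s.onV s.k) := by
    rw [s.time_eq, s.time_eq]; exact s.time_lt
  -- Times increase strictly along a path, so the new edge occurs only once and both remaining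
  -- pieces are old.
  obtain ⟨l₁, h₁, rfl⟩ := s.exists_map_eq h₁' fun hm => by
    obtain ⟨_, _, -, -, h3⟩ := h₁'.split hm
    have := h3.time_le
    rw [s.tgt_newEdge] at this
    exact this.not_gt hlt
  obtain ⟨l₂, h₂, rfl⟩ := s.exists_map_eq h₂' fun hm => by
    obtain ⟨_, _, -, h3, -⟩ := h₂'.split hm
    have := h3.time_le
    rw [s.src_newEdge] at this
    exact this.not_gt hlt
  -- The old time-path from `j` to `k` required for adding the edge supplies the bypassed segment.
  obtain ⟨m, hm⟩ := s.connected
  refine ⟨⟨_, h₁.append (hm.append h₂)⟩, FullPath.point_vertex rfl h₁ (hm.append h₂),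
    FullPath.point_vertex (List.append_assoc _ _ _).symm (h₁.append hm) h₂,
    s.point_splice rfl h₁ hm h₂ h'⟩

theorem pathFamily_eq :
    G'.pathFamily = addConnection
      ((fun (σ : unitInterval → G.Point) t => s.onPoint (σ t)) '' G.pathFamily)
      (G.time s.j) (G.time s.k) (.vertex (s.onV s.j)) (.vertex (s.onV s.k))
      fun t => G'.pt s.newEdge t := by
  ext ρ
  constructor
  · rintro ⟨σ', rfl⟩
    by_cases h : s.newEdge ∈ σ'.1
    · obtain ⟨σ, h1, h2, h3⟩ := s.exists_splice h
      exact .inr ⟨_, ⟨_, σ.mem_pathFamily, rfl⟩, congrArg s.onPoint h1, congrArg s.onPoint h2, h3⟩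
    · obtain ⟨l', hl'⟩ := σ'
      have hl := hl'
      rw [s.start_eq, s.finish_eq] at hl
      obtain ⟨l, h1, rfl⟩ := s.exists_map_eq hl h
      exact .inl ⟨_, FullPath.mem_pathFamily ⟨l, h1⟩, (s.point_onFullPath ⟨l, h1⟩).symm⟩
  · rintro (⟨_, ⟨σ, rfl⟩, rfl⟩ | ⟨_, ⟨_, ⟨σ, rfl⟩, rfl⟩, h1, h2, rfl⟩)
    · exact ⟨s.onFullPath σ, s.point_onFullPath σ⟩
    · obtain ⟨-, -, l₁, m, l₂, h, h₁, hm, h₂⟩ := FullPath.exists_split s.time_lt.le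
        (s.onPoint_injective (a₂ := .vertex s.j) h1) (s.onPoint_injective (a₂ := .vertex s.k) h2)
      have p₁ := s.isPath_map h₁
      have p₂ := s.isPath_map h₂
      have pe : IsPath (s.onV s.j) [s.newEdge] (s.onV s.k) := ⟨s.src_newEdge, s.tgt_newEdge⟩
      have p := p₁.append (pe.append p₂)
      rw [← s.start_eq, ← s.finish_eq] at p
      exact ⟨⟨_, p⟩, s.point_splice h h₁ hm h₂ rfl⟩

end EdgeStep

/-! ### The construction along a tower -/

/-- The forgetful map from paths to functions of time. -/
def pathFun (f : RCLLPath) : unitInterval → ℝ := fun t => coord t f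

theorem measurable_coord (t : unitInterval) : Measurable (coord t) :=
  (measurable_pi_apply t).comp measurable_subtype_coe

theorem measurable_pathFun : Measurable pathFun := measurable_pi_iff.2 measurable_coord

theorem IsBridgeKernel.isBridge {ν : Measure RCLLPath} {a b : unitInterval}
    {κ : Kernel (ℝ × ℝ) (Icc a b → ℝ)} (h : IsBridgeKernel ν a b κ) :
    IsBridge (ν.map pathFun) a b κ := by
  have m1 : Measurable fun x : unitInterval → ℝ => (x a, x b) :=
    (measurable_pi_apply _).prodMk (measurable_pi_apply _)
  have m2 : Measurable fun (x : unitInterval → ℝ) (t : Icc a b) => x t :=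
    measurable_pi_iff.2 fun t => measurable_pi_apply _
  rw [IsBridge, Measure.map_map (m1.prodMk m2) measurable_pathFun,
    Measure.map_map m1 measurable_pathFun]
  exact h.2

/-- `μ`, `X` and `ν` vary in the induction because each step pulls them back to the smaller graph.
-/
theorem constructed_of_isConstructed {Ω : Type*} [MeasurableSpace Ω] {P : Measure Ω}
    [IsProbabilityMeasure P] {G : TLG} (T : Tower G) :
    ∀ {μ : G.FullPath → Measure RCLLPath} {X : G.Point → Ω → ℝ}, (∀ p, Measurable (X p)) →
      IsConstructed P T μ X → ∀ {ν : (unitInterval → G.Point) → Measure (unitInterval → ℝ)},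
      (∀ σ : G.FullPath, ν σ.point = (μ σ).map pathFun) → Constructed P X ν G.pathFamily := by
  induction T with
  | minimal h =>
    intro μ X hX hc ν hν
    obtain ⟨σ, hσ⟩ := h.pathFamily_eq
    rw [hσ]
    exact .single _ ((hc σ).trans (hν σ).symm)
  | addVertex T s ih =>
    intro μ X hX hc ν hν
    rw [s.pathFamily_eq]
    refine Constructed.map s.onPoint_injective (ih (fun p => hX _) hc fun σ => ?_)
    rw [← s.point_onFullPath]
    exact hν _
  | addEdge T s ih =>
    rename_i G G'
    intro μ X hX hc ν hν
    obtain ⟨hc, σ', hσ', κ, hκ, hlaw⟩ := hc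
    have hF := Constructed.map s.onPoint_injective (ih (ν := fun σ => ν fun t => s.onPoint (σ t))
      (fun p => hX _) hc fun σ => by rw [← s.point_onFullPath]; exact hν _)
    obtain ⟨σ, hj, hk, h⟩ := s.exists_splice hσ'
    have h0 : Reach G.start G.finish := ⟨_, σ.2⟩
    have := hκ.1
    -- Every point lies on a full time-path, so conditioning on the support of the old family is
    -- conditioning on all of the previous graph.
    have hsupp : pathSupport ((fun (σ : unitInterval → G.Point) t => s.onPoint (σ t)) ''
        G.pathFamily) = range s.onPoint := by
      ext p
      constructor
      · rintro ⟨_, ⟨ρ, hρ, rfl⟩, t, rfl⟩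
        exact ⟨_, rfl⟩
      · rintro ⟨p, rfl⟩
        obtain ⟨ρ, hρ, t, rfl⟩ := mem_pathSupport_pathFamily h0 p
        exact ⟨_, ⟨ρ, hρ, rfl⟩, t, rfl⟩
    have hj' : s.onPoint (σ.point (G.time s.j)) = .vertex (s.onV s.j) := congrArg s.onPoint hj
    have hk' : s.onPoint (σ.point (G.time s.k)) = .vertex (s.onV s.k) := congrArg s.onPoint hk
    rw [s.pathFamily_eq, ← hj', ← hk']
    refine .add _ _ _ (fun t => s.onPoint (σ.point t)) _ κ hF s.time_lt
      ⟨_, σ.mem_pathFamily, rfl⟩ ?_ hκ.1 ?_ ?_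
    · rintro t h1 h2 ht
      rw [hsupp] at ht
      obtain ⟨p, hp⟩ := ht
      exact s.onPoint_ne_new p h1 h2 hp
    · rw [← h, hν]
      exact hκ.isBridge
    · intro B hB
      have e1 : (fun ω (t : Icc (G.time s.j) (G.time s.k)) =>
          X (splice (G.time s.j) (G.time s.k) (fun t => s.onPoint (σ.point t))
            (fun t => G'.pt s.newEdge t) t) ω) =
          fun ω (t : Icc (G.time s.j) (G.time s.k)) => X (G'.pt s.newEdge t) ω := by
        funext ω t
        rw [← h, FullPath.point, pathPoint_of_mem σ'.2 hσ']
        · rw [s.src_newEdge, s.time_eq]; exact t.2.1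
        · rw [s.tgt_newEdge, s.time_eq]; exact t.2.2
      rw [e1, hsupp, ← comap_tuple s.onPoint, hj', hk']
      exact condExp_of_map_eq_compProd (measurable_pi_iff.2 fun p => hX _)
        (measurable_pi_iff.2 fun t => hX _) hlaw hB

end TLG

/-! ### The strong cell-Markov property -/

namespace TLG

variable {G : TLG} {μ : G.FullPath → Measure RCLLPath}

open Classical in
/-- The laws on the full time-paths, as laws of processes indexed by functions of time. -/
noncomputable def pathLaw (μ : G.FullPath → Measure RCLLPath) (ρ : unitInterval → G.Point) :
    Measure (unitInterval → ℝ) :=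
  if h : ∃ σ : G.FullPath, σ.point = ρ then (μ h.choose).map pathFun else 0

/-- The chosen path and `σ` agree at all times, so consistency equates their whole laws; injectivity
of `FullPath.point` is not needed. -/
theorem IsConsistent.pathLaw_point (h : IsConsistent μ) (σ : G.FullPath) :
    pathLaw μ σ.point = (μ σ).map pathFun := by
  have hex : ∃ σ' : G.FullPath, σ'.point = σ.point := ⟨σ, rfl⟩
  rw [pathLaw, dif_pos hex]
  have heq := hex.choose_spec
  generalize hex.choose = σ' at heq
  have := congrArg (Measure.map fun (y : {t // σ'.point t = σ.point t} → ℝ) t =>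
    y ⟨t, congrFun heq t⟩) (h σ' σ)
  rw [Measure.map_map, Measure.map_map] at this
  · exact this
  all_goals first
    | exact measurable_pi_iff.2 fun t => measurable_pi_apply _
    | exact measurable_pi_iff.2 fun t => measurable_coord _

theorem IsConsistent.consistentLaws (h : IsConsistent μ) :
    ConsistentLaws G.pathFamily (pathLaw μ) := by
  rintro _ ⟨σ₁, rfl⟩ _ ⟨σ₂, rfl⟩
  have hm : Measurable fun (x : unitInterval → ℝ)
      (t : {t : unitInterval // σ₁.point t = σ₂.point t}) => x t :=
    measurable_pi_iff.2 fun t => measurable_pi_apply _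
  rw [h.pathLaw_point, h.pathLaw_point, Measure.map_map hm measurable_pathFun,
    Measure.map_map hm measurable_pathFun]
  exact h σ₁ σ₂

theorem outer_eq (a b : unitInterval) : Icc 0 a ∪ Icc b 1 = outer a b := by
  ext t
  simp only [mem_union, mem_Icc, mem_outer, unitInterval.nonneg', unitInterval.le_one', true_and,
    and_true]

theorem ThreeT.ind (h : ThreeT G μ) {u v : G.V} {l₁ l₂ : List G.E} (hc : IsSimpleCell u v l₁ l₂)
    {σ : G.FullPath} (hσ : l₁ <:+: σ.1) :
    Ind (pathLaw μ σ.point) (fun t x => x t) {G.time u, G.time v}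
      (Icc (G.time u) (G.time v)) (outer (G.time u) (G.time v)) := by
  have := h.prob σ
  rw [h.consistent.pathLaw_point, Ind.map_iff measurable_pathFun fun t => measurable_pi_apply t,
    ← outer_eq]
  exact CondIndepGiven.symm (h.markov u v l₁ l₂ hc σ (.inl hσ))

theorem ThreeT.simpleMarkov (h : ThreeT G μ) : SimpleMarkov G.pathFamily (pathLaw μ) := by
  intro a b ρ₁ ρ₂ hp
  obtain ⟨σ₁, rfl⟩ := hp.left
  obtain ⟨σ₂, rfl⟩ := hp.right
  obtain ⟨u, v, l₁, l₂, hc, rfl, rfl, hi⟩ := exists_isSimpleCell hp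
  exact h.ind hc hi

end TLG

theorem mainTheorem6 {G : TLG} (T : TLG.Tower G) (μ : G.FullPath → Measure RCLLPath)
    (hμ : TLG.ThreeT G μ) {Ω : Type*} [MeasurableSpace Ω] (P : Measure Ω) [IsProbabilityMeasure P]
    (X : G.Point → Ω → ℝ) (hX : ∀ p, Measurable (X p)) (hc : TLG.IsConstructed P T μ X) :
    TLG.IsStrongCellMarkov P X := by
  have hC := TLG.constructed_of_isConstructed T hX hc hμ.consistent.pathLaw_point
  have hprob : ∀ ρ ∈ G.pathFamily, IsProbabilityMeasure (TLG.pathLaw μ ρ) := by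
    rintro _ ⟨σ, rfl⟩
    have := hμ.prob σ
    rw [hμ.consistent.pathLaw_point]
    exact Measure.isProbabilityMeasure_map TLG.measurable_pathFun.aemeasurable
  have hg : Graded G.pathFamily := TLG.graded_pathFamily
  have hlaw := hC.map_eq hX hprob hg hμ.consistent.consistentLaws hμ.simpleMarkov
  have hB := hC.markovBuilt hX hprob hg hμ.consistent.consistentLaws hμ.simpleMarkov
  -- Both sides are completed to full time-paths by a common beginning and a common end.
  have hcell : ∀ {u v : G.V} {l₁ l₂ : List G.E}, TLG.IsTrulySimpleCell u v l₁ l₂ →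
      ∃ (m n : List G.E) (σ₁ σ₂ : G.FullPath), σ₁.1 = m ++ (l₁ ++ n) ∧ σ₂.1 = m ++ (l₂ ++ n) ∧
        TLG.IsPath G.start m u ∧ TLG.IsPath v n G.finish ∧
        σ₁.point (G.time u) = .vertex u ∧ σ₁.point (G.time v) = .vertex v := by
    intro u v l₁ l₂ h
    have h0 : TLG.Reach G.start G.finish := by
      obtain ⟨_, ⟨σ, rfl⟩⟩ := hC.nonempty
      exact ⟨_, σ.2⟩
    obtain ⟨m, hm⟩ := TLG.reach_start h0 u
    obtain ⟨n, hn⟩ := TLG.reach_finish h0 v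
    exact ⟨m, n, ⟨_, hm.append (h.left.append hn)⟩, ⟨_, hm.append (h.right.append hn)⟩, rfl, rfl,
      hm, hn, TLG.FullPath.point_vertex rfl hm (h.left.append hn),
      TLG.FullPath.point_vertex (List.append_assoc _ _ _).symm (hm.append h.left) hn⟩
  refine ⟨fun u v l₁ l₂ h => ?_, fun u v l₁ l₂ h => ?_⟩
  · obtain ⟨m, n, σ₁, σ₂, h₁, h₂, hm, hn, hu, hv⟩ := hcell h
    have := hB.ind_cell hX hg _ _ _ _ (h.isTrulySimplePair h₁ h₂ hm hn)
    rwa [hu, hv, ← TLG.pathPoints_eq_image h₁ hm h.left hn h.ne_nil.1,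
      ← TLG.pathPoints_eq_image h₂ hm h.right hn h.ne_nil.2] at this
  · obtain ⟨m, n, σ, -, h₁, -, hm, hn, hu, hv⟩ := hcell h
    -- (T3) on a full time-path through the first side, carried over to `X` by the equality of laws,
    -- is the input for the invariant.
    have hI := hμ.ind h.isSimpleCell (σ := σ) ⟨m, n, by rw [h₁, List.append_assoc]⟩
    rw [← hlaw _ σ.mem_pathFamily, Ind.map_iff (measurable_pi_iff.2 fun t => hX _)
      fun t => measurable_pi_apply _] at hI
    have hI' := (Ind.image (P := P) (X := X) (f := σ.point)).2 hI
    rw [image_pair] at hI'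
    have := (hB.spineMarkov hX hg).2.ind_between_beyond hX σ.mem_pathFamily h.time_lt.le hI'
    rwa [hu, hv, ← TLG.intervalPoints_eq ⟨_, σ.2⟩, ← TLG.intervalPoints_union_eq ⟨_, σ.2⟩] at this
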